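/- Let $G$ be a finite connected plane graph (multiple edges are permitted) with at least one edge, given by its combinatorial embedding with a designated exterior face, with a positive length on each edge and with an assignment of an angle in $\{0^\circ,180^\circ,360^\circ\}$ to each corner (pair of consecutive edges at a vertex) such that the angles at every vertex sum to $360^\circ$. A *flat folding* of such a graph maps its vertices to the real line so that the ends of each edge are at a distance equal to its length. The images of the vertices divide the line into consecutive intervals (the edges of a path), and a flat folding also has, for each such interval, a linear order from bottom to top of the edges that lie over it (its magnified view), such that around each image point the stars of the vertices mapped there and the edges passing through it can be drawn without crossings in a disk with the prescribed orders on its left and right sides, preserving the cyclic order of the edges at each vertex. The folding must realize the assigned angles ($0^\circ$: the two edges point in the same direction and the corner lies between them; $180^\circ$: they point in opposite directions; $360^\circ$: they point in the same direction and the corner surrounds them), and the unbounded face must be the exterior face. Flat foldings are counted up to equivalence, where two are equivalent if they have the same magnified views in the same or in the reversed order, i.e. they differ by a translation of the line or a half-turn of the plane. For each face $f$ of $G$, the boundary of $f$ is the embedded subgraph of $G$ formed by the edges and vertices on $f$, with the induced lengths and angles (angles of corners that merge are added) and the induced exterior face; the face $f$ is called flat-foldable if this graph has a flat folding. The *Euler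 tour* cycle $C_f$ is the simple cycle obtained by making a copy of each edge of $G$ for each of its sides that belongs to $f$, joining each copy to the next one along $f$, and replacing repeated vertices by new ones. Lengths and the angles in $f$ are copied, the angles on the other side of $C_f$ are the complements to $360^\circ$, and the side of $C_f$ that corresponds to $f$ is the exterior if and only if $f$ is the exterior face of $G$. The *pattern of internal visibility* of a flat folding of $C_f$ is the set of pairs of edges of $C_f$ that are consecutive in the magnified view of at least one interval with the side corresponding to $f$ between them. Then every face of $G$ is flat-foldable if and only if every cycle $C_f$ is flat-foldable. Moreover, the number of flat foldings of $G$ up to equivalence is finite, and it is equal to the product over all faces $f$ of $G$ of the number of different patterns of internal visibility of flat foldings of $C_f$. -/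

import Mathlib

/-- A finite graph embedded in an oriented surface, together with edge lengths, an angle
assignment (in degrees) and a marked set of exterior darts.

The embedding is recorded by its rotation system.  `D` is the set of darts (edges with a
direction); `rev` reverses a dart; `rot d` is the dart that follows `d` counterclockwise among
the darts leaving the same vertex.  So the vertices are the orbits of `rot` and the edges are the
orbits of `rev`.  `angle d` is the angle of the corner swept counterclockwise from `d` to
`rot d`.  `outer` is the set of the darts that have the exterior face on their left. -/
structure AngledMap (D : Type*) where
  rev : Equiv.Perm D
  rot : Equiv.Perm D
  rev_rev : ∀ d, rev (rev d) = d
  rev_ne : ∀ d, rev d ≠ d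
  len : D → ℝ
  len_pos : ∀ d, 0 < len d
  len_rev : ∀ d, len (rev d) = len d
  angle : D → ℕ
  outer : Set D

namespace AngledMap

section Basic

variable {D : Type*} (M : AngledMap D)

/-- The next dart along the boundary of the face on the left of a dart. The corner of that face
between `d` and `faceNext d` is the one swept counterclockwise from `faceNext d` to `rev d`. -/
def faceNext : Equiv.Perm D := M.rot⁻¹ * M.rev

/-- The vertices. -/
def Vertex : Type _ := Quotient (Equiv.Perm.SameCycle.setoid M.rot)

/-- The edges. -/
def Edge : Type _ := Quotient (Equiv.Perm.SameCycle.setoid M.rev)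

/-- The faces. -/
def Face : Type _ := Quotient (Equiv.Perm.SameCycle.setoid M.faceNext)

/-- The face on the left of a dart. -/
def faceOf (d : D) : M.Face := Quotient.mk (Equiv.Perm.SameCycle.setoid M.faceNext) d

instance [Finite D] : Finite M.Face := by
  unfold Face; infer_instance

noncomputable instance [Finite D] : Fintype M.Face := Fintype.ofFinite _

/-- `M` is a connected plane graph: it is connected, its embedding has genus zero
(Euler's formula), and the exterior darts are the darts of one face. -/
structure IsPlane : Prop where
  connected : ∀ d e, Relation.EqvGen (fun a b => b = M.rot a ∨ b = M.rev a) d e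
  euler : Nat.card M.Vertex + Nat.card M.Face = Nat.card M.Edge + 2
  outer_face : ∃ f : M.Face, ∀ d, d ∈ M.outer ↔ M.faceOf d = f

open Classical in
/-- The angles are an angle assignment, and they sum to `360` at every vertex. -/
structure IsConsistent [Fintype D] : Prop where
  angle_mem : ∀ d, M.angle d = 0 ∨ M.angle d = 180 ∨ M.angle d = 360
  angle_sum : ∀ d, ∑ e with M.rot.SameCycle d e, M.angle e = 360

end Basic

section Folding

variable {D : Type*} (M : AngledMap D)

/-- The vertices of the graph are mapped to the line; `pos d` is the coordinate of the vertex that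
`d` leaves. The underlying path has the vertices `Set.range pos`, and its edges are the pairs
`(a, b)` of consecutive ones. -/
def IsPathEdge (pos : D → ℝ) (a b : ℝ) : Prop :=
  a ∈ Set.range pos ∧ b ∈ Set.range pos ∧ a < b ∧ ∀ d, ¬ (a < pos d ∧ pos d < b)

/-- `d` points to the right and its edge is mapped onto a path that contains the interval from `a`
to `b`. Every edge over the interval has exactly one such dart, which is used as its name. -/
def Over (pos : D → ℝ) (a b : ℝ) (d : D) : Prop :=
  pos d ≤ a ∧ b ≤ pos (M.rev d)

/-- `d` leaves a small disk around the point `c` of the line on its right side. -/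
def ExitsRight (pos : D → ℝ) (c : ℝ) (d : D) : Prop := pos d ≤ c ∧ c < pos (M.rev d)

/-- `d` leaves a small disk around the point `c` of the line on its left side. -/
def ExitsLeft (pos : D → ℝ) (c : ℝ) (d : D) : Prop := c ≤ pos d ∧ pos (M.rev d) < c

/-- Order of the boundary points of the disk around `c`, read counterclockwise
from the bottom: the edges on the right side from bottom to top, then the edges on the left side
from top to bottom. Here `view a b` is the order, from bottom to top, of the edges over
`(a, b)`. A boundary point is named by the dart that leaves the disk through it. -/
def Precedes (pos : D → ℝ) (view : ℝ → ℝ → D → D → Prop) (c : ℝ) (d e : D) : Prop :=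
  (M.ExitsRight pos c d ∧ M.ExitsLeft pos c e) ∨ (∃ b, view c b d e) ∨
    (∃ a, view a c (M.rev e) (M.rev d))

/-- `b` lies strictly inside the counterclockwise arc from `d` to `e` on the boundary of the disk
around `c`. If `d = e`, the arc is the whole circle without `d`. -/
def InArc (pos : D → ℝ) (view : ℝ → ℝ → D → D → Prop) (c : ℝ) (d b e : D) : Prop :=
  (M.Precedes pos view c d b ∧ M.Precedes pos view c b e) ∨
  (M.Precedes pos view c b e ∧ ¬ M.Precedes pos view c d e) ∨
  (¬ M.Precedes pos view c d e ∧ M.Precedes pos view c d b)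

open Classical in
/-- The part of the graph in the disk around `c` consists of the stars of the vertices at `c` and of
the edges that pass through `c` without a vertex there. This is the next boundary point of the
same component, counterclockwise according to the rotation system. -/
noncomputable def diskNext (pos : D → ℝ) (c : ℝ) (d : D) : D :=
  if pos d = c then M.rot d else M.rev d

open Classical in
/-- The geometric angle of the corner swept counterclockwise from `d` to `rot d`: it is `180` if
the darts point in opposite directions; if they point in the same direction, it is `0` if
the corner lies between them, and `360` otherwise (in particular if `rot d = d`). -/
noncomputable def foldedAngle (pos : D → ℝ) (view : ℝ → ℝ → D → D → Prop) (d : D) : ℕ :=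
  if (pos d < pos (M.rev d) ↔ pos (M.rot d) < pos (M.rev (M.rot d))) then
    if M.Precedes pos view (pos d) d (M.rot d) then 0 else 360
  else 180

/-- A flat folding that realizes the embedding, the lengths, the angles and the exterior face:
a one-dimensional self-touching configuration, with a map to a path on the real line
(`pos`), and for every edge `(a, b)` of the path a linear order (`view a b`) from bottom to
top of the edges over it (its magnified view). The magnified view of a point `c` of the path is
a plane embedding in a disk of the components of the graph near `c`, with the boundary points
prescribed by the orders on both sides. Such an embedding exists, and is then unique, if and only
if no component separates boundary points of another one and every component has its
boundary points in the order of its rotation; that is, if and only if each open arc between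
consecutive boundary points of a component is a union of boundaries of whole components. -/
structure FlatFolding where
  pos : D → ℝ
  view : ℝ → ℝ → D → D → Prop
  pos_rot : ∀ d, pos (M.rot d) = pos d
  abs_pos : ∀ d, |pos (M.rev d) - pos d| = M.len d
  view_support : ∀ a b d e, view a b d e →
    IsPathEdge pos a b ∧ M.Over pos a b d ∧ M.Over pos a b e
  view_irrefl : ∀ a b d, ¬ view a b d d
  view_trans : ∀ a b d e g, view a b d e → view a b e g → view a b d g
  view_total : ∀ a b d e, IsPathEdge pos a b → M.Over pos a b d → M.Over pos a b e → d ≠ e →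
    view a b d e ∨ view a b e d
  planar : ∀ c ∈ Set.range pos, ∀ d b,
    (M.ExitsRight pos c d ∨ M.ExitsLeft pos c d) → (M.ExitsRight pos c b ∨ M.ExitsLeft pos c b) →
    M.InArc pos view c d b (M.diskNext pos c d) →
    M.InArc pos view c d (M.diskNext pos c b) (M.diskNext pos c d)
  angle_eq : ∀ d, M.foldedAngle pos view d = M.angle d
  bottom_outer : ∀ a b d, IsPathEdge pos a b → M.Over pos a b d → (∀ e, ¬ view a b e d) →
    M.rev d ∈ M.outer
  top_outer : ∀ a b d, IsPathEdge pos a b → M.Over pos a b d → (∀ e, ¬ view a b d e) →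
    d ∈ M.outer

/-- There is a flat folding. -/
def FlatFoldable : Prop := Nonempty M.FlatFolding

variable {M}

/-- Two flat foldings are equivalent if they have the same magnified views, in the same order or in
the reversed order: they differ by a translation of the line, or by a rotation of the plane by
half a turn. -/
def FlatFolding.Equivalent (F G : M.FlatFolding) : Prop :=
  (∃ t : ℝ, (∀ d, G.pos d = F.pos d + t) ∧
    ∀ a b d e, G.view (a + t) (b + t) d e ↔ F.view a b d e) ∨
  (∃ t : ℝ, (∀ d, G.pos d = t - F.pos d) ∧
    ∀ a b d e, G.view (t - b) (t - a) (M.rev e) (M.rev d) ↔ F.view a b d e)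

theorem FlatFolding.equivalent_equivalence :
    Equivalence (FlatFolding.Equivalent (M := M)) where
  refl F := Or.inl ⟨0, by simp⟩
  symm := by
    rintro F G (⟨t, h1, h2⟩ | ⟨t, h1, h2⟩)
    · refine Or.inl ⟨-t, fun d => by rw [h1]; ring, fun a b d e => ?_⟩
      rw [← h2]; simp
    · refine Or.inr ⟨t, fun d => by rw [h1]; ring, fun a b d e => ?_⟩
      rw [← h2]; simp [M.rev_rev]
  trans := by
    rintro F G H (⟨t, h1, h2⟩ | ⟨t, h1, h2⟩) (⟨s, k1, k2⟩ | ⟨s, k1, k2⟩)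
    · refine Or.inl ⟨t + s, fun d => by rw [k1, h1]; ring, fun a b d e => ?_⟩
      rw [← h2, ← k2, add_assoc, add_assoc]
    · refine Or.inr ⟨s - t, fun d => by rw [k1, h1]; ring, fun a b d e => ?_⟩
      rw [← h2, ← k2, show s - t - b = s - (b + t) by ring, show s - t - a = s - (a + t) by ring]
    · refine Or.inr ⟨t + s, fun d => by rw [k1, h1]; ring, fun a b d e => ?_⟩
      rw [← h2, ← k2, show t + s - b = t - b + s by ring, show t + s - a = t - a + s by ring]
    · refine Or.inl ⟨s - t, fun d => by rw [k1, h1]; ring, fun a b d e => ?_⟩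
      rw [← h2, ← k2, M.rev_rev, M.rev_rev, show s - (t - a) = a + (s - t) by ring,
        show s - (t - b) = b + (s - t) by ring]

/-- The equivalence of flat foldings. -/
instance FlatFolding.setoid : Setoid M.FlatFolding :=
  ⟨FlatFolding.Equivalent, FlatFolding.equivalent_equivalence⟩

variable (M) in
/-- The flat foldings up to equivalence. -/
def FoldingClass : Type _ := Quotient (FlatFolding.setoid (M := M))

variable (M) in
/-- The number of flat foldings up to equivalence. -/
noncomputable def numFlatFoldings : ℕ := Nat.card M.FoldingClass

/-- The touching pairs: two edges that are consecutive in the magnified view of at least one edge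
of the path. Each of the two edges is recorded by its dart that has the space
between them on its left, so the pair also records the face in which the edges touch. -/
def FlatFolding.touching (F : M.FlatFolding) : Set (Sym2 D) :=
  {s | ∃ a b d e, F.view a b d e ∧ (∀ g, ¬ (F.view a b d g ∧ F.view a b g e)) ∧
    s = s(d, M.rev e)}

end Folding

section Restrict

variable {D : Type*} [Finite D] (M : AngledMap D)

/-- The number of steps of the rotation that lead from `d` to the next dart in `S`. -/
noncomputable def returnTime (S : Set D) (d : D) : ℕ :=
  sInf {n | 0 < n ∧ (M.rot ^ n) d ∈ S}

theorem returnTime_spec (S : Set D) (d : S) :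
    0 < M.returnTime S d ∧ (M.rot ^ M.returnTime S d) d ∈ S :=
  Nat.sInf_mem (s := {n | 0 < n ∧ (M.rot ^ n) (d : D) ∈ S})
    ⟨orderOf M.rot, orderOf_pos M.rot, by simp [pow_orderOf_eq_one]⟩

/-- The next dart in `S` in the rotation. -/
noncomputable def nextIn (S : Set D) (d : S) : S :=
  ⟨(M.rot ^ M.returnTime S d) d, (M.returnTime_spec S d).2⟩

theorem nextIn_injective (S : Set D) : Function.Injective (M.nextIn S) := by
  have key : ∀ d e : S, M.returnTime S d ≤ M.returnTime S e → M.nextIn S d = M.nextIn S e →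
      d = e := by
    intro d e hle h
    obtain ⟨k, hk⟩ := Nat.exists_eq_add_of_le hle
    have h1 : (M.rot ^ M.returnTime S d) (d : D) = (M.rot ^ M.returnTime S e) (e : D) :=
      congrArg Subtype.val h
    rw [hk, pow_add, Equiv.Perm.mul_apply] at h1
    have h2 : (d : D) = (M.rot ^ k) (e : D) := (M.rot ^ M.returnTime S d).injective h1
    rcases Nat.eq_zero_or_pos k with rfl | hpos
    · exact Subtype.ext (by simpa using h2)
    · exfalso
      have h3 : M.returnTime S e ≤ k := Nat.sInf_le ⟨hpos, h2 ▸ d.2⟩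
      have h4 := (M.returnTime_spec S d).1
      omega
  intro d e h
  rcases le_total (M.returnTime S d) (M.returnTime S e) with hle | hle
  · exact key d e hle h
  · exact (key e d hle h.symm).symm

/-- The embedded subgraph with the darts in `S`, with the induced lengths and angles. The corners
that are merged at a vertex add up their angles. The faces of the subgraph are unions of faces
across deleted edges; a dart is exterior if this leads from its face to the exterior face. -/
noncomputable def restrict (S : Set D) (hS : ∀ d ∈ S, M.rev d ∈ S) : AngledMap S where
  rev := M.rev.subtypePerm fun d => ⟨fun h => by simpa [M.rev_rev] using hS _ h, fun h => hS d h⟩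
  rot := Equiv.ofBijective (M.nextIn S) (Finite.injective_iff_bijective.1 (M.nextIn_injective S))
  rev_rev d := Subtype.ext (by simp [M.rev_rev])
  rev_ne d h := M.rev_ne d (by simpa using congrArg Subtype.val h)
  len d := M.len d
  len_pos d := M.len_pos d
  len_rev d := by simp [M.len_rev]
  angle d := ∑ i ∈ Finset.range (M.returnTime S d), M.angle ((M.rot ^ i) d)
  outer := {d | ∃ e ∈ M.outer,
    Relation.EqvGen (fun a b => b = M.faceNext a ∨ (a ∉ S ∧ b = M.rev a)) (d : D) e}

/-- A face as a graph: the embedded subgraph of the edges and vertices on its boundary, where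
repeated edges and vertices are not separated, with the induced lengths and angles. -/
noncomputable def boundaryGraph (f : M.Face) :
    AngledMap {d | M.faceOf d = f ∨ M.faceOf (M.rev d) = f} :=
  M.restrict {d | M.faceOf d = f ∨ M.faceOf (M.rev d) = f}
    (fun d h => by simpa [M.rev_rev] using h.symm)

end Restrict

section EulerTour

variable {D : Type*} (M : AngledMap D)

/-- The darts with the face `f` on their left: the sides of edges that belong to `f`. -/
abbrev FaceDart (f : M.Face) : Type _ := {d : D // M.faceOf d = f}

theorem faceOf_faceNext (d : D) : M.faceOf (M.faceNext d) = M.faceOf d :=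
  Quotient.sound (s := Equiv.Perm.SameCycle.setoid M.faceNext)
    (show M.faceNext.SameCycle _ _ from Equiv.Perm.sameCycle_apply_left.2 (.refl _ _))

/-- One step along the boundary walk of the face `f`. -/
def tourNext (f : M.Face) : Equiv.Perm (M.FaceDart f) :=
  M.faceNext.subtypePerm fun d => by rw [M.faceOf_faceNext]

open Classical in
/-- The simple cycle that the Euler tour of the face `f` gives: its edges are the sides of
edges in `f`, each side is joined to the next one along the face at a new vertex, and the lengths
and the angles in `f` are copied. The dart `(d, false)` runs along `d` and has the copy
of the face `f` on its left, and `(d, true)` is its reverse. On the other side of the cycle the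
angles are the complements to `360`. The copy of `f` is the exterior face of the cycle if and only
if `f` is the exterior face. -/
noncomputable def eulerCycle (f : M.Face) : AngledMap (M.FaceDart f × Bool) where
  rev :=
    { toFun := fun p => (p.1, !p.2)
      invFun := fun p => (p.1, !p.2)
      left_inv := fun p => by simp
      right_inv := fun p => by simp }
  rot :=
    { toFun := fun p => if p.2 then (M.tourNext f p.1, false) else ((M.tourNext f)⁻¹ p.1, true)
      invFun := fun p => if p.2 then (M.tourNext f p.1, false) else ((M.tourNext f)⁻¹ p.1, true)
      left_inv := fun p => by rcases p with ⟨d, _ | _⟩ <;> simp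
      right_inv := fun p => by rcases p with ⟨d, _ | _⟩ <;> simp }
  rev_rev p := by simp
  rev_ne p h := by simpa using congrArg Prod.snd h
  len p := M.len p.1
  len_pos p := M.len_pos p.1
  len_rev p := rfl
  angle p := if p.2 then 360 - M.angle (M.tourNext f p.1) else M.angle p.1
  outer := {p | p.2 = false ↔ (p.1 : D) ∈ M.outer}

/-- The pattern of internal visibility of a flat folding of the cycle of `f`: the pairs
of edges of the cycle that touch inside the copy of the face `f`. -/
def internalPattern (f : M.Face) (F : (M.eulerCycle f).FlatFolding) : Set (Sym2 (M.FaceDart f)) :=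
  {s | s.map (fun d => (d, false)) ∈ F.touching}

/-- The number of patterns of internal visibility of the flat foldings of the cycle of `f`. -/
noncomputable def numPatterns (f : M.Face) : ℕ :=
  (Set.range (M.internalPattern f)).ncard

end EulerTour

end AngledMap

/-! Locally, a folding is a disk around an image point. Its boundary points are ranked
counterclockwise from the bottom, and a permutation `ν` (rotation at the stars, reversal on passing
edges) is noncrossing for the ranks. If `β` is the cyclic successor, the orbits of `ν` are the
components in the disk and those of `ν⁻¹ * β` are the regions between them. Angles become integers,
angle = 180 (2 - `turn`), and planarity gives Gauss-Bonnet sums: 2 - `turn` adds up to 2 over a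
component, and `turn` adds up to 2 over a region, less 1 for each of the two marked gaps (above and
below) that it contains (`Noncrossing.sum_turn`, `Noncrossing.sum_turn_inv_mul`). The converse
drives the proof. If weights have these sums and `ν`, `ν⁻¹ * β` generate a transitive group, then
components plus regions outnumber the points by one, so every function of the points is a function
of the component minus a function of the region. It follows that `β` is a single cycle, that `ν` is
noncrossing and that the weights are the turns (`IsDisk`, `exists_rank_turn_eq`).

From the graph to its faces: a function that is constant on faces has a potential that is carried
along components and edges, so edges that touch bound a common face
(`FlatFolding.faceOf_eq_of_touching`). Doubling the edges and keeping the sides in one face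
therefore gives a folding of its cycle with the same touching pairs in that face
(`IsFaceCycle.fold`). The straight angles fix the map to the line up to isometry, and consecutive
pairs generate the linear orders. A folding is thus determined up to equivalence by its touching
pairs, that is, by the patterns of all faces (`FlatFolding.equivalent_of_touching_subset`).

From the faces to the graph: exactness of the cellular complex of the sphere first yields consistent
directions modulo 2 and then coordinates over the reals, so the foldings of all cycles can be moved
over one placement of the graph (`IsPlane.exists_placement`). In each disk the successors of the
face cycles are combined into one permutation `β`. Its region sums come from the faces and its
component sums from the angle sums at the vertices. A priori `β` could have several cycles. By
parity, the part that contains one gap contains the other, hence is a disk and a single cycle.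
Membership in this part is carried from disk to disk, and connectivity makes it everything
(`exists_isGlue_sameCycle`). The orders of all disks then fit together
(`exists_flatFolding_of_faces`), and foldings up to equivalence correspond to independent choices of
one pattern per face.

For flat-foldability of a face as a graph, `eulerCycle f` is also the cycle of a face of the
boundary graph of `f`, so `fold` applies to it. Conversely, foldable cycles glue to a folding of the
whole graph, which restricts to every subgraph because first-return maps of noncrossing permutations
are noncrossing and merged corners add their turns (`FlatFolding.restrict`). -/

namespace CyclicOrder

open Equiv.Perm

/-! ### Noncrossing permutations of a cyclic order and their corner sums -/

section Arcs

variable {Y : Type*}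

/-- `b` lies strictly inside the cyclic arc from `d` to `e`, for a cyclic order given by ranks. -/
def Arc (r : Y → ℕ) (d b e : Y) : Prop :=
  (r d < r b ∧ r b < r e) ∨ (r b < r e ∧ ¬ r d < r e) ∨ (¬ r d < r e ∧ r d < r b)

/-- Every open arc from a point to its image is mapped to itself. -/
def Noncrossing (r : Y → ℕ) (ν : Equiv.Perm Y) : Prop :=
  ∀ d b, Arc r d b (ν d) → Arc r d (ν b) (ν d)

/-- On a finite set the nonnegative powers exhaust an orbit, so forward invariance suffices. -/
theorem mem_of_sameCycle [Finite Y] {π : Equiv.Perm Y} {S : Set Y} (hS : ∀ x ∈ S, π x ∈ S)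
    {z x : Y} (hz : z ∈ S) (h : π.SameCycle z x) : x ∈ S := by
  obtain ⟨n, -, rfl⟩ := h.exists_pow_eq'
  induction n with
  | zero => simpa
  | succ n ih =>
    rw [pow_succ', Equiv.Perm.mul_apply]
    exact hS _ (ih ⟨n, by simp⟩)

/-- A permutation of a finite set that maps a subset into itself also maps its complement into
itself. -/
theorem Noncrossing.arc_iff [Finite Y] {r : Y → ℕ} {ν : Equiv.Perm Y} (h : Noncrossing r ν)
    (d b : Y) : Arc r d (ν b) (ν d) ↔ Arc r d b (ν d) := by
  refine ⟨fun hb => ?_, h d b⟩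
  exact mem_of_sameCycle (S := {x | Arc r d x (ν d)}) (fun x hx => h d x hx) hb
    (sameCycle_apply_left.2 (.refl _ _))

theorem not_arc_left (r : Y → ℕ) (d e : Y) : ¬ Arc r d d e := by
  unfold Arc; omega

/-- The ranks `0, 1, ...` are assigned in the cyclic order of `β`. -/
def IsCyclicSucc [Fintype Y] (r : Y → ℕ) (β : Equiv.Perm Y) : Prop :=
  ∀ y, r (β y) = if r y + 1 = Fintype.card Y then 0 else r y + 1

open Classical in
theorem sum_sameCycle_comp [Fintype Y] {A : Type*} [AddCommMonoid A] (π : Equiv.Perm Y) (y : Y)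
    (f : Y → A) : ∑ z with π.SameCycle y z, f (π z) = ∑ z with π.SameCycle y z, f z :=
  Finset.sum_equiv π (by simp) (by simp)

open Classical in
/-- A permutation that leaves a set of large ranks only by jumping to its bottom has one descent in
every orbit. -/
theorem sum_descents [Fintype Y] {π : Equiv.Perm Y} {r : Y → ℕ} (hr : Function.Injective r)
    (h : ∀ z, r (π z) ≤ r z → ∀ x, π.SameCycle z x → r (π z) ≤ r x) (y : Y) :
    ∑ z with π.SameCycle y z, (if r (π z) ≤ r z then (1 : ℤ) else 0) = 1 := by
  obtain ⟨m, hm, hmax⟩ := Finset.exists_max_image (Finset.univ.filter fun z => π.SameCycle y z) r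
    ⟨y, by simp [SameCycle.refl]⟩
  simp only [Finset.mem_filter, Finset.mem_univ, true_and] at hm hmax
  have h1 : r (π m) ≤ r m := hmax _ (sameCycle_apply_right.2 hm)
  rw [Finset.sum_eq_single m]
  · simp [h1]
  · intro z hz hne
    simp only [Finset.mem_filter, Finset.mem_univ, true_and] at hz
    rw [if_neg]
    intro h2
    -- Every descent lands on the minimum of its orbit, so two descents of one orbit have the same
    -- image.
    have h3 := h m h1 (π z) (hm.symm.trans (sameCycle_apply_right.2 hz))
    have h4 := h z h2 (π m) (hz.symm.trans (sameCycle_apply_right.2 hm))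
    exact hne (π.injective (hr (le_antisymm h4 h3)))
  · simp [hm]

/-- At a descent, the arc from `z` to `ν z` wraps around and contains every rank below that of `ν
z`. The arc is invariant and omits `z`, so the orbit of `z` avoids it. -/
theorem Noncrossing.descent [Fintype Y] {r : Y → ℕ} {ν : Equiv.Perm Y} (h : Noncrossing r ν)
    (z : Y) (hz : r (ν z) ≤ r z) (x : Y) (hx : ν.SameCycle z x) : r (ν z) ≤ r x := by
  have := mem_of_sameCycle (S := {x | ¬ Arc r z x (ν z)})
    (fun x hx => by simpa [h.arc_iff] using hx) (not_arc_left r z _) hx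
  simp only [Set.mem_ofPred_eq, Arc] at this
  omega

/-- Put `d = ν⁻¹ (β z)`. The ranks after `d` up to `z` form the arc from `d` to `ν d`. `β` moves the
other points of the block from `d` to `z` into this arc and `ν⁻¹` preserves it, so the block is
invariant and `d` is its minimum. -/
theorem Noncrossing.descent_inv_mul [Fintype Y] {r : Y → ℕ} {ν β : Equiv.Perm Y}
    (h : Noncrossing r ν) (hr : Function.Injective r) (hlt : ∀ y, r y < Fintype.card Y)
    (hβ : IsCyclicSucc r β)
    (z : Y) (hz : r ((ν⁻¹ * β) z) ≤ r z) (x : Y) (hx : (ν⁻¹ * β).SameCycle z x) :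
    r ((ν⁻¹ * β) z) ≤ r x := by
  set d := (ν⁻¹ * β) z with hd
  have hνd : ν d = β z := by simp [hd]
  have hinv : ∀ y, ν ((ν⁻¹ * β) y) = β y := fun y => by simp
  -- If `z` is last, then `β z` has rank 0 and the arc consists of all ranks above that of `d`.
  by_cases hlast : r z + 1 = Fintype.card Y
  · have h0 : r (ν d) = 0 := by rw [hνd, hβ, if_pos hlast]
    refine mem_of_sameCycle (S := {x | r d ≤ r x}) (fun y hy => ?_) hz hx
    simp only [Set.mem_ofPred_eq] at hy ⊢
    by_cases hyl : r y + 1 = Fintype.card Y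
    · have : y = z := hr (by omega)
      subst this
      exact hd ▸ le_rfl
    · have h1 : Arc r d (β y) (ν d) := by
        unfold Arc; rw [hβ y, if_neg hyl]; omega
      rw [← hinv y, h.arc_iff] at h1
      unfold Arc at h1
      omega
  · have h0 : r (ν d) = r z + 1 := by rw [hνd, hβ, if_neg hlast]
    refine (mem_of_sameCycle (S := {x | r d ≤ r x ∧ r x ≤ r z}) (fun y hy => ?_)
      ⟨hz, le_rfl⟩ hx).1
    simp only [Set.mem_ofPred_eq] at hy ⊢
    by_cases hyz : y = z
    · subst hyz
      exact ⟨hd ▸ le_rfl, hd ▸ hz⟩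
    · have hne : r y ≠ r z := fun h => hyz (hr h)
      have hyl := hlt z
      have h1 : Arc r d (β y) (ν d) := by
        unfold Arc; rw [hβ y, if_neg (by omega)]; omega
      rw [← hinv y, h.arc_iff] at h1
      unfold Arc at h1
      omega

open Classical in
/-- Twice the defect of the corner between a boundary point and the next one of its component, in
units of half a turn; `σ` is `0` on the right side and `1` on the left side. -/
noncomputable def turn (r : Y → ℕ) (σ : Y → ℤ) (ν : Equiv.Perm Y) (y : Y) : ℤ :=
  2 * (if r y < r (ν y) then 1 else 0) + σ y - σ (ν y)

open Classical in
-- The terms in `σ` telescope along the orbit, and its only descent contributes 2.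
theorem Noncrossing.sum_turn [Fintype Y] {r : Y → ℕ} {ν : Equiv.Perm Y} (h : Noncrossing r ν)
    (hr : Function.Injective r) (σ : Y → ℤ) (y : Y) :
    ∑ z with ν.SameCycle y z, (2 - turn r σ ν z) = 2 := by
  have h1 := sum_descents hr h.descent y
  have h2 := sum_sameCycle_comp ν y σ
  have h3 : ∀ z, 2 - turn r σ ν z =
      2 * (if r (ν z) ≤ r z then (1 : ℤ) else 0) - σ z + σ (ν z) := by
    intro z
    unfold turn
    by_cases hz : r z < r (ν z)
    · rw [if_pos hz, if_neg (by omega)]; ring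
    · rw [if_neg hz, if_pos (by omega)]; ring
  simp only [h3, Finset.sum_add_distrib, Finset.sum_sub_distrib, ← Finset.mul_sum, h1, h2]
  ring

open Classical in
-- With `ψ = ν⁻¹ * β`, the corner at `ψ z` ends at the successor `β z`, so its turn compares the
-- ranks of `ψ z` and `z`. The single descent contributes 2, and the correction is 1 at each of the
-- gaps after `t` and after `b`, where the side changes or the ranks start again.
theorem Noncrossing.sum_turn_inv_mul [Fintype Y] {r : Y → ℕ} {ν β : Equiv.Perm Y}
    (h : Noncrossing r ν) (hr : Function.Injective r) (hlt : ∀ y, r y < Fintype.card Y)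
    (hβ : IsCyclicSucc r β) {σ : Y → ℤ} {t b : Y} (hb : r b + 1 = Fintype.card Y)
    (hσ : ∀ y, y ≠ t → y ≠ b → σ (β y) = σ y)
    (htb : (t = b ∧ σ (β b) = σ b) ∨
      (t ≠ b ∧ σ t = 0 ∧ σ (β t) = 1 ∧ σ b = 1 ∧ σ (β b) = 0)) (y : Y) :
    ∑ z with (ν⁻¹ * β).SameCycle y z, turn r σ ν z =
      2 - (if (ν⁻¹ * β).SameCycle y t then 1 else 0) -
        (if (ν⁻¹ * β).SameCycle y b then 1 else 0) := by
  set ψ := ν⁻¹ * β with hψ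
  have h1 := sum_descents hr (h.descent_inv_mul hr hlt hβ) y
  rw [← hψ] at h1
  have h2 := sum_sameCycle_comp ψ y σ
  have hinv : ∀ y, ν (ψ y) = β y := fun y => by simp [hψ]
  have hsingle : ∀ c : Y, ∑ z with ψ.SameCycle y z, (if z = c then (1 : ℤ) else 0) =
      if ψ.SameCycle y c then 1 else 0 := by
    intro c
    rw [Finset.sum_ite_eq']
    simp
  rw [← sum_sameCycle_comp ψ y (turn r σ ν), ← hsingle t, ← hsingle b]
  have h3 : ∀ z, turn r σ ν (ψ z) = 2 * (if r (ψ z) ≤ r z then (1 : ℤ) else 0) + σ (ψ z) - σ z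
      - (if z = t then 1 else 0) - (if z = b then 1 else 0) := by
    intro z
    unfold turn
    rw [hinv]
    by_cases hzb : z = b
    · subst hzb
      have h4 : r (β z) = 0 := by rw [hβ, if_pos hb]
      have h5 := hlt (ψ z)
      rw [if_neg (by omega), if_pos (by omega), if_pos rfl]
      rcases htb with ⟨rfl, h6⟩ | ⟨h7, -, -, h8, h9⟩
      · rw [if_pos rfl, h6]; ring
      · rw [if_neg (Ne.symm h7), h8, h9]; ring
    · have h4 : r z ≠ r b := fun h => hzb (hr h)
      have h5 := hlt z
      have h6 : r (β z) = r z + 1 := by rw [hβ, if_neg (by omega)]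
      rw [if_neg hzb, h6]
      have h7 : (if r (ψ z) < r z + 1 then (1 : ℤ) else 0) = if r (ψ z) ≤ r z then 1 else 0 := by
        simp only [Nat.lt_succ_iff]
      rw [h7]
      by_cases hzt : z = t
      · subst hzt
        rcases htb with ⟨h8, -⟩ | ⟨h7, h8, h9, -, -⟩
        · exact absurd h8 hzb
        · rw [if_pos rfl, h8, h9]; ring
      · rw [if_neg hzt, hσ z hzt hzb]; ring
  simp only [h3, Finset.sum_add_distrib, Finset.sum_sub_distrib, ← Finset.mul_sum, h1, h2]
  ring

open Classical in
/-- The prefix sums of the jumps of a function along the orbits of a noncrossing permutation differ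
from this function by an invariant function. -/
theorem Noncrossing.prefix_sum [Fintype Y] {r : Y → ℕ} {ν : Equiv.Perm Y} (h : Noncrossing r ν)
    (hr : Function.Injective r) (P : Y → ℤ) (d : Y) :
    ∑ z with r z ≤ r (ν d), (P z - P (ν⁻¹ z)) - P (ν d) =
      ∑ z with r z ≤ r d, (P z - P (ν⁻¹ z)) - P d := by
  set f : Y → ℤ := fun z => P z - P (ν⁻¹ z) with hf
  have htot : ∑ z, f z = 0 := by
    simp only [hf, Finset.sum_sub_distrib]
    rw [Equiv.sum_comp ν⁻¹ P, sub_self]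
  -- The arc is a union of orbits, on each of which the jumps telescope.
  have harc : ∑ z, (if Arc r d z (ν d) then f z else 0) = 0 := by
    have h1 : ∑ z, (if Arc r d z (ν d) then P z else 0) =
        ∑ z, (if Arc r d z (ν d) then P (ν⁻¹ z) else 0) := by
      rw [← Equiv.sum_comp ν (fun z => if Arc r d z (ν d) then P (ν⁻¹ z) else 0)]
      simp [h.arc_iff]
    rw [← sub_eq_zero, ← Finset.sum_sub_distrib] at h1
    refine (Finset.sum_congr rfl fun z _ => ?_).trans h1
    simp only [hf]
    split_ifs <;> ring
  -- The prefix up to `ν d` is the prefix up to `d`, the open arc and the point `ν d`. If the arc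
  -- wraps around, everything has been counted once too often, and the total is 0.
  have hpt : ∀ z, (if r z ≤ r (ν d) then f z else 0) = (if r z ≤ r d then f z else 0) +
      (if Arc r d z (ν d) then f z else 0) + (if z = ν d then f z else 0) -
      (if r d < r (ν d) then 0 else f z) := by
    intro z
    have h1 : z = ν d ↔ r z = r (ν d) := ⟨fun h => h ▸ rfl, fun h => hr h⟩
    rw [h1]
    unfold Arc
    split_ifs <;> first | (exfalso; omega) | ring
  have hsum := Finset.sum_congr (rfl : (Finset.univ : Finset Y) = Finset.univ) (fun z _ => hpt z)
  rw [Finset.sum_sub_distrib, Finset.sum_add_distrib, Finset.sum_add_distrib, harc,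
    Finset.sum_ite_eq' Finset.univ (ν d) f] at hsum
  rw [Finset.sum_filter, Finset.sum_filter, hsum]
  have h5 : ∑ z, (if r d < r (ν d) then 0 else f z) = 0 := by
    split_ifs <;> simp [htot]
  have h6 : f (ν d) = P (ν d) - P d := by simp [hf]
  rw [h5, if_pos (Finset.mem_univ _), h6]
  ring

end Arcs

/-! ### Counting components and regions, and the converse for disks -/

section Incidence

variable {Y : Type*}

/-- The orbits of a permutation. -/
abbrev Orbits (π : Equiv.Perm Y) : Type _ := Quotient (SameCycle.setoid π)

/-- The two permutations generate a transitive group. -/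
def Transitive (ν ψ : Equiv.Perm Y) : Prop :=
  ∀ x y, Relation.EqvGen (fun a b => b = ν a ∨ b = ψ a) x y

theorem Transitive.eq_of_invariant {ν ψ : Equiv.Perm Y} (h : Transitive ν ψ) {α : Type*}
    {s : Y → α} (h1 : ∀ y, s (ν y) = s y) (h2 : ∀ y, s (ψ y) = s y) (x y : Y) : s x = s y := by
  induction h x y with
  | rel x y hxy => rcases hxy with rfl | rfl <;> simp [h1, h2]
  | refl => rfl
  | symm _ _ _ ih => exact ih.symm
  | trans _ _ _ _ _ ih1 ih2 => exact ih1.trans ih2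

variable (K : Type*) [Field K] (ν ψ : Equiv.Perm Y)

/-- The differences of functions on two sets of orbits. -/
def incidence : ((Orbits ν → K) × (Orbits ψ → K)) →ₗ[K] (Y → K) where
  toFun p y := p.1 (Quotient.mk _ y) - p.2 (Quotient.mk _ y)
  map_add' p q := by ext y; simp; ring
  map_smul' c p := by ext y; simp; ring

variable {K ν ψ}

/-- A pair in the kernel has a common pullback to the points. It is invariant under both
permutations and constant by transitivity, so the kernel has dimension at most 1. -/
theorem finrank_range_incidence [Finite Y] (h : Transitive ν ψ) :
    Nat.card (Orbits ν) + Nat.card (Orbits ψ) ≤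
      Module.finrank K (LinearMap.range (incidence K ν ψ)) + 1 := by
  have : Fintype (Orbits ν) := Fintype.ofFinite _
  have : Fintype (Orbits ψ) := Fintype.ofFinite _
  have h1 := LinearMap.finrank_range_add_finrank_ker (incidence K ν ψ)
  have h2 : LinearMap.ker (incidence K ν ψ) ≤ Submodule.span K {(fun _ => 1, fun _ => 1)} := by
    intro p hp
    rw [LinearMap.mem_ker] at hp
    have hp1 : ∀ y, p.1 (Quotient.mk _ y) = p.2 (Quotient.mk _ y) := fun y =>
      sub_eq_zero.1 (congrFun hp y)
    rw [Submodule.mem_span_singleton]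
    rcases isEmpty_or_nonempty Y with hY | ⟨⟨y0⟩⟩
    · refine ⟨0, ?_⟩
      ext q
      · exact q.inductionOn fun y => hY.elim y
      · exact q.inductionOn fun y => hY.elim y
    · have hc : ∀ y, p.1 (Quotient.mk _ y) = p.1 (Quotient.mk _ y0) := fun y =>
        h.eq_of_invariant (s := fun y => p.1 (Quotient.mk _ y))
          (fun y => congrArg p.1 (Quotient.sound (sameCycle_apply_left.2 (.refl _ _))))
          (fun y => by
            rw [hp1, hp1]
            exact congrArg p.2 (Quotient.sound (sameCycle_apply_left.2 (.refl _ _)))) y y0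
      refine ⟨p.1 (Quotient.mk _ y0), ?_⟩
      ext q
      · exact q.inductionOn fun y => by simp [hc y]
      · exact q.inductionOn fun y => by simp [← hp1, hc y]
  have h3 : Module.finrank K (LinearMap.ker (incidence K ν ψ)) ≤ 1 :=
    (Submodule.finrank_mono h2).trans
      ((finrank_span_le_card _).trans (by simp))
  rw [Module.finrank_prod, Module.finrank_pi, Module.finrank_pi] at h1
  rw [Nat.card_eq_fintype_card, Nat.card_eq_fintype_card]
  omega

open Classical in
theorem sum_orbits [Fintype Y] {A : Type*} [AddCommMonoid A] (π : Equiv.Perm Y) (f : Y → A)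
    [Fintype (Orbits π)] :
    ∑ q : Orbits π, ∑ z with π.SameCycle q.out z, f z = ∑ z, f z := by
  rw [← Finset.sum_fiberwise Finset.univ (fun z => (Quotient.mk _ z : Orbits π)) f]
  refine Finset.sum_congr rfl fun q _ => Finset.sum_congr ?_ fun _ _ => rfl
  ext z
  simp only [Finset.mem_filter, Finset.mem_univ, true_and]
  conv_rhs => rw [← q.out_eq, eq_comm]
  exact (Quotient.eq (r := SameCycle.setoid π)).symm

open Classical in
theorem sum_mul_invariant [Fintype Y] {π : Equiv.Perm Y} {φ u : Y → K}
    (hφ : ∀ y, φ (π y) = φ y) (hu : ∀ y, ∑ z with π.SameCycle y z, u z = 0) :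
    ∑ y, u y * φ y = 0 := by
  have : Fintype (Orbits π) := Fintype.ofFinite _
  rw [← sum_orbits π]
  refine Finset.sum_eq_zero fun q _ => ?_
  have : ∀ z, π.SameCycle q.out z → φ z = φ q.out := fun z hz =>
    mem_of_sameCycle (S := {z | φ z = φ q.out}) (fun x hx => (hφ x).trans hx) rfl hz
  rw [Finset.sum_congr rfl (g := fun z => u z * φ q.out)]
  · rw [← Finset.sum_mul, hu, zero_mul]
  · intro z hz
    rw [this z (by simpa using hz)]

open Classical in
theorem sum_orbits_indicator [Fintype Y] (π : Equiv.Perm Y) [Fintype (Orbits π)] (t : Y) :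
    ∑ q : Orbits π, (if π.SameCycle q.out t then (1 : ℤ) else 0) = 1 := by
  rw [Finset.sum_eq_single (Quotient.mk _ t)]
  · rw [if_pos]
    exact Quotient.exact (s := SameCycle.setoid π) (Quotient.out_eq _)
  · intro q _ hq
    rw [if_neg]
    intro h
    refine hq ?_
    rw [← q.out_eq]
    exact Quotient.sound h
  · simp

open Classical in
/-- The corner defects `w` have the sums that a disk with the gaps `t` and `b` requires. -/
structure IsDisk [Fintype Y] (ν ψ : Equiv.Perm Y) (w : Y → ℤ) (t b : Y) : Prop where
  transitive : Transitive ν ψ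
  sum_component : ∀ y, ∑ z with ν.SameCycle y z, (2 - w z) = 2
  sum_region : ∀ y, ∑ z with ψ.SameCycle y z, w z =
    2 - (if ψ.SameCycle y t then 1 else 0) - (if ψ.SameCycle y b then 1 else 0)

section

variable [Fintype Y]

open Classical in
-- Parity: adding all the sums would give twice the number of points as an even number plus an odd
-- one.
theorem not_sum_region_single {w : Y → ℤ} {t : Y}
    (hν : ∀ y, ∑ z with ν.SameCycle y z, (2 - w z) = 2)
    (hψ : ∀ y, ∑ z with ψ.SameCycle y z, w z = 2 - (if ψ.SameCycle y t then 1 else 0)) :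
    False := by
  have : Fintype (Orbits ν) := Fintype.ofFinite _
  have : Fintype (Orbits ψ) := Fintype.ofFinite _
  have h1 := sum_orbits ν (fun z => 2 - w z)
  have h2 := sum_orbits ψ w
  simp only [hν, hψ, Finset.sum_sub_distrib, sum_orbits_indicator] at h1 h2
  simp only [Finset.sum_const, Finset.card_univ, nsmul_eq_mul] at h1 h2
  omega

variable {w : Y → ℤ} {t b : Y}

/-- The Euler characteristic of a disk: adding the sums over all components and all regions cancels
`w`. -/
theorem IsDisk.card_orbits (h : IsDisk ν ψ w t b) :
    Nat.card (Orbits ν) + Nat.card (Orbits ψ) = Fintype.card Y + 1 := by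
  have : Fintype (Orbits ν) := Fintype.ofFinite _
  have : Fintype (Orbits ψ) := Fintype.ofFinite _
  have h1 := sum_orbits ν (fun z => 2 - w z)
  have h2 := sum_orbits ψ w
  simp only [h.sum_component, h.sum_region, Finset.sum_sub_distrib, sum_orbits_indicator] at h1 h2
  simp only [Finset.sum_const, Finset.card_univ, nsmul_eq_mul] at h1 h2
  rw [Nat.card_eq_fintype_card, Nat.card_eq_fintype_card]
  omega

/-- By `card_orbits`, the lower bound for the rank of the incidence map equals the dimension of its
target. -/
theorem IsDisk.exists_sub_eq (h : IsDisk ν ψ w t b) (g : Y → ℚ) :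
    ∃ φ χ : Y → ℚ, (∀ y, φ (ν y) = φ y) ∧ (∀ y, χ (ψ y) = χ y) ∧ ∀ y, g y = φ y - χ y := by
  have h1 := finrank_range_incidence (K := ℚ) h.transitive
  rw [h.card_orbits] at h1
  have h2 : LinearMap.range (incidence ℚ ν ψ) = ⊤ := by
    apply Submodule.eq_top_of_finrank_eq
    have h3 := Submodule.finrank_le (LinearMap.range (incidence ℚ ν ψ))
    rw [Module.finrank_pi] at h3 ⊢
    omega
  obtain ⟨p, hp⟩ := LinearMap.range_eq_top.1 h2 g
  refine ⟨fun y => p.1 (Quotient.mk _ y), fun y => p.2 (Quotient.mk _ y), fun y => ?_,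
    fun y => ?_, fun y => (congrFun hp y).symm⟩
  · exact congrArg p.1 (Quotient.sound (sameCycle_apply_left.2 (.refl _ _)))
  · exact congrArg p.2 (Quotient.sound (sameCycle_apply_left.2 (.refl _ _)))

open Classical in
-- Such a `u` is orthogonal to all functions of the component and to all functions of the region,
-- hence to itself. The coefficients are rational so that a vanishing sum of squares forces zero.
theorem IsDisk.eq_zero (h : IsDisk ν ψ w t b) {u : Y → ℚ}
    (hν : ∀ y, ∑ z with ν.SameCycle y z, u z = 0)
    (hψ : ∀ y, ∑ z with ψ.SameCycle y z, u z = 0) (y : Y) : u y = 0 := by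
  obtain ⟨φ, χ, h1, h2, h3⟩ := h.exists_sub_eq u
  have h4 : ∑ y, u y * u y = 0 := by
    have : ∀ y, u y * u y = u y * φ y - u y * χ y := fun y => by
      rw [← mul_sub, ← h3]
    simp only [this, Finset.sum_sub_distrib, sum_mul_invariant h1 hν, sum_mul_invariant h2 hψ,
      sub_zero]
  have h5 := (Finset.sum_eq_zero_iff_of_nonneg (fun y _ => mul_self_nonneg (u y))).1 h4 y
    (Finset.mem_univ y)
  exact mul_self_eq_zero.1 h5

/-- The difference `s - s ∘ ν` telescopes over the orbits of `ν`. On an orbit of `ψ` it telescopes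
as well, after a shift by `ψ`, because `s ∘ ν ∘ ψ = s`. It is therefore zero. -/
theorem IsDisk.eq_of_invariant (h : IsDisk ν ψ w t b) {s : Y → ℚ}
    (hs : ∀ y, s (ν (ψ y)) = s y) (x y : Y) : s x = s y := by
  classical
  have h1 : ∀ y, s (ν y) = s y := by
    intro y
    have := h.eq_zero (u := fun y => s y - s (ν y)) (fun y => by
      rw [Finset.sum_sub_distrib, sum_sameCycle_comp ν y s, sub_self]) (fun y => by
      rw [← sum_sameCycle_comp ψ y]
      simp only [hs, Finset.sum_sub_distrib]
      rw [sum_sameCycle_comp ψ y s, sub_self]) y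
    linarith
  exact h.transitive.eq_of_invariant h1 (fun y => by rw [← hs y, h1]) x y

/-- The indicator function of an orbit of `ν * ψ` is constant. -/
theorem IsDisk.sameCycle (h : IsDisk ν ψ w t b) (x y : Y) : (ν * ψ).SameCycle x y := by
  classical
  have := h.eq_of_invariant (s := fun y => if (ν * ψ).SameCycle x y then 1 else 0)
    (fun y => by
      have : (ν * ψ).SameCycle x (ν (ψ y)) ↔ (ν * ψ).SameCycle x y :=
        sameCycle_apply_right (f := ν * ψ)
      simp only [this]) x y
  by_contra hc
  simp [hc, SameCycle.refl] at this

theorem exists_rank {β : Equiv.Perm Y} (h : ∀ x y, β.SameCycle x y) (y0 : Y) :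
    ∃ r : Y → ℕ, Function.Injective r ∧ (∀ y, r y < Fintype.card Y) ∧ IsCyclicSucc r β ∧
      r y0 = 0 := by
  classical
  have hc : β.IsCycleOn (Finset.univ : Finset Y) :=
    ⟨by simp [β.bijective.bijOn_univ], fun x _ y _ => h x y⟩
  have h1 : ∀ y, ∃ n < Fintype.card Y, (β ^ n) y0 = y := fun y =>
    hc.exists_pow_eq (Finset.mem_univ _) (Finset.mem_univ _)
  choose r hlt hr using h1
  have huniq : ∀ m n, m < Fintype.card Y → n < Fintype.card Y → (β ^ m) y0 = (β ^ n) y0 →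
      m = n := by
    intro m n hm hn hmn
    have := (hc.pow_apply_eq_pow_apply (Finset.mem_univ y0)).1 hmn
    exact Nat.ModEq.eq_of_lt_of_lt this hm hn
  have hpos : 0 < Fintype.card Y := Fintype.card_pos_iff.2 ⟨y0⟩
  refine ⟨r, fun x y hxy => by rw [← hr x, ← hr y, hxy], hlt, fun y => ?_,
    huniq _ _ (hlt _) hpos (by simpa using hr y0)⟩
  have h2 : (β ^ (r y + 1)) y0 = β y := by rw [pow_succ', Equiv.Perm.mul_apply, hr]
  split_ifs with h3
  · refine huniq _ _ (hlt _) hpos ?_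
    rw [hr, ← h2, h3]
    exact (hc.pow_apply_eq (Finset.mem_univ y0)).2 (by simp)
  · have := hlt y
    exact huniq _ _ (hlt _) (by omega) (by rw [hr, h2])

/-- Write the point mass at `d` as a function `φ` of the component minus a function of the region.
Along the successor `φ` changes only on leaving `d` and on reaching `ν d`, exactly opposite to the
indicator of the arc between them. Their sum is constant, so this indicator is invariant under `ν`,
as `φ` is. -/
theorem IsDisk.noncrossing (h : IsDisk ν ψ w t b) {r : Y → ℕ} (hr : Function.Injective r)
    (hlt : ∀ y, r y < Fintype.card Y) (hβ : IsCyclicSucc r (ν * ψ)) : Noncrossing r ν := by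
  classical
  intro d x hx
  obtain ⟨φ, χ, h1, h2, h3⟩ := h.exists_sub_eq (fun y => if y = d then 1 else 0)
  have h4 : ∀ y, φ (ν (ψ y)) = φ y - (if y = d then 1 else 0) +
      (if ν (ψ y) = ν d then 1 else 0) := by
    intro y
    rw [h1]
    have h5 := h3 y
    have h6 := h3 (ψ y)
    rw [h2] at h6
    simp only [ν.injective.eq_iff]
    linarith
  have h5 : ∀ y, φ (ν (ψ y)) + (if Arc r d (ν (ψ y)) (ν d) then 1 else 0) =
      φ y + (if Arc r d y (ν d) then 1 else 0) := by
    intro y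
    rw [h4]
    have e1 : y = d ↔ r y = r d := hr.eq_iff.symm
    have e2 : ν (ψ y) = ν d ↔ r (ν (ψ y)) = r (ν d) := hr.eq_iff.symm
    have e3 := hβ y
    rw [Equiv.Perm.mul_apply] at e3
    have e4 := hlt y
    have e5 := hlt d
    have e6 := hlt (ν d)
    rw [e1, e2]
    unfold Arc
    split_ifs at e3 <;> rw [e3] <;> split_ifs <;> first | (exfalso; omega) | ring
  have h6 : ∀ y, φ y + (if Arc r d y (ν d) then 1 else 0) = φ d := by
    intro y
    rw [h.eq_of_invariant (s := fun y => φ y + (if Arc r d y (ν d) then 1 else 0)) h5 y d,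
      if_neg (not_arc_left r d _), add_zero]
  have h7 := h6 x
  have h8 := h6 (ν x)
  rw [h1] at h8
  rw [if_pos hx] at h7
  by_contra hc
  rw [if_neg hc] at h8
  linarith

end

end Incidence

end CyclicOrder

/-! ### Ranks of a linear order -/

namespace CyclicOrder

variable {Y : Type*} [Fintype Y]

open Classical in
/-- The number of predecessors. -/
noncomputable def rankOf (R : Y → Y → Prop) (y : Y) : ℕ := (Finset.univ.filter (R · y)).card

variable {R : Y → Y → Prop}

theorem rankOf_lt_rankOf_iff (hi : ∀ x, ¬ R x x) (ht : ∀ x y z, R x y → R y z → R x z)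
    (hc : ∀ x y, x ≠ y → R x y ∨ R y x) (x y : Y) : rankOf R x < rankOf R y ↔ R x y := by
  have key : ∀ x y, R x y → rankOf R x < rankOf R y := by
    intro x y h
    refine Finset.card_lt_card (Finset.ssubset_iff_of_subset ?_ |>.2 ⟨x, ?_, ?_⟩)
    · intro z
      simpa using fun hz => ht z x y hz h
    · simpa using h
    · simpa using hi x
  refine ⟨fun h => ?_, key x y⟩
  by_contra hn
  rcases eq_or_ne x y with rfl | hne
  · omega
  · have := key y x ((hc x y hne).resolve_left hn)
    omega

theorem rankOf_injective (hi : ∀ x, ¬ R x x) (ht : ∀ x y z, R x y → R y z → R x z)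
    (hc : ∀ x y, x ≠ y → R x y ∨ R y x) : Function.Injective (rankOf R) := by
  intro x y h
  by_contra hne
  rcases hc x y hne with h' | h' <;> have := (rankOf_lt_rankOf_iff hi ht hc _ _).2 h' <;> omega

theorem rankOf_lt_card (hi : ∀ x, ¬ R x x) (y : Y) : rankOf R y < Fintype.card Y :=
  Finset.card_lt_card (Finset.ssubset_univ_iff.2 fun h => hi y (by
    have := h ▸ Finset.mem_univ y
    simpa using this))

end CyclicOrder

namespace AngledMap

open CyclicOrder

/-! ### Placements and the permutation of a disk -/

section Placement

variable {D : Type*} (M : AngledMap D)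

/-- A map of the vertices to the line that respects the lengths. -/
structure IsPlacement (pos : D → ℝ) : Prop where
  rot : ∀ d, pos (M.rot d) = pos d
  abs : ∀ d, |pos (M.rev d) - pos d| = M.len d

/-- `d` leaves a small disk around `c`. -/
def Exits (pos : D → ℝ) (c : ℝ) (d : D) : Prop := M.ExitsRight pos c d ∨ M.ExitsLeft pos c d

/-- The boundary points of the disk around `c`. -/
abbrev DiskDart (pos : D → ℝ) (c : ℝ) : Type _ := {d : D // M.Exits pos c d}

noncomputable instance [Finite D] (pos : D → ℝ) (c : ℝ) : Fintype (M.DiskDart pos c) :=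
  Fintype.ofFinite _

variable {M} {pos : D → ℝ}

theorem IsPlacement.pos_ne (h : M.IsPlacement pos) (d : D) : pos (M.rev d) ≠ pos d := by
  intro h1
  have h2 := h.abs d
  rw [h1, sub_self, abs_zero] at h2
  exact (M.len_pos d).ne h2

theorem IsPlacement.exits_self (h : M.IsPlacement pos) (d : D) : M.Exits pos (pos d) d := by
  rcases (h.pos_ne d).lt_or_gt with h1 | h1
  · exact Or.inr ⟨le_rfl, h1⟩
  · exact Or.inl ⟨le_rfl, h1⟩

theorem Exits.rev {c : ℝ} {d : D} (h : M.Exits pos c d) (hd : pos d ≠ c) :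
    M.Exits pos c (M.rev d) ∧ pos (M.rev d) ≠ c := by
  simp only [Exits, ExitsRight, ExitsLeft, M.rev_rev] at h ⊢
  rcases h with ⟨h1, h2⟩ | ⟨h1, h2⟩
  · exact ⟨Or.inr ⟨h2.le, lt_of_le_of_ne h1 hd⟩, h2.ne'⟩
  · exact ⟨Or.inl ⟨h2.le, lt_of_le_of_ne h1 hd.symm⟩, h2.ne⟩

theorem rot_inv_pos (h : M.IsPlacement pos) (d : D) : pos (M.rot⁻¹ d) = pos d := by
  rw [← h.rot (M.rot⁻¹ d)]; simp

open Classical in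
/-- The rotation of the components in the disk around `c`. -/
noncomputable def IsPlacement.diskPerm (h : M.IsPlacement pos) (c : ℝ) :
    Equiv.Perm (M.DiskDart pos c) where
  toFun y := ⟨M.diskNext pos c y, by
    unfold diskNext
    split_ifs with hy
    · have := h.exits_self (M.rot y)
      rwa [h.rot, hy] at this
    · exact (y.2.rev hy).1⟩
  invFun y := ⟨if pos y = c then M.rot⁻¹ y else M.rev y, by
    split_ifs with hy
    · have := h.exits_self (M.rot⁻¹ y)
      rwa [rot_inv_pos h, hy] at this
    · exact (y.2.rev hy).1⟩
  left_inv y := by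
    apply Subtype.ext
    by_cases hy : pos y = c
    · simp [diskNext, hy, h.rot]
    · simp [diskNext, hy, (y.2.rev hy).2, M.rev_rev]
  right_inv y := by
    apply Subtype.ext
    by_cases hy : pos y = c
    · have : pos ((Equiv.symm M.rot) y) = c := (rot_inv_pos h y).trans hy
      simp [diskNext, hy, this]
    · simp [diskNext, hy, (y.2.rev hy).2, M.rev_rev]

theorem IsPlacement.diskPerm_of_eq (h : M.IsPlacement pos) {c : ℝ} (y : M.DiskDart pos c)
    (hy : pos y = c) : (h.diskPerm c y : D) = M.rot y := if_pos hy

theorem IsPlacement.diskPerm_of_ne (h : M.IsPlacement pos) {c : ℝ} (y : M.DiskDart pos c)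
    (hy : pos y ≠ c) : (h.diskPerm c y : D) = M.rev y := if_neg hy

theorem IsPlacement.diskPerm_inv_of_eq (h : M.IsPlacement pos) {c : ℝ} (y : M.DiskDart pos c)
    (hy : pos y = c) : ((h.diskPerm c)⁻¹ y : D) = M.rot⁻¹ y := if_pos hy

theorem IsPlacement.diskPerm_inv_of_ne (h : M.IsPlacement pos) {c : ℝ} (y : M.DiskDart pos c)
    (hy : pos y ≠ c) : ((h.diskPerm c)⁻¹ y : D) = M.rev y := if_neg hy

theorem ExitsLeft.exitsRight_rev {c a : ℝ} {d : D} (h : M.ExitsLeft pos c d) (ha : a < c)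
    (hd : pos (M.rev d) ≤ a) : M.ExitsRight pos a (M.rev d) :=
  ⟨hd, by rw [M.rev_rev]; exact ha.trans_le h.1⟩

theorem not_exitsRight_of_exitsLeft {c : ℝ} {d : D} (h : M.ExitsLeft pos c d) :
    ¬ M.ExitsRight pos c d := fun h' => (h.2.trans h'.2).false

open Classical in
/-- The side of the disk on which a dart leaves it: `0` for right and `1` for left. -/
noncomputable def side (M : AngledMap D) (pos : D → ℝ) (c : ℝ) (y : M.DiskDart pos c) : ℤ :=
  if M.ExitsRight pos c y then 0 else 1

end Placement

/-! ### Orders of the edges and the ranks that they induce in disks -/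

section Stack

variable {D : Type*} (M : AngledMap D)

/-- `B` orders the edges over every point of the line linearly, from bottom to top. -/
structure IsStack (pos : D → ℝ) (B : D → D → Prop) : Prop where
  irrefl : ∀ d, ¬ B d d
  trans : ∀ c d e g, M.ExitsRight pos c d → M.ExitsRight pos c e → M.ExitsRight pos c g →
    B d e → B e g → B d g
  total : ∀ c d e, M.ExitsRight pos c d → M.ExitsRight pos c e → d ≠ e → B d e ∨ B e d

/-- The order of the boundary points of the disk around `c` that is induced by an order of the
edges. -/
def Prec (pos : D → ℝ) (B : D → D → Prop) (c : ℝ) (d e : D) : Prop :=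
  (M.ExitsRight pos c d ∧ M.ExitsLeft pos c e) ∨
  (M.ExitsRight pos c d ∧ M.ExitsRight pos c e ∧ B d e) ∨
  (M.ExitsLeft pos c d ∧ M.ExitsLeft pos c e ∧ B (M.rev e) (M.rev d))

/-- The position of a boundary point in this order. -/
noncomputable def diskRank [Finite D] (pos : D → ℝ) (B : D → D → Prop) (c : ℝ) :
    M.DiskDart pos c → ℕ := rankOf fun d e => M.Prec pos B c d e

variable {M} {pos : D → ℝ} {B : D → D → Prop}

theorem IsStack.total_left (h : M.IsStack pos B) {c : ℝ} {d e : D} (hd : M.ExitsLeft pos c d)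
    (he : M.ExitsLeft pos c e) (hne : d ≠ e) : B (M.rev e) (M.rev d) ∨ B (M.rev d) (M.rev e) := by
  have hm : max (pos (M.rev d)) (pos (M.rev e)) < c := max_lt hd.2 he.2
  exact h.total _ _ _ (he.exitsRight_rev hm (le_max_right _ _))
    (hd.exitsRight_rev hm (le_max_left _ _)) fun h => hne (M.rev.injective h.symm)

theorem IsStack.trans_left (h : M.IsStack pos B) {c : ℝ} {d e g : D} (hd : M.ExitsLeft pos c d)
    (he : M.ExitsLeft pos c e) (hg : M.ExitsLeft pos c g) (h1 : B (M.rev d) (M.rev e))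
    (h2 : B (M.rev e) (M.rev g)) : B (M.rev d) (M.rev g) := by
  have hm : max (max (pos (M.rev d)) (pos (M.rev e))) (pos (M.rev g)) < c :=
    max_lt (max_lt hd.2 he.2) hg.2
  exact h.trans _ _ _ _ (hd.exitsRight_rev hm ((le_max_left _ _).trans (le_max_left _ _)))
    (he.exitsRight_rev hm ((le_max_right _ _).trans (le_max_left _ _)))
    (hg.exitsRight_rev hm (le_max_right _ _)) h1 h2

theorem IsStack.asymm (h : M.IsStack pos B) {c : ℝ} {d e : D} (hd : M.ExitsRight pos c d)
    (he : M.ExitsRight pos c e) (h1 : B d e) : ¬ B e d :=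
  fun h2 => h.irrefl d (h.trans c d e d hd he hd h1 h2)

theorem IsStack.prec_irrefl (h : M.IsStack pos B) (c : ℝ) (d : D) : ¬ M.Prec pos B c d d := by
  rintro (⟨h1, h2⟩ | ⟨-, -, h1⟩ | ⟨-, -, h1⟩)
  · exact not_exitsRight_of_exitsLeft h2 h1
  · exact h.irrefl _ h1
  · exact h.irrefl _ h1

theorem IsStack.prec_trans (h : M.IsStack pos B) {c : ℝ} {d e g : D} (h1 : M.Prec pos B c d e)
    (h2 : M.Prec pos B c e g) : M.Prec pos B c d g := by
  rcases h1 with ⟨h3, h4⟩ | ⟨h3, h4, h5⟩ | ⟨h3, h4, h5⟩ <;>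
    rcases h2 with ⟨h6, h7⟩ | ⟨h6, h7, h8⟩ | ⟨h6, h7, h8⟩
  · exact Or.inl ⟨h3, h7⟩
  · exact absurd h6 (not_exitsRight_of_exitsLeft h4)
  · exact Or.inl ⟨h3, h7⟩
  · exact Or.inl ⟨h3, h7⟩
  · exact Or.inr (Or.inl ⟨h3, h7, h.trans c _ _ _ h3 h4 h7 h5 h8⟩)
  · exact absurd h4 (not_exitsRight_of_exitsLeft h6)
  · exact absurd h6 (not_exitsRight_of_exitsLeft h4)
  · exact absurd h6 (not_exitsRight_of_exitsLeft h4)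
  · exact Or.inr (Or.inr ⟨h3, h7, h.trans_left h7 h4 h3 h8 h5⟩)

theorem IsStack.prec_total (h : M.IsStack pos B) {c : ℝ} {d e : D} (hd : M.Exits pos c d)
    (he : M.Exits pos c e) (hne : d ≠ e) : M.Prec pos B c d e ∨ M.Prec pos B c e d := by
  rcases hd with hd | hd <;> rcases he with he | he
  · rcases h.total c d e hd he hne with h1 | h1
    · exact Or.inl (Or.inr (Or.inl ⟨hd, he, h1⟩))
    · exact Or.inr (Or.inr (Or.inl ⟨he, hd, h1⟩))
  · exact Or.inl (Or.inl ⟨hd, he⟩)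
  · exact Or.inr (Or.inl ⟨he, hd⟩)
  · rcases h.total_left hd he hne with h1 | h1
    · exact Or.inl (Or.inr (Or.inr ⟨hd, he, h1⟩))
    · exact Or.inr (Or.inr (Or.inr ⟨he, hd, h1⟩))

theorem prec_right_iff {c : ℝ} {d e : D} (hd : M.ExitsRight pos c d) (he : M.ExitsRight pos c e) :
    M.Prec pos B c d e ↔ B d e := by
  refine ⟨?_, fun h => Or.inr (Or.inl ⟨hd, he, h⟩)⟩
  rintro (⟨-, h⟩ | ⟨-, -, h⟩ | ⟨h, -⟩)
  · exact absurd he (not_exitsRight_of_exitsLeft h)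
  · exact h
  · exact absurd hd (not_exitsRight_of_exitsLeft h)

theorem prec_left_iff {c : ℝ} {d e : D} (hd : M.ExitsLeft pos c d) (he : M.ExitsLeft pos c e) :
    M.Prec pos B c d e ↔ B (M.rev e) (M.rev d) := by
  refine ⟨?_, fun h => Or.inr (Or.inr ⟨hd, he, h⟩)⟩
  rintro (⟨h, -⟩ | ⟨h, -⟩ | ⟨-, -, h⟩)
  · exact absurd h (not_exitsRight_of_exitsLeft hd)
  · exact absurd h (not_exitsRight_of_exitsLeft hd)
  · exact h

theorem not_prec_left_right {c : ℝ} {d e : D} (hd : M.ExitsLeft pos c d)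
    (he : M.ExitsRight pos c e) : ¬ M.Prec pos B c d e := by
  rintro (⟨h, -⟩ | ⟨h, -⟩ | ⟨-, h, -⟩)
  · exact not_exitsRight_of_exitsLeft hd h
  · exact not_exitsRight_of_exitsLeft hd h
  · exact not_exitsRight_of_exitsLeft h he

variable [Finite D]

theorem IsStack.diskRank_lt_iff (h : M.IsStack pos B) {c : ℝ} (d e : M.DiskDart pos c) :
    M.diskRank pos B c d < M.diskRank pos B c e ↔ M.Prec pos B c d e :=
  rankOf_lt_rankOf_iff (R := fun d e : M.DiskDart pos c => M.Prec pos B c d e)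
    (fun x => h.prec_irrefl c x) (fun _ _ _ => h.prec_trans)
    (fun x y hne => h.prec_total x.2 y.2 fun h => hne (Subtype.ext h)) d e

theorem IsStack.diskRank_injective (h : M.IsStack pos B) (c : ℝ) :
    Function.Injective (M.diskRank pos B c) :=
  rankOf_injective (R := fun d e : M.DiskDart pos c => M.Prec pos B c d e)
    (fun x => h.prec_irrefl c x) (fun _ _ _ => h.prec_trans)
    (fun x y hne => h.prec_total x.2 y.2 fun h => hne (Subtype.ext h))

theorem IsStack.diskRank_lt_card (h : M.IsStack pos B) {c : ℝ} (d : M.DiskDart pos c) :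
    M.diskRank pos B c d < Fintype.card (M.DiskDart pos c) :=
  rankOf_lt_card (R := fun d e : M.DiskDart pos c => M.Prec pos B c d e)
    (fun x => h.prec_irrefl c x) d

open Classical in
/-- The angles of an order of the edges, in terms of the turns. -/
theorem IsStack.angle_eq_turn (h : M.IsStack pos B) (hp : M.IsPlacement pos) (d : D) :
    (((if (pos d < pos (M.rev d) ↔ pos (M.rot d) < pos (M.rev (M.rot d))) then
      if M.Prec pos B (pos d) d (M.rot d) then 0 else 360 else 180 : ℕ)) : ℤ) =
    180 * (2 - turn (M.diskRank pos B (pos d)) (M.side pos (pos d)) (hp.diskPerm (pos d))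
      ⟨d, hp.exits_self d⟩) := by
  have h1 : hp.diskPerm (pos d) ⟨d, hp.exits_self d⟩ =
      ⟨M.rot d, by have := hp.exits_self (M.rot d); rwa [hp.rot] at this⟩ :=
    Subtype.ext (hp.diskPerm_of_eq ⟨d, hp.exits_self d⟩ rfl)
  have hR : ∀ e (he : M.Exits pos (pos d) e), pos e = pos d →
      (M.ExitsRight pos (pos d) e ↔ pos e < pos (M.rev e)) := by
    intro e he hpe
    simp [ExitsRight, hpe]
  have h2 := hp.exits_self (M.rot d)
  rw [hp.rot] at h2
  unfold turn
  rw [h1]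
  simp only [h.diskRank_lt_iff, side, hR d (hp.exits_self d) rfl, hR (M.rot d) h2 (hp.rot d)]
  by_cases c1 : pos d < pos (M.rev d) <;> by_cases c2 : pos (M.rot d) < pos (M.rev (M.rot d))
  · rw [if_pos (by tauto)]
    split_ifs <;> simp
  · have h3 : M.Prec pos B (pos d) d (M.rot d) := Or.inl ⟨(hR d (hp.exits_self d) rfl).2 c1,
      h2.resolve_left fun h => c2 ((hR _ h2 (hp.rot d)).1 h)⟩
    rw [if_neg (by tauto), if_pos h3]
    simp [c1, c2]
  · rw [if_neg (by tauto), if_neg (not_prec_left_right ((hp.exits_self d).resolve_left fun h =>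
      c1 ((hR d (hp.exits_self d) rfl).1 h)) ((hR _ h2 (hp.rot d)).2 c2))]
    simp [c1, c2]
  · rw [if_pos (by tauto)]
    split_ifs <;> simp

end Stack

/-! ### The path that underlies a placement -/

section Path

variable {D : Type*} {M : AngledMap D} {pos : D → ℝ}

/-- No vertex lies strictly inside a path edge, so the edges over it can be read off just to the
right of any of its points except the right end. -/
theorem over_iff_exitsRight {a b c : ℝ} (h : IsPathEdge pos a b) (h1 : a ≤ c) (h2 : c < b)
    (d : D) : M.Over pos a b d ↔ M.ExitsRight pos c d := by
  refine ⟨fun hd => ⟨hd.1.trans h1, h2.trans_le hd.2⟩, fun hd => ⟨?_, ?_⟩⟩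
  · by_contra hc
    exact h.2.2.2 d ⟨not_le.1 hc, hd.1.trans_lt h2⟩
  · by_contra hc
    exact h.2.2.2 _ ⟨h1.trans_lt hd.2, not_le.1 hc⟩

theorem over_rev_iff_exitsLeft {a b c : ℝ} (h : IsPathEdge pos a b) (h1 : a < c) (h2 : c ≤ b)
    (d : D) : M.Over pos a b (M.rev d) ↔ M.ExitsLeft pos c d := by
  unfold Over ExitsLeft
  rw [M.rev_rev]
  refine ⟨fun hd => ⟨h2.trans hd.2, hd.1.trans_lt h1⟩, fun hd => ⟨?_, ?_⟩⟩
  · by_contra hc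
    exact h.2.2.2 _ ⟨not_le.1 hc, hd.2.trans_le h2⟩
  · by_contra hc
    exact h.2.2.2 _ ⟨h1.trans_le hd.1, not_le.1 hc⟩

theorem IsPathEdge.left_unique {a a' b : ℝ} (h : IsPathEdge pos a b) (h' : IsPathEdge pos a' b) :
    a = a' := by
  obtain ⟨d, rfl⟩ := h.1
  obtain ⟨e, rfl⟩ := h'.1
  rcases lt_trichotomy (pos d) (pos e) with h1 | h1 | h1
  · exact absurd ⟨h1, h'.2.2.1⟩ (h.2.2.2 e)
  · exact h1
  · exact absurd ⟨h1, h.2.2.1⟩ (h'.2.2.2 d)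

theorem IsPathEdge.right_unique {a b b' : ℝ} (h : IsPathEdge pos a b) (h' : IsPathEdge pos a b') :
    b = b' := by
  obtain ⟨d, rfl⟩ := h.2.1
  obtain ⟨e, rfl⟩ := h'.2.1
  rcases lt_trichotomy (pos d) (pos e) with h1 | h1 | h1
  · exact absurd ⟨h.2.2.1, h1⟩ (h'.2.2.2 d)
  · exact h1
  · exact absurd ⟨h'.2.2.1, h1⟩ (h.2.2.2 e)

variable [Finite D]

theorem exists_isPathEdge_right {c : ℝ} {d e : D} (hd : pos d ≤ c) (he : c < pos e) :
    ∃ a b, IsPathEdge pos a b ∧ a ≤ c ∧ c < b ∧ (c ∈ Set.range pos → a = c) := by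
  obtain ⟨m, hm, hmax⟩ := Set.exists_max_image {d | pos d ≤ c} pos (Set.toFinite _) ⟨d, hd⟩
  obtain ⟨n, hn, hmin⟩ := Set.exists_min_image {d | c < pos d} pos (Set.toFinite _) ⟨e, he⟩
  refine ⟨pos m, pos n, ⟨⟨m, rfl⟩, ⟨n, rfl⟩, lt_of_le_of_lt hm hn, fun g hg => ?_⟩, hm, hn, ?_⟩
  · rcases le_or_gt (pos g) c with h | h
    · exact (hmax g h).not_gt hg.1
    · exact (hmin g h).not_gt hg.2
  · rintro ⟨g, rfl⟩
    exact le_antisymm hm (hmax g (by simp))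

theorem exists_isPathEdge_left {c : ℝ} {d e : D} (hd : pos d < c) (he : c ≤ pos e) :
    ∃ a b, IsPathEdge pos a b ∧ a < c ∧ c ≤ b ∧ (c ∈ Set.range pos → b = c) := by
  obtain ⟨m, hm, hmax⟩ := Set.exists_max_image {d | pos d < c} pos (Set.toFinite _) ⟨d, hd⟩
  obtain ⟨n, hn, hmin⟩ := Set.exists_min_image {d | c ≤ pos d} pos (Set.toFinite _) ⟨e, he⟩
  refine ⟨pos m, pos n, ⟨⟨m, rfl⟩, ⟨n, rfl⟩, lt_of_lt_of_le hm hn, fun g hg => ?_⟩, hm, hn, ?_⟩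
  · rcases lt_or_ge (pos g) c with h | h
    · exact (hmax g h).not_gt hg.1
    · exact (hmin g h).not_gt hg.2
  · rintro ⟨g, rfl⟩
    exact le_antisymm (hmin g (by simp)) hn

/-- Induction along the path. -/
theorem path_induction {a₀ c₀ : ℝ} {p : ℝ → Prop} (h₀ : a₀ ∈ Set.range pos) (hp : p a₀)
    (hstep : ∀ a b, IsPathEdge pos a b → a₀ ≤ a → b ≤ c₀ → p a → p b) {c : ℝ}
    (hc : c ∈ Set.range pos) (h1 : a₀ ≤ c) (h2 : c ≤ c₀) : p c := by
  by_contra hn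
  obtain ⟨m, ⟨⟨g, hg⟩, hm1, hm2, hm3⟩, hmin⟩ := Set.exists_min_image
    {c | c ∈ Set.range pos ∧ a₀ ≤ c ∧ c ≤ c₀ ∧ ¬ p c} id
    ((Set.finite_range pos).subset fun _ h => h.1) ⟨c, hc, h1, h2, hn⟩
  obtain ⟨d0, hd0⟩ := h₀
  have hlt : a₀ < m := lt_of_le_of_ne hm1 fun h => hm3 (h ▸ hp)
  obtain ⟨a, b, hab, ha, -, hb⟩ := exists_isPathEdge_left (pos := pos) (c := m) (d := d0) (e := g)
    (by rw [hd0]; exact hlt) hg.ge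
  obtain rfl := hb ⟨g, hg⟩
  have ha0 : a₀ ≤ a := by
    by_contra hc
    exact hab.2.2.2 d0 (by rw [hd0]; exact ⟨not_le.1 hc, hlt⟩)
  refine hm3 (hstep a b hab ha0 hm2 ?_)
  by_contra hpa
  exact (hmin a ⟨hab.1, ha0, ha.le.trans hm2, hpa⟩).not_gt ha

end Path

/-! ### A flat folding as a single order of the edges -/

section Below

variable {D : Type*} {M : AngledMap D}

/-- `d` is below `e` over some interval. -/
def FlatFolding.below (F : M.FlatFolding) (d e : D) : Prop := ∃ a b, F.view a b d e

theorem FlatFolding.isPlacement (F : M.FlatFolding) : M.IsPlacement F.pos :=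
  ⟨F.pos_rot, F.abs_pos⟩

/-- Both edges pass through the disk at `b`. If `d` is the lower one on the right, `e` enters the
arc from `d` to `rev d`. By planarity its other end lies in that arc too, so that `rev e` comes
before `rev d`, which means that `d` is the lower one on the left. -/
theorem FlatFolding.view_left_of_view_right (F : M.FlatFolding) {a b b' : ℝ} {d e : D}
    (hab : IsPathEdge F.pos a b) (hd : M.Over F.pos a b d) (he : M.Over F.pos a b e)
    (h : F.view b b' d e) : F.view a b d e := by
  obtain ⟨hbb, hd', he'⟩ := F.view_support _ _ _ _ h
  have hab' := hab.2.2.1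
  have hbb' := hbb.2.2.1
  have hER : ∀ g, M.Over F.pos a b g → M.Over F.pos b b' g →
      M.ExitsRight F.pos b g ∧ M.ExitsLeft F.pos b (M.rev g) ∧ F.pos g ≠ b := by
    intro g h1 h2
    refine ⟨⟨h2.1, hbb'.trans_le h2.2⟩, ⟨h1.2, ?_⟩, (h1.1.trans_lt hab').ne⟩
    rw [M.rev_rev]
    exact h1.1.trans_lt hab'
  obtain ⟨d1, d2, d3⟩ := hER d hd hd'
  obtain ⟨e1, e2, e3⟩ := hER e he he'
  have h1 := F.planar b hab.2.1 d e (Or.inl d1) (Or.inl e1)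
  simp only [diskNext, if_neg d3, if_neg e3] at h1
  have h2 : M.Precedes F.pos F.view b d (M.rev d) := Or.inl ⟨d1, d2⟩
  have h3 : M.Precedes F.pos F.view b e (M.rev d) := Or.inl ⟨e1, d2⟩
  have h4 : M.Precedes F.pos F.view b (M.rev e) (M.rev d) := by
    rcases h1 (Or.inl ⟨Or.inr (Or.inl ⟨b', h⟩), h3⟩) with h | h | h
    · exact h.2
    · exact absurd h2 h.2
    · exact absurd h2 h.1
  rcases h4 with ⟨h5, -⟩ | ⟨b2, h5⟩ | ⟨a2, h5⟩
  · exact absurd h5 (not_exitsRight_of_exitsLeft e2)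
  · have h6 := (F.view_support _ _ _ _ h5).2.1
    exact absurd h6.1 (not_le.2 (hbb'.trans_le he'.2))
  · rw [M.rev_rev, M.rev_rev] at h5
    rwa [hab.left_unique (F.view_support _ _ _ _ h5).1]

theorem FlatFolding.view_asymm (F : M.FlatFolding) {a b : ℝ} {d e : D} (h : F.view a b d e) :
    ¬ F.view a b e d := fun h' => F.view_irrefl a b d (F.view_trans _ _ _ _ _ h h')

theorem FlatFolding.view_adjacent (F : M.FlatFolding) {a b b' : ℝ} {d e : D}
    (hab : IsPathEdge F.pos a b) (hbb : IsPathEdge F.pos b b')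
    (hd : M.Over F.pos a b d) (he : M.Over F.pos a b e)
    (hd' : M.Over F.pos b b' d) (he' : M.Over F.pos b b' e) :
    F.view a b d e ↔ F.view b b' d e := by
  refine ⟨fun h => ?_, F.view_left_of_view_right hab hd he⟩
  by_contra hc
  have hne : d ≠ e := by
    rintro rfl
    exact F.view_irrefl _ _ _ h
  exact F.view_asymm h (F.view_left_of_view_right hab he hd
    ((F.view_total _ _ _ _ hbb hd' he' hne).resolve_left hc))

/-- Two edges that lie over both intervals lie over all intervals between them and pass through all
points between them, so their order is carried along. -/
theorem FlatFolding.view_iff_view [Finite D] (F : M.FlatFolding) {a b a' b' : ℝ} {d e : D}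
    (hab : IsPathEdge F.pos a b) (hab' : IsPathEdge F.pos a' b')
    (hd : M.Over F.pos a b d) (he : M.Over F.pos a b e)
    (hd' : M.Over F.pos a' b' d) (he' : M.Over F.pos a' b' e) :
    F.view a b d e ↔ F.view a' b' d e := by
  wlog hle : a ≤ a' generalizing a b a' b'
  · exact (this hab' hab hd' he' hd he (le_of_not_ge hle)).symm
  have hlt := hab'.2.2.1
  refine path_induction (pos := F.pos) (a₀ := a) (c₀ := a')
    (p := fun c => ∀ b', IsPathEdge F.pos c b' → (F.view a b d e ↔ F.view c b' d e)) hab.1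
    (fun b' hb => by rw [hab.right_unique hb]) (fun x y hxy hx hy ih z hyz => ?_) hab'.1 hle le_rfl
    b' hab'
  rw [ih y hxy]
  have hyz' := hyz.2.2.1
  have hxy' := hxy.2.2.1
  have key : ∀ g, M.Over F.pos a b g → M.Over F.pos a' b' g →
      M.Over F.pos x y g ∧ M.Over F.pos y z g := by
    intro g h1 h2
    have h3 : a' < F.pos (M.rev g) := hlt.trans_le h2.2
    exact ⟨(over_iff_exitsRight hxy le_rfl hxy' g).2 ⟨h1.1.trans hx, by linarith⟩,
      (over_iff_exitsRight hyz le_rfl hyz' g).2 ⟨h1.1.trans (by linarith), by linarith⟩⟩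
  exact F.view_adjacent hxy hyz (key d hd hd').1 (key e he he').1 (key d hd hd').2 (key e he he').2

variable [Finite D] (F : M.FlatFolding)

theorem FlatFolding.view_iff_below {a b : ℝ} {d e : D}
    (hab : IsPathEdge F.pos a b) (hd : M.Over F.pos a b d) (he : M.Over F.pos a b e) :
    F.view a b d e ↔ F.below d e := by
  refine ⟨fun h => ⟨a, b, h⟩, ?_⟩
  rintro ⟨a', b', h⟩
  obtain ⟨h1, h2, h3⟩ := F.view_support _ _ _ _ h
  exact (F.view_iff_view hab h1 hd he h2 h3).2 h

/-- Together with the positions, one relation on darts encodes all magnified views; from here on it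
replaces them. -/
theorem FlatFolding.view_iff {a b : ℝ} {d e : D} : F.view a b d e ↔
    IsPathEdge F.pos a b ∧ M.Over F.pos a b d ∧ M.Over F.pos a b e ∧ F.below d e := by
  refine ⟨fun h => ?_, fun h => (F.view_iff_below h.1 h.2.1 h.2.2.1).2 h.2.2.2⟩
  obtain ⟨h1, h2, h3⟩ := F.view_support _ _ _ _ h
  exact ⟨h1, h2, h3, a, b, h⟩

theorem FlatFolding.isStack : M.IsStack F.pos F.below where
  irrefl d := fun ⟨a, b, h⟩ => F.view_irrefl a b d h
  trans := by
    intro c d e g hd he hg h1 h2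
    obtain ⟨a, b, hab, ha, hb, -⟩ := exists_isPathEdge_right hd.1 hd.2
    have ho := over_iff_exitsRight (M := M) hab ha hb
    exact ⟨a, b, F.view_trans _ _ _ _ _
      ((F.view_iff_below hab ((ho d).2 hd) ((ho e).2 he)).2 h1)
      ((F.view_iff_below hab ((ho e).2 he) ((ho g).2 hg)).2 h2)⟩
  total := by
    intro c d e hd he hne
    obtain ⟨a, b, hab, ha, hb, -⟩ := exists_isPathEdge_right hd.1 hd.2
    have ho := over_iff_exitsRight (M := M) hab ha hb
    exact (F.view_total a b d e hab ((ho d).2 hd) ((ho e).2 he) hne).imp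
      (fun h => ⟨a, b, h⟩) (fun h => ⟨a, b, h⟩)

theorem precedes_iff_prec {pos : D → ℝ} {view : ℝ → ℝ → D → D → Prop} {B : D → D → Prop}
    (hv : ∀ a b d e, view a b d e ↔
      IsPathEdge pos a b ∧ M.Over pos a b d ∧ M.Over pos a b e ∧ B d e)
    {c : ℝ} (hc : c ∈ Set.range pos) (d e : D) :
    M.Precedes pos view c d e ↔ M.Prec pos B c d e := by
  refine or_congr Iff.rfl (or_congr ⟨?_, ?_⟩ ⟨?_, ?_⟩)
  · rintro ⟨b, h⟩
    obtain ⟨h1, h2, h3, h4⟩ := (hv _ _ _ _).1 h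
    have ho := over_iff_exitsRight (M := M) h1 le_rfl h1.2.2.1
    exact ⟨(ho d).1 h2, (ho e).1 h3, h4⟩
  · rintro ⟨h1, h2, h3⟩
    obtain ⟨a, b, hab, ha, hb, hac⟩ := exists_isPathEdge_right h1.1 h1.2
    obtain rfl := hac hc
    have ho := over_iff_exitsRight (M := M) hab ha hb
    exact ⟨b, (hv _ _ _ _).2 ⟨hab, (ho d).2 h1, (ho e).2 h2, h3⟩⟩
  · rintro ⟨a, h⟩
    obtain ⟨h1, h2, h3, h4⟩ := (hv _ _ _ _).1 h
    have ho := over_rev_iff_exitsLeft (M := M) h1 h1.2.2.1 le_rfl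
    exact ⟨(ho d).1 h3, (ho e).1 h2, h4⟩
  · rintro ⟨h1, h2, h3⟩
    obtain ⟨a, b, hab, ha, hb, hbc⟩ := exists_isPathEdge_left h1.2 h1.1
    obtain rfl := hbc hc
    have ho := over_rev_iff_exitsLeft (M := M) hab ha hb
    exact ⟨a, (hv _ _ _ _).2 ⟨hab, (ho e).2 h2, (ho d).2 h1, h3⟩⟩

theorem inArc_iff_arc {pos : D → ℝ} {view : ℝ → ℝ → D → D → Prop} {B : D → D → Prop}
    (hv : ∀ a b d e, view a b d e ↔
      IsPathEdge pos a b ∧ M.Over pos a b d ∧ M.Over pos a b e ∧ B d e)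
    (hB : M.IsStack pos B) {c : ℝ} (hc : c ∈ Set.range pos) (d b e : M.DiskDart pos c) :
    M.InArc pos view c d b e ↔ Arc (M.diskRank pos B c) d b e := by
  simp only [InArc, Arc, precedes_iff_prec hv hc, hB.diskRank_lt_iff]

/-- Away from the vertices all components are passing edges, and the left side mirrors the right
side since both are ordered by `below`. Such points are included because a point with a vertex of
the graph need not carry a vertex of every face cycle. -/
theorem FlatFolding.noncrossing (c : ℝ) :
    Noncrossing (M.diskRank F.pos F.below c) (F.isPlacement.diskPerm c) := by
  intro d b
  by_cases hc : c ∈ Set.range F.pos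
  · have hv := fun a b d e => F.view_iff (a := a) (b := b) (d := d) (e := e)
    rw [← inArc_iff_arc hv F.isStack hc, ← inArc_iff_arc hv F.isStack hc]
    exact F.planar c hc d b d.2 b.2
  · have hne : ∀ y : M.DiskDart F.pos c, F.pos y ≠ c := fun y h => hc ⟨y, h⟩
    have hER : ∀ y : M.DiskDart F.pos c, M.ExitsLeft F.pos c (F.isPlacement.diskPerm c y) ↔
        M.ExitsRight F.pos c y := by
      intro y
      rw [F.isPlacement.diskPerm_of_ne y (hne y)]
      unfold ExitsLeft ExitsRight
      rw [M.rev_rev]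
      constructor
      · exact fun h => ⟨h.2.le, lt_of_le_of_ne h.1 fun h => hc ⟨_, h.symm⟩⟩
      · exact fun h => ⟨h.2.le, lt_of_le_of_ne h.1 fun h => hc ⟨_, h⟩⟩
    have hEL : ∀ y : M.DiskDart F.pos c, M.ExitsRight F.pos c (F.isPlacement.diskPerm c y) ↔
        M.ExitsLeft F.pos c y := by
      intro y
      rw [F.isPlacement.diskPerm_of_ne y (hne y)]
      unfold ExitsLeft ExitsRight
      rw [M.rev_rev]
      constructor
      · exact fun h => ⟨h.2.le, lt_of_le_of_ne h.1 fun h => hc ⟨_, h⟩⟩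
      · exact fun h => ⟨h.2.le, lt_of_le_of_ne h.1 fun h => hc ⟨_, h.symm⟩⟩
    have hrev : ∀ y : M.DiskDart F.pos c, (F.isPlacement.diskPerm c y : D) = M.rev y :=
      fun y => F.isPlacement.diskPerm_of_ne y (hne y)
    unfold Arc
    simp only [F.isStack.diskRank_lt_iff]
    rcases d.2 with hd | hd <;> rcases b.2 with hb | hb
    · have hd' := (hER d).2 hd
      have hb' := (hER b).2 hb
      rw [prec_right_iff hd hb, prec_left_iff hb' hd', hrev, hrev, M.rev_rev, M.rev_rev]
      have h1 : M.Prec F.pos F.below c d (F.isPlacement.diskPerm c d) := Or.inl ⟨hd, hd'⟩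
      have h2 : M.Prec F.pos F.below c d (F.isPlacement.diskPerm c b) := Or.inl ⟨hd, hb'⟩
      rw [← hrev, ← hrev]
      tauto
    · have hd' := (hER d).2 hd
      have hb' := (hEL b).2 hb
      rw [prec_right_iff hd hb', prec_left_iff hb hd', hrev, hrev, M.rev_rev]
      have h1 : M.Prec F.pos F.below c d (F.isPlacement.diskPerm c d) := Or.inl ⟨hd, hd'⟩
      have h2 : M.Prec F.pos F.below c (F.isPlacement.diskPerm c b)
        (F.isPlacement.diskPerm c d) := Or.inl ⟨hb', hd'⟩
      rw [← hrev, ← hrev]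
      tauto
    · have hd' := (hEL d).2 hd
      have hb' := (hER b).2 hb
      rw [prec_right_iff hb hd', prec_left_iff hd hb', hrev, hrev, M.rev_rev]
      have h1 := not_prec_left_right (B := F.below) hd hd'
      have h2 := not_prec_left_right (B := F.below) hd hb
      have h3 := not_prec_left_right (B := F.below) hb' hd'
      rw [hrev] at h1 h3
      rw [hrev] at h3
      tauto
    · have hd' := (hEL d).2 hd
      have hb' := (hEL b).2 hb
      rw [prec_left_iff hd hb, prec_right_iff hb' hd', hrev, hrev]
      have h1 := not_prec_left_right (B := F.below) hd hd'
      have h2 := not_prec_left_right (B := F.below) hd hb'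
      have h3 := not_prec_left_right (B := F.below) hb hd'
      rw [hrev] at h1 h2 h3
      tauto

theorem FlatFolding.angle_eq_turn (d : D) : (M.angle d : ℤ) =
    180 * (2 - turn (M.diskRank F.pos F.below (F.pos d)) (M.side F.pos (F.pos d))
      (F.isPlacement.diskPerm (F.pos d)) ⟨d, F.isPlacement.exits_self d⟩) := by
  rw [← F.isStack.angle_eq_turn F.isPlacement, ← F.angle_eq d]
  have h1 := precedes_iff_prec (M := M) (pos := F.pos) (view := F.view) (B := F.below)
    (fun a b d e => F.view_iff) (c := F.pos d) ⟨d, rfl⟩ d (M.rot d)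
  unfold foldedAngle
  classical
  exact congrArg Nat.cast (if_congr Iff.rfl (if_congr h1 rfl rfl) rfl)

theorem FlatFolding.rev_mem_outer {c : ℝ} {d : D} (hd : M.ExitsRight F.pos c d)
    (h : ∀ e, M.ExitsRight F.pos c e → ¬ F.below e d) : M.rev d ∈ M.outer := by
  obtain ⟨a, b, hab, ha, hb, -⟩ := exists_isPathEdge_right hd.1 hd.2
  have ho := over_iff_exitsRight (M := M) hab ha hb
  refine F.bottom_outer a b d hab ((ho d).2 hd) fun e he => ?_
  obtain ⟨-, h1, h2, h3⟩ := F.view_iff.1 he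
  exact h e ((ho e).1 h1) h3

theorem FlatFolding.mem_outer {c : ℝ} {d : D} (hd : M.ExitsRight F.pos c d)
    (h : ∀ e, M.ExitsRight F.pos c e → ¬ F.below d e) : d ∈ M.outer := by
  obtain ⟨a, b, hab, ha, hb, -⟩ := exists_isPathEdge_right hd.1 hd.2
  have ho := over_iff_exitsRight (M := M) hab ha hb
  refine F.top_outer a b d hab ((ho d).2 hd) fun e he => ?_
  obtain ⟨-, h1, h2, h3⟩ := F.view_iff.1 he
  exact h e ((ho e).1 h2) h3

/-- A flat folding from an order of the edges. -/
def FlatFolding.ofStack {pos : D → ℝ} {B : D → D → Prop} (hp : M.IsPlacement pos)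
    (hB : M.IsStack pos B)
    (planar : ∀ c ∈ Set.range pos, Noncrossing (M.diskRank pos B c) (hp.diskPerm c))
    (angle : ∀ d, (M.angle d : ℤ) = 180 * (2 - turn (M.diskRank pos B (pos d))
      (M.side pos (pos d)) (hp.diskPerm (pos d)) ⟨d, hp.exits_self d⟩))
    (bottom : ∀ c ∈ Set.range pos, ∀ d, M.ExitsRight pos c d →
      (∀ e, M.ExitsRight pos c e → ¬ B e d) → M.rev d ∈ M.outer)
    (top : ∀ c ∈ Set.range pos, ∀ d, M.ExitsRight pos c d →
      (∀ e, M.ExitsRight pos c e → ¬ B d e) → d ∈ M.outer) : M.FlatFolding where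
  pos := pos
  view a b d e := IsPathEdge pos a b ∧ M.Over pos a b d ∧ M.Over pos a b e ∧ B d e
  pos_rot := hp.rot
  abs_pos := hp.abs
  view_support _ _ _ _ h := ⟨h.1, h.2.1, h.2.2.1⟩
  view_irrefl _ _ d h := hB.irrefl d h.2.2.2
  view_trans a b d e g h1 h2 := by
    have ho := over_iff_exitsRight (M := M) h1.1 le_rfl h1.1.2.2.1
    exact ⟨h1.1, h1.2.1, h2.2.2.1, hB.trans a d e g ((ho d).1 h1.2.1) ((ho e).1 h1.2.2.1)
      ((ho g).1 h2.2.2.1) h1.2.2.2 h2.2.2.2⟩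
  view_total a b d e h hd he hne := by
    have ho := over_iff_exitsRight (M := M) h le_rfl h.2.2.1
    exact (hB.total a d e ((ho d).1 hd) ((ho e).1 he) hne).imp
      (fun h' => ⟨h, hd, he, h'⟩) (fun h' => ⟨h, he, hd, h'⟩)
  planar c hc d b hd hb h := by
    have hv : ∀ a b d e, (IsPathEdge pos a b ∧ M.Over pos a b d ∧ M.Over pos a b e ∧ B d e) ↔
      IsPathEdge pos a b ∧ M.Over pos a b d ∧ M.Over pos a b e ∧ B d e := fun _ _ _ _ => Iff.rfl
    have h1 := planar c hc ⟨d, hd⟩ ⟨b, hb⟩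
    rw [← inArc_iff_arc hv hB hc, ← inArc_iff_arc hv hB hc] at h1
    exact h1 h
  angle_eq d := by
    have h1 := (hB.angle_eq_turn hp d).trans (angle d).symm
    rw [← Nat.cast_inj (R := ℤ), ← h1]
    have h2 := precedes_iff_prec (M := M) (pos := pos) (B := B)
      (fun a b d e => Iff.rfl) (c := pos d) ⟨d, rfl⟩ d (M.rot d)
    unfold foldedAngle
    classical
    exact congrArg Nat.cast (if_congr Iff.rfl (if_congr h2 rfl rfl) rfl)
  bottom_outer a b d h hd hn := by
    have ho := over_iff_exitsRight (M := M) h le_rfl h.2.2.1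
    exact bottom a h.1 d ((ho d).1 hd) fun e he hb => hn e ⟨h, (ho e).2 he, hd, hb⟩
  top_outer a b d h hd hn := by
    have ho := over_iff_exitsRight (M := M) h le_rfl h.2.2.1
    exact top a h.1 d ((ho d).1 hd) fun e he hb => hn e ⟨h, hd, (ho e).2 he, hb⟩

end Below

end AngledMap

/-! ### Potentials: edges that touch bound the same face -/

namespace AngledMap

open CyclicOrder

variable {D : Type*} {M : AngledMap D}

/-- The underlying graph is connected. -/
def Connected (M : AngledMap D) : Prop :=
  ∀ d e, Relation.EqvGen (fun a b => b = M.rot a ∨ b = M.rev a) d e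

theorem Connected.eq_of_invariant (h : M.Connected) {α : Type*} {s : D → α}
    (h1 : ∀ d, s (M.rot d) = s d) (h2 : ∀ d, s (M.rev d) = s d) (d e : D) : s d = s e := by
  induction h d e with
  | rel x y hxy => rcases hxy with rfl | rfl <;> simp [h1, h2]
  | refl => rfl
  | symm _ _ _ ih => exact ih.symm
  | trans _ _ _ _ _ ih1 ih2 => exact ih1.trans ih2

theorem rot_faceNext (d : D) : M.rot (M.faceNext d) = M.rev d := by
  simp [faceNext]

theorem faceNext_rev (d : D) : M.faceNext (M.rev d) = M.rot⁻¹ d := by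
  simp [faceNext, M.rev_rev]

/-- Clockwise of `y` lies the face on the left of `rev y`, and the previous boundary point of the
component has that face on its left. -/
theorem apply_diskPerm_inv {pos : D → ℝ} (h : M.IsPlacement pos) {P : D → ℤ}
    (hP : ∀ d, P (M.faceNext d) = P d) {c : ℝ} (y : M.DiskDart pos c) :
    P ((h.diskPerm c)⁻¹ y) = P (M.rev y) := by
  by_cases hy : pos y = c
  · rw [h.diskPerm_inv_of_eq y hy, ← faceNext_rev, hP]
  · rw [h.diskPerm_inv_of_ne y hy]

variable [Finite D]

section Potential

variable (F : M.FlatFolding) {P : D → ℤ} (hP : ∀ d, P (M.faceNext d) = P d)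

open Classical in
/-- The jumps of `P` that a boundary point of a disk has before it, normalized by `P`. -/
noncomputable def FlatFolding.potential (P : D → ℤ) (c : ℝ) (y : M.DiskDart F.pos c) : ℤ :=
  ∑ z with M.diskRank F.pos F.below c z ≤ M.diskRank F.pos F.below c y,
    (P z - P ((F.isPlacement.diskPerm c)⁻¹ z)) - P y

theorem FlatFolding.potential_diskPerm (P : D → ℤ) (c : ℝ) (y : M.DiskDart F.pos c) :
    F.potential P c (F.isPlacement.diskPerm c y) = F.potential P c y :=
  (F.noncrossing c).prefix_sum (F.isStack.diskRank_injective c) (fun z => P z) y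

include hP

open Classical in
-- Read upwards on the right, the jump at an edge is the value of `P` above it minus the value below
-- it. Including the jump at `d` itself turns `P d` into `P (rev d)`.
theorem FlatFolding.potential_right [Fintype D] {c : ℝ} {d : D} (hd : M.ExitsRight F.pos c d) :
    F.potential P c ⟨d, Or.inl hd⟩ =
      ∑ e with M.ExitsRight F.pos c e ∧ F.below e d, (P e - P (M.rev e)) - P (M.rev d) := by
  have h1 : ∑ z with M.diskRank F.pos F.below c z ≤ M.diskRank F.pos F.below c ⟨d, Or.inl hd⟩,
      (P z - P ((F.isPlacement.diskPerm c)⁻¹ z)) =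
      ∑ e with M.ExitsRight F.pos c e ∧ (F.below e d ∨ e = d), (P e - P (M.rev e)) := by
    refine Finset.sum_bij (fun z _ => (z : D)) ?_ (fun _ _ _ _ h => Subtype.ext h) ?_ ?_
    · intro z hz
      simp only [Finset.mem_filter, Finset.mem_univ, true_and] at hz ⊢
      rcases eq_or_ne z ⟨d, Or.inl hd⟩ with rfl | hne
      · exact ⟨hd, Or.inr rfl⟩
      · have h2 := lt_of_le_of_ne hz fun h => hne (F.isStack.diskRank_injective c h)
        rw [F.isStack.diskRank_lt_iff] at h2
        have h3 : M.ExitsRight F.pos c z := z.2.resolve_right fun h => not_prec_left_right h hd h2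
        exact ⟨h3, Or.inl ((prec_right_iff h3 hd).1 h2)⟩
    · intro e he
      simp only [Finset.mem_filter, Finset.mem_univ, true_and] at he
      refine ⟨⟨e, Or.inl he.1⟩, ?_, rfl⟩
      simp only [Finset.mem_filter, Finset.mem_univ, true_and]
      rcases he.2 with h2 | rfl
      · exact ((F.isStack.diskRank_lt_iff _ _).2 ((prec_right_iff he.1 hd).2 h2)).le
      · exact le_rfl
    · intro z _
      rw [apply_diskPerm_inv F.isPlacement hP]
  have h2 : (Finset.univ.filter fun e => M.ExitsRight F.pos c e ∧ (F.below e d ∨ e = d)) =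
      insert d (Finset.univ.filter fun e => M.ExitsRight F.pos c e ∧ F.below e d) := by
    ext e
    simp only [Finset.mem_filter, Finset.mem_univ, true_and, Finset.mem_insert]
    constructor
    · rintro ⟨h, h' | h'⟩
      · exact Or.inr ⟨h, h'⟩
      · exact Or.inl h'
    · rintro (rfl | ⟨h, h'⟩)
      · exact ⟨hd, Or.inr rfl⟩
      · exact ⟨h, Or.inl h'⟩
  unfold FlatFolding.potential
  rw [h1, h2, Finset.sum_insert (by simpa using fun _ => F.isStack.irrefl d)]
  ring

open Classical in
-- All jumps of a disk add up to 0, so the prefix is minus the sum over the later points, which on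
-- the left side are the edges below.
theorem FlatFolding.potential_left [Fintype D] {c : ℝ} {d : D} (hd : M.ExitsLeft F.pos c d) :
    F.potential P c ⟨d, Or.inr hd⟩ =
      ∑ e with M.ExitsLeft F.pos c (M.rev e) ∧ F.below e (M.rev d), (P e - P (M.rev e)) - P d := by
  have htot : ∑ z : M.DiskDart F.pos c, (P z - P ((F.isPlacement.diskPerm c)⁻¹ z)) = 0 := by
    rw [Finset.sum_sub_distrib, Equiv.sum_comp (F.isPlacement.diskPerm c)⁻¹ (fun z => P z),
      sub_self]
  have h1 : ∑ z with ¬ M.diskRank F.pos F.below c z ≤ M.diskRank F.pos F.below c ⟨d, Or.inr hd⟩,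
      (P z - P ((F.isPlacement.diskPerm c)⁻¹ z)) =
      ∑ e with M.ExitsLeft F.pos c (M.rev e) ∧ F.below e (M.rev d), -(P e - P (M.rev e)) := by
    refine Finset.sum_bij (fun z _ => M.rev z) ?_
      (fun _ _ _ _ h => Subtype.ext (M.rev.injective h)) ?_ ?_
    · intro z hz
      simp only [Finset.mem_filter, Finset.mem_univ, true_and, not_le] at hz ⊢
      rw [F.isStack.diskRank_lt_iff] at hz
      have h3 : M.ExitsLeft F.pos c z := z.2.resolve_left fun h => not_prec_left_right hd h hz
      rw [M.rev_rev]
      exact ⟨h3, (prec_left_iff hd h3).1 hz⟩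
    · intro e he
      simp only [Finset.mem_filter, Finset.mem_univ, true_and] at he
      refine ⟨⟨M.rev e, Or.inr he.1⟩, ?_, M.rev_rev e⟩
      simp only [Finset.mem_filter, Finset.mem_univ, true_and, not_le]
      rw [F.isStack.diskRank_lt_iff, prec_left_iff hd he.1, M.rev_rev]
      exact he.2
    · intro z _
      rw [apply_diskPerm_inv F.isPlacement hP, M.rev_rev]
      ring
  have h2 := Finset.sum_filter_add_sum_filter_not Finset.univ (fun z : M.DiskDart F.pos c =>
    M.diskRank F.pos F.below c z ≤ M.diskRank F.pos F.below c ⟨d, Or.inr hd⟩)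
    (fun z => P z - P ((F.isPlacement.diskPerm c)⁻¹ z))
  rw [htot, h1, Finset.sum_neg_distrib] at h2
  unfold FlatFolding.potential
  linarith

/-- The disks at both ends of a path edge show the same stack over it, so the formulas for the right
and the left side agree. -/
theorem FlatFolding.potential_path {a b : ℝ} (hab : IsPathEdge F.pos a b) {d : D}
    (hd : M.ExitsRight F.pos a d) (hd' : M.ExitsLeft F.pos b (M.rev d)) :
    F.potential P b ⟨M.rev d, Or.inr hd'⟩ = F.potential P a ⟨d, Or.inl hd⟩ := by
  classical
  have : Fintype D := Fintype.ofFinite D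
  rw [F.potential_right hP hd, F.potential_left hP hd', M.rev_rev]
  congr 2
  ext e
  simp only [Finset.mem_filter, Finset.mem_univ, true_and]
  rw [← over_rev_iff_exitsLeft hab hab.2.2.1 le_rfl, M.rev_rev,
    over_iff_exitsRight hab le_rfl hab.2.2.1]

theorem FlatFolding.potential_along {d : D} {c : ℝ} (hc : c ∈ Set.range F.pos)
    (hd : M.ExitsRight F.pos c d) :
    F.potential P c ⟨d, Or.inl hd⟩ = F.potential P (F.pos d) ⟨d, F.isPlacement.exits_self d⟩ := by
  refine path_induction (pos := F.pos) (a₀ := F.pos d) (c₀ := c)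
    (p := fun c => ∀ h : M.ExitsRight F.pos c d, F.potential P c ⟨d, Or.inl h⟩ =
      F.potential P (F.pos d) ⟨d, F.isPlacement.exits_self d⟩) ⟨d, rfl⟩ (fun _ => rfl)
      (fun a b hab ha hb ih h => ?_) hc hd.1 le_rfl hd
  have h1 : M.ExitsRight F.pos a d := ⟨ha, hab.2.2.1.trans h.2⟩
  have h2 : M.ExitsLeft F.pos b (M.rev d) := by
    rw [← over_rev_iff_exitsLeft hab hab.2.2.1 le_rfl, M.rev_rev,
      over_iff_exitsRight hab le_rfl hab.2.2.1]
    exact h1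
  rw [← ih h1, ← F.potential_path hP hab h1 h2, ← F.potential_diskPerm]
  congr 1
  apply Subtype.ext
  rw [F.isPlacement.diskPerm_of_ne]
  exact (h1.1.trans_lt hab.2.2.1).ne

theorem FlatFolding.potential_rev_of_lt {d : D} (hd : F.pos d < F.pos (M.rev d)) :
    F.potential P (F.pos (M.rev d)) ⟨M.rev d, F.isPlacement.exits_self _⟩ =
      F.potential P (F.pos d) ⟨d, F.isPlacement.exits_self d⟩ := by
  obtain ⟨a, b, hab, ha, -, hb⟩ := exists_isPathEdge_left (pos := F.pos) hd le_rfl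
  obtain rfl := hb ⟨_, rfl⟩
  have h1 : M.ExitsRight F.pos a d := by
    refine ⟨?_, ha⟩
    by_contra hc
    exact hab.2.2.2 d ⟨not_le.1 hc, hd⟩
  rw [← F.potential_along hP hab.1 h1]
  exact F.potential_path hP hab h1 ⟨le_rfl, by rwa [M.rev_rev]⟩

/-- The potential is constant on the components of a disk and is carried along every edge to the
disk at its other end; connectivity does the rest. -/
theorem FlatFolding.potential_const (hM : M.Connected) (d e : D) :
    F.potential P (F.pos d) ⟨d, F.isPlacement.exits_self d⟩ =
      F.potential P (F.pos e) ⟨e, F.isPlacement.exits_self e⟩ := by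
  have hcongr : ∀ {c c' : ℝ} (hc : c = c') (y : M.DiskDart F.pos c) (y' : M.DiskDart F.pos c'),
      (y : D) = y' → F.potential P c y = F.potential P c' y' := by
    rintro c _ rfl y y' h
    rw [Subtype.ext h]
  refine hM.eq_of_invariant
    (s := fun d => F.potential P (F.pos d) ⟨d, F.isPlacement.exits_self d⟩)
    (fun d => ?_) (fun d => ?_) d e
  · rw [← F.potential_diskPerm P (F.pos d)]
    exact hcongr (F.pos_rot d) _ _ 
      (F.isPlacement.diskPerm_of_eq ⟨d, F.isPlacement.exits_self d⟩ rfl).symm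
  · rcases (F.isPlacement.pos_ne d).lt_or_gt with h | h
    · rw [← F.potential_rev_of_lt hP (d := M.rev d) (by rwa [M.rev_rev])]
      exact hcongr (by rw [M.rev_rev]) _ _ (M.rev_rev d)
    · exact F.potential_rev_of_lt hP h

end Potential

/-- Two edges of a connected graph that touch in a flat folding bound the same face. -/
theorem FlatFolding.faceOf_eq_of_touching (hM : M.Connected) (F : M.FlatFolding) {c : ℝ} {d e : D}
    (hd : M.ExitsRight F.pos c d) (he : M.ExitsRight F.pos c e) (hde : F.below d e)
    (hn : ∀ g, M.ExitsRight F.pos c g → ¬ (F.below d g ∧ F.below g e)) :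
    M.faceOf d = M.faceOf (M.rev e) := by
  classical
  have : Fintype D := Fintype.ofFinite D
  wlog hc : c ∈ Set.range F.pos generalizing c
  · obtain ⟨a, b, hab, ha, hb, -⟩ := exists_isPathEdge_right hd.1 hd.2
    have h1 : ∀ g, M.ExitsRight F.pos a g ↔ M.ExitsRight F.pos c g := fun g => by
      rw [← over_iff_exitsRight hab ha hb, over_iff_exitsRight hab le_rfl hab.2.2.1]
    exact this ((h1 d).2 hd) ((h1 e).2 he) (fun g hg => hn g ((h1 g).1 hg)) hab.1
  -- The indicator function of the face above `d`.
  set P : D → ℤ := fun x => if M.faceOf x = M.faceOf d then 1 else 0 with hPdef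
  have hP : ∀ x, P (M.faceNext x) = P x := fun x => by
    simp only [hPdef, M.faceOf_faceNext]
  have h1 := F.potential_along hP hc hd
  have h2 := F.potential_along hP hc he
  rw [F.potential_const hP hM e d, ← h1, F.potential_right hP hd, F.potential_right hP he] at h2
  have h3 : (Finset.univ.filter fun g => M.ExitsRight F.pos c g ∧ F.below g e) =
      insert d (Finset.univ.filter fun g => M.ExitsRight F.pos c g ∧ F.below g d) := by
    ext g
    simp only [Finset.mem_filter, Finset.mem_univ, true_and, Finset.mem_insert]
    constructor
    · rintro ⟨h, h'⟩
      by_cases hgd : g = d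
      · exact Or.inl hgd
      · exact Or.inr ⟨h, (F.isStack.total c g d h hd hgd).resolve_right fun h'' => hn g h ⟨h'', h'⟩⟩
    · rintro (rfl | ⟨h, h'⟩)
      · exact ⟨hd, hde⟩
      · exact ⟨h, F.isStack.trans c g d e h hd he h' hde⟩
  rw [h3, Finset.sum_insert (by simpa using fun _ => F.isStack.irrefl d)] at h2
  -- Between `d` and the next edge `e` the sum of jumps grows only by the jump at `d`, so equal
  -- potentials leave an equality across the gap.
  have h4 : P (M.rev e) = P d := by linarith
  simp only [hPdef, if_true] at h4
  by_contra hne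
  rw [if_neg (fun h => hne h.symm)] at h4
  exact zero_ne_one h4

/-- An edge that is not on top has a next edge above it. -/
theorem IsStack.exists_next {pos : D → ℝ} {B : D → D → Prop} (h : M.IsStack pos B) {c : ℝ} {d e : D}
    (he : M.ExitsRight pos c e) (hde : B d e) :
    ∃ g, M.ExitsRight pos c g ∧ B d g ∧ (g = e ∨ B g e) ∧
      ∀ x, M.ExitsRight pos c x → ¬ (B d x ∧ B x g) := by
  obtain ⟨g, ⟨hg, hdg⟩, hmin⟩ := Set.exists_min_image
    {x : M.DiskDart pos c | M.ExitsRight pos c x ∧ B d x} (M.diskRank pos B c) (Set.toFinite _)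
    ⟨⟨e, Or.inl he⟩, he, hde⟩
  refine ⟨g, hg, hdg, ?_, fun x hx hdx => ?_⟩
  · by_cases hge : (g : D) = e
    · exact Or.inl hge
    · refine Or.inr ((h.total c g e hg he hge).resolve_right fun hb => ?_)
      have := hmin ⟨e, Or.inl he⟩ ⟨he, hde⟩
      have h2 := (h.diskRank_lt_iff ⟨e, Or.inl he⟩ g).2 ((prec_right_iff he hg).2 hb)
      omega
  · have := hmin ⟨x, Or.inl hx⟩ ⟨hx, hdx.1⟩
    have h2 := (h.diskRank_lt_iff ⟨x, Or.inl hx⟩ g).2 ((prec_right_iff hx hg).2 hdx.2)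
    omega

theorem IsStack.exists_prev {pos : D → ℝ} {B : D → D → Prop} (h : M.IsStack pos B) {c : ℝ} {d e : D}
    (he : M.ExitsRight pos c e) (hde : B e d) :
    ∃ g, M.ExitsRight pos c g ∧ B g d ∧ (g = e ∨ B e g) ∧
      ∀ x, M.ExitsRight pos c x → ¬ (B g x ∧ B x d) := by
  obtain ⟨g, ⟨hg, hdg⟩, hmax⟩ := Set.exists_max_image
    {x : M.DiskDart pos c | M.ExitsRight pos c x ∧ B x d} (M.diskRank pos B c) (Set.toFinite _)
    ⟨⟨e, Or.inl he⟩, he, hde⟩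
  refine ⟨g, hg, hdg, ?_, fun x hx hdx => ?_⟩
  · by_cases hge : (g : D) = e
    · exact Or.inl hge
    · refine Or.inr ((h.total c g e hg he hge).resolve_left fun hb => ?_)
      have := hmax ⟨e, Or.inl he⟩ ⟨he, hde⟩
      have h2 := (h.diskRank_lt_iff g ⟨e, Or.inl he⟩).2 ((prec_right_iff hg he).2 hb)
      omega
  · have := hmax ⟨x, Or.inl hx⟩ ⟨hx, hdx.2⟩
    have h2 := (h.diskRank_lt_iff g ⟨x, Or.inl hx⟩).2 ((prec_right_iff hg hx).2 hdx.1)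
    omega

end AngledMap

/-! ### Uniqueness: a folding is determined by its touching pairs -/

namespace AngledMap

open CyclicOrder

variable {D : Type*} {M : AngledMap D}

theorem IsPlacement.lt_rev_iff_not {p : D → ℝ} (hp : M.IsPlacement p) (d : D) :
    p (M.rev d) < p d ↔ ¬ p d < p (M.rev d) :=
  ⟨fun h => h.not_gt, fun h => lt_of_le_of_ne (not_lt.1 h) (hp.pos_ne d)⟩

theorem IsPlacement.sub_of_lt {p : D → ℝ} (hp : M.IsPlacement p) {d : D}
    (h : p d < p (M.rev d)) : p (M.rev d) - p d = M.len d := by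
  rw [← hp.abs d, abs_of_pos (sub_pos.2 h)]

theorem IsPlacement.sub_of_not_lt {p : D → ℝ} (hp : M.IsPlacement p) {d : D}
    (h : ¬ p d < p (M.rev d)) : p (M.rev d) - p d = -M.len d := by
  rw [← hp.abs d, abs_of_neg (sub_neg.2 ((hp.lt_rev_iff_not d).2 h)), neg_neg]

/-- Two placements of a connected graph with straight angles at the same corners differ by an
isometry of the line. -/
theorem Connected.placement_unique (hM : M.Connected) {p q : D → ℝ} (hp : M.IsPlacement p)
    (hq : M.IsPlacement q) (hdir : ∀ d, (p d < p (M.rev d) ↔ p (M.rot d) < p (M.rev (M.rot d))) ↔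
      (q d < q (M.rev d) ↔ q (M.rot d) < q (M.rev (M.rot d)))) :
    (∃ t : ℝ, ∀ d, q d = p d + t) ∨ ∃ t : ℝ, ∀ d, q d = t - p d := by
  rcases isEmpty_or_nonempty D with hD | ⟨⟨d0⟩⟩
  · exact Or.inl ⟨0, fun d => hD.elim d⟩
  -- Whether the two placements agree on the direction of a dart does not change under `rot` or
  -- `rev`. Constant agreement gives a translation, constant disagreement a reflection of the line.
  have hs : ∀ d, (p d < p (M.rev d) ↔ q d < q (M.rev d)) =
      (p d0 < p (M.rev d0) ↔ q d0 < q (M.rev d0)) := by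
    intro d
    refine hM.eq_of_invariant (s := fun d => (p d < p (M.rev d) ↔ q d < q (M.rev d)))
      (fun d => propext ?_) (fun d => propext ?_) d d0
    · have := hdir d
      tauto
    · rw [M.rev_rev, hp.lt_rev_iff_not, hq.lt_rev_iff_not]
      tauto
  by_cases h0 : p d0 < p (M.rev d0) ↔ q d0 < q (M.rev d0)
  · refine Or.inl ⟨q d0 - p d0, fun d => ?_⟩
    have h1 := hM.eq_of_invariant (s := fun d => q d - p d) (fun d => by rw [hp.rot, hq.rot])
      (fun d => by
        have h2 : p d < p (M.rev d) ↔ q d < q (M.rev d) := by rw [hs d]; exact h0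
        by_cases h3 : p d < p (M.rev d)
        · have := hp.sub_of_lt h3
          have := hq.sub_of_lt (h2.1 h3)
          linarith
        · have := hp.sub_of_not_lt h3
          have := hq.sub_of_not_lt (fun h => h3 (h2.2 h))
          linarith) d d0
    linarith
  · refine Or.inr ⟨q d0 + p d0, fun d => ?_⟩
    have h1 := hM.eq_of_invariant (s := fun d => q d + p d) (fun d => by rw [hp.rot, hq.rot])
      (fun d => by
        have h2 : ¬ (p d < p (M.rev d) ↔ q d < q (M.rev d)) := by rw [hs d]; exact h0
        by_cases h3 : p d < p (M.rev d)
        · have := hp.sub_of_lt h3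
          have := hq.sub_of_not_lt (fun h => h2 (iff_of_true h3 h))
          linarith
        · have := hp.sub_of_not_lt h3
          have := hq.sub_of_lt (d := d) (by tauto)
          linarith) d d0
    linarith

theorem FlatFolding.foldedAngle_eq_180_iff (F : M.FlatFolding) (d : D) : M.angle d ≠ 180 ↔
    (F.pos d < F.pos (M.rev d) ↔ F.pos (M.rot d) < F.pos (M.rev (M.rot d))) := by
  rw [← F.angle_eq d]
  unfold foldedAngle
  split_ifs <;> simp_all

theorem FlatFolding.Equivalent.touching_subset {F G : M.FlatFolding} (h : F.Equivalent G) :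
    F.touching ⊆ G.touching := by
  rintro s ⟨a, b, d, e, h1, h2, rfl⟩
  rcases h with ⟨t, -, h⟩ | ⟨t, -, h⟩
  · exact ⟨a + t, b + t, d, e, (h _ _ _ _).2 h1, fun g hg =>
      h2 g ⟨(h _ _ _ _).1 hg.1, (h _ _ _ _).1 hg.2⟩, rfl⟩
  · refine ⟨t - b, t - a, M.rev e, M.rev d, (h _ _ _ _).2 h1, fun g hg => h2 (M.rev g) ?_, ?_⟩
    · rw [← M.rev_rev g] at hg
      exact ⟨(h _ _ _ _).1 hg.2, (h _ _ _ _).1 hg.1⟩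
    · rw [M.rev_rev, Sym2.eq_swap]

theorem FlatFolding.Equivalent.touching_eq {F G : M.FlatFolding} (h : F.Equivalent G) :
    F.touching = G.touching :=
  Set.Subset.antisymm h.touching_subset
    (FlatFolding.equivalent_equivalence.symm h).touching_subset

theorem exitsRight_sub_iff {pos : D → ℝ} {t c : ℝ} {d : D} :
    M.ExitsRight (fun d => t - pos d) c d ↔ M.ExitsLeft pos (t - c) d := by
  unfold ExitsRight ExitsLeft
  constructor <;> rintro ⟨h1, h2⟩ <;> constructor <;> linarith

theorem exitsLeft_sub_iff {pos : D → ℝ} {t c : ℝ} {d : D} :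
    M.ExitsLeft (fun d => t - pos d) c d ↔ M.ExitsRight pos (t - c) d := by
  unfold ExitsRight ExitsLeft
  constructor <;> rintro ⟨h1, h2⟩ <;> constructor <;> linarith

theorem exits_sub_iff {pos : D → ℝ} {t c : ℝ} {d : D} :
    M.Exits (fun d => t - pos d) c d ↔ M.Exits pos (t - c) d := by
  unfold Exits
  rw [exitsRight_sub_iff, exitsLeft_sub_iff, or_comm]

theorem prec_sub_iff {pos : D → ℝ} {B : D → D → Prop} {t c : ℝ} {d e : D} :
    M.Prec (fun d => t - pos d) (fun d e => B (M.rev e) (M.rev d)) c d e ↔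
      (M.ExitsLeft pos (t - c) d ∧ M.ExitsRight pos (t - c) e) ∨
      (M.ExitsLeft pos (t - c) d ∧ M.ExitsLeft pos (t - c) e ∧ B (M.rev e) (M.rev d)) ∨
      (M.ExitsRight pos (t - c) d ∧ M.ExitsRight pos (t - c) e ∧ B d e) := by
  unfold Prec
  simp only [exitsRight_sub_iff, exitsLeft_sub_iff, M.rev_rev]

theorem isPathEdge_sub_iff {pos : D → ℝ} {t a b : ℝ} :
    IsPathEdge (fun d => t - pos d) (t - b) (t - a) ↔ IsPathEdge pos a b := by
  have h1 : ∀ x, t - x ∈ Set.range (fun d => t - pos d) ↔ x ∈ Set.range pos := fun x => by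
    simp [Set.mem_range]
  unfold IsPathEdge
  rw [h1, h1]
  constructor
  · rintro ⟨h1, h2, h3, h4⟩
    exact ⟨h2, h1, by linarith, fun d hd => h4 d ⟨by linarith, by linarith⟩⟩
  · rintro ⟨h1, h2, h3, h4⟩
    exact ⟨h2, h1, by linarith, fun d hd => h4 d ⟨by linarith, by linarith⟩⟩

theorem FlatFolding.isPlacement_sub (F : M.FlatFolding) (t : ℝ) : M.IsPlacement fun d => t - F.pos d where
  rot d := by rw [F.pos_rot]
  abs d := by rw [← F.abs_pos d, ← abs_neg]; ring_nf

variable [Finite D]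

theorem FlatFolding.ofStack_below {pos : D → ℝ} {B : D → D → Prop} (hp : M.IsPlacement pos)
    (hB : M.IsStack pos B) (planar angle bottom top) (d e : D) :
    (FlatFolding.ofStack hp hB planar angle bottom top).below d e ↔
      B d e ∧ ∃ c, M.ExitsRight pos c d ∧ M.ExitsRight pos c e := by
  constructor
  · rintro ⟨a, b, h1, h2, h3, h4⟩
    exact ⟨h4, a, (over_iff_exitsRight h1 le_rfl h1.2.2.1 d).1 h2,
      (over_iff_exitsRight h1 le_rfl h1.2.2.1 e).1 h3⟩
  · rintro ⟨h, c, h1, h2⟩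
    obtain ⟨a, b, hab, ha, hb, -⟩ := exists_isPathEdge_right h1.1 h1.2
    exact ⟨a, b, hab, (over_iff_exitsRight hab ha hb d).2 h1,
      (over_iff_exitsRight hab ha hb e).2 h2, h⟩

section HalfTurn

variable (F : M.FlatFolding) (t : ℝ)

theorem FlatFolding.isStack_sub :
    M.IsStack (fun d => t - F.pos d) (fun d e => F.below (M.rev e) (M.rev d)) where
  irrefl _ := F.isStack.irrefl _
  trans _ _ _ _ hd he hg h1 h2 := F.isStack.trans_left (exitsRight_sub_iff.1 hg)
    (exitsRight_sub_iff.1 he) (exitsRight_sub_iff.1 hd) h2 h1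
  total _ _ _ hd he hne := F.isStack.total_left (exitsRight_sub_iff.1 hd)
    (exitsRight_sub_iff.1 he) hne

/-- A half-turn keeps the cyclic order of the boundary points and moves only its starting point,
from the bottom to the top. Arcs do not depend on the starting point. -/
theorem FlatFolding.arc_sub_iff {c : ℝ} (d b e : M.DiskDart (fun d => t - F.pos d) c) :
    Arc (M.diskRank (fun d => t - F.pos d) (fun d e => F.below (M.rev e) (M.rev d)) c) d b e ↔
    Arc (M.diskRank F.pos F.below (t - c)) ⟨d, exits_sub_iff.1 d.2⟩ ⟨b, exits_sub_iff.1 b.2⟩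
      ⟨e, exits_sub_iff.1 e.2⟩ := by
  unfold Arc
  simp only [(F.isStack_sub t).diskRank_lt_iff, F.isStack.diskRank_lt_iff, prec_sub_iff]
  unfold Prec
  have hex : ∀ x : M.DiskDart (fun d => t - F.pos d) c,
      (M.ExitsRight F.pos (t - c) x ∧ ¬ M.ExitsLeft F.pos (t - c) x) ∨
      (M.ExitsLeft F.pos (t - c) x ∧ ¬ M.ExitsRight F.pos (t - c) x) := fun x =>
    (exits_sub_iff.1 x.2).imp (fun h => ⟨h, fun h' => not_exitsRight_of_exitsLeft h' h⟩)
      (fun h => ⟨h, not_exitsRight_of_exitsLeft h⟩)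
  rcases hex d with ⟨d1, d2⟩ | ⟨d1, d2⟩ <;> rcases hex b with ⟨b1, b2⟩ | ⟨b1, b2⟩ <;>
    rcases hex e with ⟨e1, e2⟩ | ⟨e1, e2⟩ <;>
    simp only [d1, d2, b1, b2, e1, e2, true_and, false_and, and_true, and_false, or_false,
      false_or, not_true_eq_false, not_false_eq_true]

/-- The image of a flat folding under a half-turn of the plane. -/
noncomputable def FlatFolding.halfTurn : M.FlatFolding :=
  FlatFolding.ofStack (F.isPlacement_sub t) (F.isStack_sub t)
    (fun c _ d b h => by
      have h1 := (F.noncrossing (t - c)) ⟨d, exits_sub_iff.1 d.2⟩ ⟨b, exits_sub_iff.1 b.2⟩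
      have h2 : ∀ y : M.DiskDart (fun d => t - F.pos d) c,
          (⟨(F.isPlacement_sub t).diskPerm c y, exits_sub_iff.1 ((F.isPlacement_sub t).diskPerm c y).2⟩ :
            M.DiskDart F.pos (t - c)) =
          F.isPlacement.diskPerm (t - c) ⟨y, exits_sub_iff.1 y.2⟩ := by
        intro y
        apply Subtype.ext
        by_cases hy : F.pos y = t - c
        · rw [F.isPlacement.diskPerm_of_eq _ hy]
          exact (F.isPlacement_sub t).diskPerm_of_eq y (by linarith)
        · rw [F.isPlacement.diskPerm_of_ne _ hy]
          exact (F.isPlacement_sub t).diskPerm_of_ne y (fun h => hy (by linarith))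
      rw [F.arc_sub_iff] at h ⊢
      rw [h2] at h
      rw [h2, h2]
      exact h1 h)
    (fun d => by
      rw [F.angle_eq_turn, ← F.isStack.angle_eq_turn, ← (F.isStack_sub t).angle_eq_turn]
      have h1 : ∀ x y : ℝ, t - x < t - y ↔ y < x := fun x y => sub_lt_sub_iff_left t
      have h2 : (t - F.pos d < t - F.pos (M.rev d) ↔
          t - F.pos (M.rot d) < t - F.pos (M.rev (M.rot d))) ↔
          (F.pos d < F.pos (M.rev d) ↔ F.pos (M.rot d) < F.pos (M.rev (M.rot d))) := by
        rw [h1, h1, F.isPlacement.lt_rev_iff_not, F.isPlacement.lt_rev_iff_not]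
        tauto
      by_cases h3 : F.pos d < F.pos (M.rev d) ↔ F.pos (M.rot d) < F.pos (M.rev (M.rot d))
      · rw [if_pos h3, if_pos (h2.2 h3)]
        have h4 : M.Prec F.pos F.below (F.pos d) d (M.rot d) ↔
            M.Prec (fun d => t - F.pos d) (fun d e => F.below (M.rev e) (M.rev d)) (t - F.pos d) d
              (M.rot d) := by
          rw [prec_sub_iff, sub_sub_cancel]
          unfold Prec ExitsRight ExitsLeft
          rw [F.pos_rot] at h3 ⊢
          have h5 := F.isPlacement.lt_rev_iff_not d
          have h6 := F.isPlacement.lt_rev_iff_not (M.rot d)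
          rw [F.pos_rot] at h6
          simp only [le_refl, true_and, h5, h6]
          tauto
        classical
        exact congrArg Nat.cast (if_congr h4 rfl rfl)
      · rw [if_neg h3, if_neg (fun h => h3 (h2.1 h))])
    (fun c _ d hd h => by
      rw [exitsRight_sub_iff] at hd
      obtain ⟨a, b, hab, ha, hb, -⟩ := exists_isPathEdge_left hd.2 hd.1
      have ho := fun e => (over_rev_iff_exitsLeft (M := M) hab ha hb e).symm.trans
        (over_iff_exitsRight hab le_rfl hab.2.2.1 _)
      refine F.mem_outer ((ho d).1 hd) fun e he hde => h (M.rev e) ?_ (by rwa [M.rev_rev])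
      rw [exitsRight_sub_iff, ho, M.rev_rev]
      exact he)
    (fun c _ d hd h => by
      rw [exitsRight_sub_iff] at hd
      obtain ⟨a, b, hab, ha, hb, -⟩ := exists_isPathEdge_left hd.2 hd.1
      have ho := fun e => (over_rev_iff_exitsLeft (M := M) hab ha hb e).symm.trans
        (over_iff_exitsRight hab le_rfl hab.2.2.1 _)
      rw [← M.rev_rev d]
      refine F.rev_mem_outer ((ho d).1 hd) fun e he hde => h (M.rev e) ?_ (by rwa [M.rev_rev])
      rw [exitsRight_sub_iff, ho, M.rev_rev]
      exact he)

theorem FlatFolding.halfTurn_equivalent : F.Equivalent (F.halfTurn t) := by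
  refine Or.inr ⟨t, fun d => rfl, fun a b d e => ?_⟩
  rw [F.view_iff]
  change IsPathEdge (fun d => t - F.pos d) (t - b) (t - a) ∧
    M.Over (fun d => t - F.pos d) (t - b) (t - a) (M.rev e) ∧
    M.Over (fun d => t - F.pos d) (t - b) (t - a) (M.rev d) ∧
    F.below (M.rev (M.rev d)) (M.rev (M.rev e)) ↔ _
  rw [isPathEdge_sub_iff, M.rev_rev, M.rev_rev]
  unfold Over
  simp only [M.rev_rev, sub_le_sub_iff_left]
  tauto

theorem FlatFolding.exists_equivalent_pos {q : D → ℝ}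
    (hq : (∃ t : ℝ, ∀ d, q d = F.pos d + t) ∨ ∃ t : ℝ, ∀ d, q d = t - F.pos d) :
    ∃ G : M.FlatFolding, F.Equivalent G ∧ G.pos = q := by
  rcases hq with ⟨t, h⟩ | ⟨t, h⟩
  -- A translation is a product of two half-turns.
  · refine ⟨(F.halfTurn 0).halfTurn t, FlatFolding.equivalent_equivalence.trans
      (F.halfTurn_equivalent 0) ((F.halfTurn 0).halfTurn_equivalent t), funext fun d => ?_⟩
    rw [h]
    change t - (0 - F.pos d) = _
    ring
  · exact ⟨F.halfTurn t, F.halfTurn_equivalent t, funext fun d => (h d).symm⟩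

end HalfTurn

/-- The pair records the darts with the gap on their left. With equal positions these darts show
which of the edges is the lower one. -/
theorem FlatFolding.exists_below_of_touching {F G : M.FlatFolding} (h : F.touching ⊆ G.touching)
    (hpos : F.pos = G.pos) {c : ℝ} {d e : D}
    (hd : M.ExitsRight F.pos c d) (he : M.ExitsRight F.pos c e) (hde : F.below d e)
    (hn : ∀ g, M.ExitsRight F.pos c g → ¬ (F.below d g ∧ F.below g e)) : G.below d e := by
  obtain ⟨a, b, hab, ha, hb, -⟩ := exists_isPathEdge_right hd.1 hd.2
  have ho := over_iff_exitsRight (M := M) hab ha hb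
  have h1 : s(d, M.rev e) ∈ F.touching := ⟨a, b, d, e,
    F.view_iff.2 ⟨hab, (ho d).2 hd, (ho e).2 he, hde⟩, fun g hg => by
      have h2 := F.view_iff.1 hg.1
      have h3 := F.view_iff.1 hg.2
      exact hn g ((ho g).1 h2.2.2.1) ⟨h2.2.2.2, h3.2.2.2⟩, rfl⟩
  obtain ⟨a', b', d', e', h2, -, h3⟩ := h h1
  obtain ⟨h4, h5, h6, h7⟩ := G.view_iff.1 h2
  rw [← hpos] at h4 h5 h6
  have h8 := h4.2.2.1
  rcases Sym2.eq_iff.1 h3 with ⟨rfl, h9⟩ | ⟨rfl, h9⟩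
  · rwa [M.rev.injective h9]
  -- If the roles were exchanged, a dart that points to the right would also point to the left.
  · have h10 := hd.1.trans_lt hd.2
    have h11 := h6.1.trans_lt (h8.trans_le h6.2)
    rw [M.rev_rev] at h10
    exact absurd h10 h11.not_gt

/-- Flat foldings with the same positions and touching pairs are equal. -/
theorem FlatFolding.eq_of_touching_subset {F G : M.FlatFolding} (h : F.touching ⊆ G.touching)
    (hpos : F.pos = G.pos) : F = G := by
  have key : ∀ c d e, M.ExitsRight F.pos c d → M.ExitsRight F.pos c e → F.below d e →
      G.below d e := by
    intro c d e hd he hde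
    let r := M.diskRank F.pos F.below c
    -- Climb from `d` to `e` through consecutive edges, by induction on the rank of `e`.
    suffices H : ∀ (n : ℕ) (e : M.DiskDart F.pos c), r e = n → M.ExitsRight F.pos c e →
        F.below d e → G.below d e from H _ ⟨e, Or.inl he⟩ rfl he hde
    intro n
    induction n using Nat.strong_induction_on with
    | _ n ih =>
      intro e hn he hde
      obtain ⟨g, hg, hge, hgd, hno⟩ := F.isStack.exists_prev hd hde
      have h1 := exists_below_of_touching h hpos hg he hge hno
      rcases hgd with rfl | hgd
      · exact h1
      · have h2 := ih (r ⟨g, Or.inl hg⟩) (by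
          rw [← hn]
          exact (F.isStack.diskRank_lt_iff _ _).2 ((prec_right_iff hg he).2 hge))
          ⟨g, Or.inl hg⟩ rfl hg hgd
        exact G.isStack.trans c d g e (hpos ▸ hd) (hpos ▸ hg) (hpos ▸ he) h2 h1
  have hview : F.view = G.view := by
    ext a b d e
    rw [F.view_iff, G.view_iff, ← hpos]
    refine and_congr_right fun hab => and_congr_right fun hd => and_congr_right fun he => ?_
    rw [over_iff_exitsRight hab le_rfl hab.2.2.1] at hd he
    refine ⟨key a d e hd he, fun h' => ?_⟩
    have hne : d ≠ e := by
      rintro rfl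
      exact G.isStack.irrefl _ h'
    refine (F.isStack.total a d e hd he hne).resolve_right fun h'' => ?_
    have h3 := key a e d he hd h''
    rw [hpos] at hd he
    exact G.isStack.asymm hd he h' h3
  cases F
  cases G
  simp only at hpos hview
  subst hpos hview
  rfl

/-- A flat folding of a connected graph is determined by its touching pairs, up to equivalence. -/
theorem FlatFolding.equivalent_of_touching_subset (hM : M.Connected) {F G : M.FlatFolding}
    (h : F.touching ⊆ G.touching) : F.Equivalent G := by
  -- Both foldings realize the same angles, so they turn straight at the same corners and their
  -- positions can be aligned.
  obtain ⟨F', hF, hpos⟩ := F.exists_equivalent_pos (hM.placement_unique F.isPlacement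
    G.isPlacement fun d => by rw [← F.foldedAngle_eq_180_iff, ← G.foldedAngle_eq_180_iff])
  rw [hF.touching_eq] at h
  rwa [← eq_of_touching_subset h hpos]

end AngledMap

/-! ### Touching edges over a point -/

namespace AngledMap

open CyclicOrder

section Touch

variable {D : Type*} {M : AngledMap D}

/-- `e` is the next edge above `d` just to the right of `c`. -/
def Touch (M : AngledMap D) (pos : D → ℝ) (B : D → D → Prop) (c : ℝ) (d e : D) : Prop :=
  M.ExitsRight pos c d ∧ M.ExitsRight pos c e ∧ B d e ∧
    ∀ g, M.ExitsRight pos c g → ¬ (B d g ∧ B g e)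

theorem IsPathEdge.exitsRight_iff {pos : D → ℝ} {a b c : ℝ} (h : IsPathEdge pos a b) (h1 : a ≤ c)
    (h2 : c < b) (d : D) : M.ExitsRight pos c d ↔ M.ExitsRight pos a d := by
  rw [← over_iff_exitsRight h h1 h2, over_iff_exitsRight h le_rfl h.2.2.1]

theorem IsPathEdge.touch_iff {pos : D → ℝ} {B : D → D → Prop} {a b c : ℝ}
    (h : IsPathEdge pos a b) (h1 : a ≤ c) (h2 : c < b) (d e : D) :
    M.Touch pos B c d e ↔ M.Touch pos B a d e := by
  simp only [Touch, h.exitsRight_iff h1 h2]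

theorem FlatFolding.angle_le (F : M.FlatFolding) (d : D) : M.angle d ≤ 360 := by
  rw [← F.angle_eq]
  unfold foldedAngle
  split_ifs <;> simp

variable [Finite D]

theorem FlatFolding.mem_touching_iff (F : M.FlatFolding) {d e : D} :
    s(d, e) ∈ F.touching ↔ ∃ c ∈ Set.range F.pos, M.Touch F.pos F.below c d (M.rev e) ∨
      M.Touch F.pos F.below c e (M.rev d) := by
  have key : ∀ d e : D, (∃ c ∈ Set.range F.pos, M.Touch F.pos F.below c d e) ↔
      ∃ a b, F.view a b d e ∧ ∀ g, ¬ (F.view a b d g ∧ F.view a b g e) := by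
    intro d e
    constructor
    · rintro ⟨c, hc, hd, he, hde, hn⟩
      obtain ⟨a, b, hab, ha, hb, -⟩ := exists_isPathEdge_right hd.1 hd.2
      have ho := over_iff_exitsRight (M := M) hab ha hb
      refine ⟨a, b, F.view_iff.2 ⟨hab, (ho d).2 hd, (ho e).2 he, hde⟩, fun g hg => ?_⟩
      have h2 := F.view_iff.1 hg.1
      have h3 := F.view_iff.1 hg.2
      exact hn g ((ho g).1 h2.2.2.1) ⟨h2.2.2.2, h3.2.2.2⟩
    · rintro ⟨a, b, h, hn⟩
      obtain ⟨hab, hd, he, hde⟩ := F.view_iff.1 h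
      have ho := over_iff_exitsRight (M := M) hab le_rfl hab.2.2.1
      exact ⟨a, hab.1, (ho d).1 hd, (ho e).1 he, hde, fun g hg hdg => hn g
        ⟨F.view_iff.2 ⟨hab, hd, (ho g).2 hg, hdg.1⟩, F.view_iff.2 ⟨hab, (ho g).2 hg, he, hdg.2⟩⟩⟩
  constructor
  · rintro ⟨a, b, d', e', h1, h2, h3⟩
    obtain ⟨c, hc, h4⟩ := (key d' e').2 ⟨a, b, h1, h2⟩
    rcases Sym2.eq_iff.1 h3 with ⟨rfl, rfl⟩ | ⟨rfl, rfl⟩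
    · exact ⟨c, hc, Or.inl (by rwa [M.rev_rev])⟩
    · exact ⟨c, hc, Or.inr (by rwa [M.rev_rev])⟩
  · rintro ⟨c, hc, h | h⟩
    · obtain ⟨a, b, h1, h2⟩ := (key _ _).1 ⟨c, hc, h⟩
      exact ⟨a, b, d, M.rev e, h1, h2, by rw [M.rev_rev]⟩
    · obtain ⟨a, b, h1, h2⟩ := (key _ _).1 ⟨c, hc, h⟩
      exact ⟨a, b, e, M.rev d, h1, h2, by rw [M.rev_rev, Sym2.eq_swap]⟩

theorem IsStack.exists_bottom {pos : D → ℝ} {B : D → D → Prop} (h : M.IsStack pos B) {c : ℝ}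
    {d : D} (hd : M.ExitsRight pos c d) : ∃ g, M.ExitsRight pos c g ∧ (g = d ∨ B g d) ∧
      ∀ x, M.ExitsRight pos c x → ¬ B x g := by
  obtain ⟨g, hg, hmin⟩ := Set.exists_min_image
    {x : M.DiskDart pos c | M.ExitsRight pos c x} (M.diskRank pos B c) (Set.toFinite _)
    ⟨⟨d, Or.inl hd⟩, hd⟩
  have key : ∀ x, M.ExitsRight pos c x → ¬ B x g := fun x hx hxg => by
    have := hmin ⟨x, Or.inl hx⟩ hx
    have h2 := (h.diskRank_lt_iff ⟨x, Or.inl hx⟩ g).2 ((prec_right_iff hx hg).2 hxg)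
    omega
  refine ⟨g, hg, ?_, key⟩
  by_cases hgd : (g : D) = d
  · exact Or.inl hgd
  · exact Or.inr ((h.total c g d hg hd hgd).resolve_right (key d hd))

theorem IsStack.exists_top {pos : D → ℝ} {B : D → D → Prop} (h : M.IsStack pos B) {c : ℝ}
    {d : D} (hd : M.ExitsRight pos c d) : ∃ g, M.ExitsRight pos c g ∧ (g = d ∨ B d g) ∧
      ∀ x, M.ExitsRight pos c x → ¬ B g x := by
  obtain ⟨g, hg, hmax⟩ := Set.exists_max_image
    {x : M.DiskDart pos c | M.ExitsRight pos c x} (M.diskRank pos B c) (Set.toFinite _)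
    ⟨⟨d, Or.inl hd⟩, hd⟩
  have key : ∀ x, M.ExitsRight pos c x → ¬ B g x := fun x hx hxg => by
    have := hmax ⟨x, Or.inl hx⟩ hx
    have h2 := (h.diskRank_lt_iff g ⟨x, Or.inl hx⟩).2 ((prec_right_iff hg hx).2 hxg)
    omega
  refine ⟨g, hg, ?_, key⟩
  by_cases hgd : (g : D) = d
  · exact Or.inl hgd
  · exact Or.inr ((h.total c g d hg hd hgd).resolve_left (key d hd))

theorem FlatFolding.angle_eq_turn_of_eq (F : M.FlatFolding) {c : ℝ} (y : M.DiskDart F.pos c)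
    (hy : F.pos y = c) : (M.angle y : ℤ) = 180 * (2 - turn (M.diskRank F.pos F.below c)
      (M.side F.pos c) (F.isPlacement.diskPerm c) y) := by
  rcases y with ⟨d, hd⟩
  change F.pos d = c at hy
  subst hy
  exact F.angle_eq_turn d

end Touch

/-! ### From a folding of a graph to foldings of the cycles of its faces -/

section FaceCycle

variable {D : Type*} {M : AngledMap D} {X : Type*}

/-- `C` is the cycle that is obtained by walking around the face `f` of `M`; its sides in the face
are indexed by `X`. -/
structure IsFaceCycle (M : AngledMap D) (f : M.Face) (C : AngledMap (X × Bool)) (ι : X → D)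
    (τ : Equiv.Perm X) : Prop where
  inj : Function.Injective ι
  mem : ∀ d, (∃ x, ι x = d) ↔ M.faceOf d = f
  next : ∀ x, ι (τ x) = M.faceNext (ι x)
  rev : ∀ x b, C.rev (x, b) = (x, !b)
  rot_true : ∀ x, C.rot (x, true) = (τ x, false)
  rot_false : ∀ x, C.rot (x, false) = (τ⁻¹ x, true)
  len : ∀ p, C.len p = M.len (ι p.1)
  angle_true : ∀ x, C.angle (x, true) = 360 - M.angle (ι (τ x))
  angle_false : ∀ x, C.angle (x, false) = M.angle (ι x)
  outer : ∀ p, p ∈ C.outer ↔ (p.2 = false ↔ ι p.1 ∈ M.outer)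

/-- The cycle of a face is treated abstractly because the same `eulerCycle f` also serves as the
cycle of a face of the boundary graph of `f`. -/
theorem eulerCycle_isFaceCycle (f : M.Face) :
    M.IsFaceCycle f (M.eulerCycle f) Subtype.val (M.tourNext f) where
  inj := Subtype.val_injective
  mem d := ⟨fun ⟨x, hx⟩ => hx ▸ x.2, fun h => ⟨⟨d, h⟩, rfl⟩⟩
  next _ := rfl
  rev _ _ := rfl
  rot_true _ := rfl
  rot_false _ := rfl
  len _ := rfl
  angle_true _ := rfl
  angle_false _ := rfl
  outer _ := Iff.rfl

/-- The dart that is parallel to a dart of the cycle. -/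
def parallel (M : AngledMap D) (ι : X → D) (p : X × Bool) : D :=
  if p.2 then M.rev (ι p.1) else ι p.1

variable {f : M.Face} {C : AngledMap (X × Bool)} {ι : X → D} {τ : Equiv.Perm X}

namespace IsFaceCycle

theorem faceOf_ι (h : M.IsFaceCycle f C ι τ) (x : X) : M.faceOf (ι x) = f := (h.mem _).1 ⟨x, rfl⟩

theorem next_inv (h : M.IsFaceCycle f C ι τ) (x : X) : M.faceNext (ι (τ⁻¹ x)) = ι x := by
  rw [← h.next]; simp

theorem parallel_rev (h : M.IsFaceCycle f C ι τ) (p : X × Bool) :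
    M.parallel ι (C.rev p) = M.rev (M.parallel ι p) := by
  rcases p with ⟨x, _ | _⟩ <;> simp [h.rev, parallel, M.rev_rev]

theorem parallel_rot_false (h : M.IsFaceCycle f C ι τ) (x : X) :
    M.parallel ι (C.rot (x, false)) = M.rot (M.parallel ι (x, false)) := by
  rw [h.rot_false]
  change M.rev (ι (τ⁻¹ x)) = M.rot (ι x)
  rw [← h.next_inv x, rot_faceNext]

/-- On the far side of the cycle the corner is complementary to the one in `f`, so it is traversed
backwards. -/
theorem parallel_rot_true (h : M.IsFaceCycle f C ι τ) (x : X) :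
    M.parallel ι (C.rot (x, true)) = M.rot⁻¹ (M.parallel ι (x, true)) := by
  rw [h.rot_true]
  exact h.next x

theorem parallel_injective (h : M.IsFaceCycle f C ι τ) {p q : X × Bool}
    (hpq : M.parallel ι p = M.parallel ι q) (h2 : p.2 = q.2) : p = q := by
  rcases p with ⟨x, b⟩
  rcases q with ⟨y, b'⟩
  simp only at h2
  subst h2
  cases b
  · exact congrArg (·, _) (h.inj hpq)
  · exact congrArg (·, _) (h.inj (M.rev.injective hpq))

/-- Both `rev` and `rot` flip the Boolean, so a step along a face keeps it: it tells the two faces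
of the cycle apart. -/
theorem faceOf_snd (h : M.IsFaceCycle f C ι τ) [Finite X] {p q : X × Bool}
    (hpq : C.faceOf p = C.faceOf q) : p.2 = q.2 := by
  have h1 : C.faceNext.SameCycle p q :=
    Quotient.exact (s := Equiv.Perm.SameCycle.setoid C.faceNext) hpq
  refine (mem_of_sameCycle (S := {q | q.2 = p.2}) (fun x hx => ?_) rfl h1).symm
  rcases x with ⟨x, b⟩
  have h2 : C.rot (C.faceNext (x, b)) = (x, !b) := by rw [rot_faceNext, h.rev]
  rcases h3 : C.faceNext (x, b) with ⟨y, b'⟩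
  rw [h3] at h2
  refine Eq.trans ?_ hx
  cases b' <;> simp [h.rot_false, h.rot_true] at h2 ⊢ <;> simp [h2.2]

theorem connected [Finite D] (h : M.IsFaceCycle f C ι τ) : C.Connected := by
  have hb : ∀ x b b', Relation.EqvGen (fun a b => b = C.rot a ∨ b = C.rev a) (x, b) (x, b') := by
    intro x b b'
    by_cases hbb : b = b'
    · subst hbb
      exact .refl _
    · refine .rel _ _ (Or.inr ?_)
      rw [h.rev]
      cases b <;> cases b' <;> simp_all
  have hstep : ∀ x b b', Relation.EqvGen (fun a b => b = C.rot a ∨ b = C.rev a)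
      (x, b) (τ x, b') := fun x b b' =>
    Relation.EqvGen.trans _ _ _ (hb x b true)
      (Relation.EqvGen.trans _ _ _ (.rel _ _ (Or.inl (h.rot_true x).symm)) (hb _ _ _))
  rintro ⟨x, b⟩ ⟨y, b'⟩
  have h1 : M.faceNext.SameCycle (ι x) (ι y) := Quotient.exact
    (s := Equiv.Perm.SameCycle.setoid M.faceNext) ((h.faceOf_ι x).trans (h.faceOf_ι y).symm)
  obtain ⟨n, -, hn⟩ := h1.exists_pow_eq'
  have h2 : ∀ n : ℕ, (M.faceNext ^ n) (ι x) = ι ((τ ^ n) x) := by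
    intro n
    induction n with
    | zero => simp
    | succ n ih => rw [pow_succ', Equiv.Perm.mul_apply, ih, pow_succ', Equiv.Perm.mul_apply, h.next]
  rw [h2] at hn
  obtain rfl := h.inj hn
  clear hn h1
  induction n generalizing b' with
  | zero => simpa using hb x b b'
  | succ n ih =>
    rw [pow_succ', Equiv.Perm.mul_apply]
    exact Relation.EqvGen.trans _ _ _ (ih false) (hstep _ _ _)

section Placement

variable (h : M.IsFaceCycle f C ι τ) (pos : D → ℝ)
include h

theorem exitsRight_iff {c : ℝ} {p : X × Bool} :
    C.ExitsRight (fun p => pos (M.parallel ι p)) c p ↔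
      M.ExitsRight pos c (M.parallel ι p) := by
  simp only [ExitsRight, h.parallel_rev]

theorem exitsLeft_iff {c : ℝ} {p : X × Bool} :
    C.ExitsLeft (fun p => pos (M.parallel ι p)) c p ↔
      M.ExitsLeft pos c (M.parallel ι p) := by
  simp only [ExitsLeft, h.parallel_rev]

theorem exits_iff {c : ℝ} {p : X × Bool} :
    C.Exits (fun p => pos (M.parallel ι p)) c p ↔ M.Exits pos c (M.parallel ι p) :=
  or_congr (h.exitsRight_iff pos) (h.exitsLeft_iff pos)

/-- The boundary point of a disk of `M` next to a boundary point of a disk of the cycle. -/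
def toDisk {c : ℝ} (p : C.DiskDart (fun p => pos (M.parallel ι p)) c) : M.DiskDart pos c :=
  ⟨M.parallel ι p, (h.exits_iff pos).1 p.2⟩

theorem toDisk_injective {c : ℝ} {p q : C.DiskDart (fun p => pos (M.parallel ι p)) c}
    (h1 : h.toDisk pos p = h.toDisk pos q) (h2 : (p : X × Bool).2 = (q : X × Bool).2) : p = q :=
  Subtype.ext (h.parallel_injective (congrArg Subtype.val h1) h2)

theorem side_eq {c : ℝ} (p : C.DiskDart (fun p => pos (M.parallel ι p)) c) :
    C.side (fun p => pos (M.parallel ι p)) c p = M.side pos c (h.toDisk pos p) := by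
  classical
  unfold side
  exact if_congr (h.exitsRight_iff pos) rfl rfl

variable {pos}

theorem isPlacement (hP : M.IsPlacement pos) : C.IsPlacement fun p => pos (M.parallel ι p) where
  rot p := by
    rcases p with ⟨x, _ | _⟩
    · rw [h.parallel_rot_false, hP.rot]
    · rw [h.parallel_rot_true, rot_inv_pos hP]
  abs p := by
    rw [h.parallel_rev, hP.abs, h.len]
    rcases p with ⟨x, _ | _⟩ <;> simp [parallel, M.len_rev]

variable (hP : M.IsPlacement pos)

theorem diskPerm_false {c : ℝ} (p : C.DiskDart (fun p => pos (M.parallel ι p)) c)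
    (hp : (p : X × Bool).2 = false) :
    ((h.isPlacement hP).diskPerm c p : X × Bool).2 = true ∧
    h.toDisk pos ((h.isPlacement hP).diskPerm c p) = hP.diskPerm c (h.toDisk pos p) := by
  rcases p with ⟨⟨x, b⟩, hx⟩
  simp only at hp
  subst hp
  by_cases hc : pos (M.parallel ι (x, false)) = c
  · have h1 := (h.isPlacement hP).diskPerm_of_eq ⟨(x, false), hx⟩ hc
    refine ⟨by rw [h1, h.rot_false], Subtype.ext ?_⟩
    rw [hP.diskPerm_of_eq _ hc]
    change M.parallel ι _ = _
    rw [h1, h.parallel_rot_false]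
    rfl
  · have h1 := (h.isPlacement hP).diskPerm_of_ne ⟨(x, false), hx⟩ hc
    refine ⟨by rw [h1, h.rev]; rfl, Subtype.ext ?_⟩
    rw [hP.diskPerm_of_ne _ hc]
    change M.parallel ι _ = _
    rw [h1, h.parallel_rev]
    rfl

theorem diskPerm_true {c : ℝ} (p : C.DiskDart (fun p => pos (M.parallel ι p)) c)
    (hp : (p : X × Bool).2 = true) :
    ((h.isPlacement hP).diskPerm c p : X × Bool).2 = false ∧
    h.toDisk pos ((h.isPlacement hP).diskPerm c p) = (hP.diskPerm c)⁻¹ (h.toDisk pos p) := by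
  rcases p with ⟨⟨x, b⟩, hx⟩
  simp only at hp
  subst hp
  by_cases hc : pos (M.parallel ι (x, true)) = c
  · have h1 := (h.isPlacement hP).diskPerm_of_eq ⟨(x, true), hx⟩ hc
    refine ⟨by rw [h1, h.rot_true], Subtype.ext ?_⟩
    rw [hP.diskPerm_inv_of_eq _ hc]
    change M.parallel ι _ = _
    rw [h1, h.parallel_rot_true]
    rfl
  · have h1 := (h.isPlacement hP).diskPerm_of_ne ⟨(x, true), hx⟩ hc
    refine ⟨by rw [h1, h.rev]; rfl, Subtype.ext ?_⟩
    rw [hP.diskPerm_inv_of_ne _ hc]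
    change M.parallel ι _ = _
    rw [h1, h.parallel_rev]
    rfl

/-- All vertices of the cycle have degree 2, so a component in a disk has two boundary points. -/
theorem diskPerm_diskPerm {c : ℝ} (p : C.DiskDart (fun p => pos (M.parallel ι p)) c) :
    (h.isPlacement hP).diskPerm c ((h.isPlacement hP).diskPerm c p) = p := by
  rcases hp : (p : X × Bool).2 with _ | _
  · obtain ⟨h1, h2⟩ := h.diskPerm_false hP p hp
    obtain ⟨h3, h4⟩ := h.diskPerm_true hP _ h1
    refine h.toDisk_injective pos ?_ (h3.trans hp.symm)
    rw [h4, h2]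
    exact (hP.diskPerm c).symm_apply_apply _
  · obtain ⟨h1, h2⟩ := h.diskPerm_true hP p hp
    obtain ⟨h3, h4⟩ := h.diskPerm_false hP _ h1
    refine h.toDisk_injective pos ?_ (h3.trans hp.symm)
    rw [h4, h2]
    exact (hP.diskPerm c).apply_symm_apply _

end Placement

section Fold

/-- The order of the edges of the cycle: an edge that has the face on both sides gives two edges
of the cycle, and the one with the face below it is the lower one. -/
def order (F : M.FlatFolding) (ι : X → D) (p q : X × Bool) : Prop :=
  F.below (M.parallel ι p) (M.parallel ι q) ∨
    (M.parallel ι p = M.parallel ι q ∧ p.2 = true ∧ q.2 = false)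

variable (h : M.IsFaceCycle f C ι τ) (F : M.FlatFolding)
include h

variable [Finite D]

theorem isStack : C.IsStack (fun p => F.pos (M.parallel ι p)) (order F ι) where
  irrefl p := by
    rintro (h1 | ⟨-, h1, h2⟩)
    · exact F.isStack.irrefl _ h1
    · simp [h1] at h2
  trans c p q r hp hq hr h1 h2 := by
    rw [h.exitsRight_iff F.pos] at hp hq hr
    rcases h1 with h1 | ⟨h1, h3, h4⟩ <;> rcases h2 with h2 | ⟨h2, h5, h6⟩
    · exact Or.inl (F.isStack.trans c _ _ _ hp hq hr h1 h2)
    · exact Or.inl (h2 ▸ h1)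
    · exact Or.inl (h1 ▸ h2)
    · simp [h4] at h5
  total c p q hp hq hne := by
    rw [h.exitsRight_iff F.pos] at hp hq
    by_cases heq : M.parallel ι p = M.parallel ι q
    · have h1 : p.2 ≠ q.2 := fun h' => hne (h.parallel_injective heq h')
      rcases hp2 : p.2 with _ | _ <;> rcases hq2 : q.2 with _ | _
      · simp [hp2, hq2] at h1
      · exact Or.inr (Or.inr ⟨heq.symm, hq2, hp2⟩)
      · exact Or.inl (Or.inr ⟨heq, hp2, hq2⟩)
      · simp [hp2, hq2] at h1
    · exact (F.isStack.total c _ _ hp hq heq).imp Or.inl Or.inl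

open Classical in
/-- The position on the boundary of a disk. -/
noncomputable def position {c : ℝ} (p : C.DiskDart (fun p => F.pos (M.parallel ι p)) c) : ℕ :=
  2 * M.diskRank F.pos F.below c (h.toDisk F.pos p) + if (p : X × Bool).2 then 0 else 1

/-- A boundary point of rank `r` is replaced by the positions `2 * r` (Boolean `true`) and `2 * r +
1` (Boolean `false`). The arc from the second copy of `d` to the first copy of its successor
contains exactly the copies of the points in the arc of `M`. -/
theorem arc_position_iff {c : ℝ} (d b : C.DiskDart (fun p => F.pos (M.parallel ι p)) c)
    (hd : (d : X × Bool).2 = false) :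
    Arc (h.position F) d b ((h.isPlacement F.isPlacement).diskPerm c d) ↔
      Arc (M.diskRank F.pos F.below c) (h.toDisk F.pos d) (h.toDisk F.pos b)
        (F.isPlacement.diskPerm c (h.toDisk F.pos d)) := by
  obtain ⟨h1, h2⟩ := h.diskPerm_false F.isPlacement d hd
  rw [← h2]
  unfold Arc position
  rw [hd, h1]
  rcases (b : X × Bool).2 with _ | _ <;> simp <;> omega

/-- On `false` points the permutation of the cycle acts as that of `M`, on `true` points as its
inverse, and an arc of `M` is invariant under both. -/
theorem arc_position_invariant {c : ℝ} {d b : C.DiskDart (fun p => F.pos (M.parallel ι p)) c}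
    (hd : (d : X × Bool).2 = false)
    (hb : Arc (h.position F) d b ((h.isPlacement F.isPlacement).diskPerm c d)) :
    Arc (h.position F) d ((h.isPlacement F.isPlacement).diskPerm c b) ((h.isPlacement F.isPlacement).diskPerm c d) := by
  rw [h.arc_position_iff F _ _ hd] at hb ⊢
  rcases hb2 : (b : X × Bool).2 with _ | _
  · rw [(h.diskPerm_false F.isPlacement b hb2).2]
    exact F.noncrossing c _ _ hb
  · rw [(h.diskPerm_true F.isPlacement b hb2).2, ← (F.noncrossing c).arc_iff]
    simpa using hb

/-- If the lowest side of an edge in the cycle faces down into `f`, the gap below it is exterior: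
any next lower edge of `M` would also have `f` above it and supply a lower side. If it faces up into
`f`, then `f` cannot be exterior, since the lowest edge of `M` would have `f` below it. -/
theorem bottom (hM : M.Connected)
    (ho : (∀ d, M.faceOf d = f ↔ d ∈ M.outer) ∨ ∀ d, M.faceOf d = f → d ∉ M.outer)
    {c : ℝ} {p : X × Bool} (hp : C.ExitsRight (fun p => F.pos (M.parallel ι p)) c p)
    (hn : ∀ q, C.ExitsRight (fun p => F.pos (M.parallel ι p)) c q → ¬ order F ι q p) :
    C.rev p ∈ C.outer := by
  rw [h.outer]
  rcases p with ⟨x, b⟩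
  rw [h.exitsRight_iff F.pos] at hp
  simp only [h.exitsRight_iff F.pos] at hn
  rw [h.rev]
  cases b
  · simp only [Bool.not_false, Bool.true_eq_false, false_iff]
    rcases ho with ho | ho
    · obtain ⟨g, hg, hgp, hbot⟩ := F.isStack.exists_bottom hp
      have h1 := F.rev_mem_outer hg hbot
      rw [← ho, ← h.mem] at h1
      obtain ⟨y, hy⟩ := h1
      have h2 : M.parallel ι (y, true) = g := by simp [parallel, hy, M.rev_rev]
      refine absurd ?_ (hn (y, true) (by rwa [h2]))
      rcases hgp with rfl | hgp
      · exact Or.inr ⟨h2, rfl, rfl⟩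
      · exact Or.inl (by rwa [h2])
    · exact ho _ (h.faceOf_ι x)
  · simp only [Bool.not_true, true_iff]
    rcases ho with ho | ho
    · exact (ho _).1 (h.faceOf_ι x)
    · by_cases hex : ∃ e, M.ExitsRight F.pos c e ∧ F.below e (M.parallel ι (x, true))
      · obtain ⟨e, he, hep⟩ := hex
        obtain ⟨g, hg, hgp, -, hno⟩ := F.isStack.exists_prev he hep
        have h1 := F.faceOf_eq_of_touching hM hg hp hgp hno
        rw [show M.rev (M.parallel ι (x, true)) = ι x from M.rev_rev _, h.faceOf_ι, ← h.mem] at h1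
        obtain ⟨y, rfl⟩ := h1
        exact absurd (Or.inl hgp) (hn (y, false) hg)
      · have h1 := F.rev_mem_outer hp fun e he hep => hex ⟨e, he, hep⟩
        rwa [show M.rev (M.parallel ι (x, true)) = ι x from M.rev_rev _] at h1

theorem top (hM : M.Connected)
    (ho : (∀ d, M.faceOf d = f ↔ d ∈ M.outer) ∨ ∀ d, M.faceOf d = f → d ∉ M.outer)
    {c : ℝ} {p : X × Bool} (hp : C.ExitsRight (fun p => F.pos (M.parallel ι p)) c p)
    (hn : ∀ q, C.ExitsRight (fun p => F.pos (M.parallel ι p)) c q → ¬ order F ι p q) :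
    p ∈ C.outer := by
  rw [h.outer]
  rcases p with ⟨x, b⟩
  rw [h.exitsRight_iff F.pos] at hp
  simp only [h.exitsRight_iff F.pos] at hn
  cases b
  · simp only [true_iff]
    rcases ho with ho | ho
    · exact (ho _).1 (h.faceOf_ι x)
    · by_cases hex : ∃ e, M.ExitsRight F.pos c e ∧ F.below (M.parallel ι (x, false)) e
      · obtain ⟨e, he, hep⟩ := hex
        obtain ⟨g, hg, hgp, -, hno⟩ := F.isStack.exists_next he hep
        have h1 := (F.faceOf_eq_of_touching hM hp hg hgp hno).symm
        change _ = M.faceOf (ι x) at h1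
        rw [h.faceOf_ι, ← h.mem] at h1
        obtain ⟨y, hy⟩ := h1
        have h2 : M.parallel ι (y, true) = g := by simp [parallel, hy, M.rev_rev]
        exact absurd (Or.inl (by rwa [h2])) (hn (y, true) (by rwa [h2]))
      · exact F.mem_outer hp fun e he hep => hex ⟨e, he, hep⟩
  · simp only [Bool.true_eq_false, false_iff]
    rcases ho with ho | ho
    · obtain ⟨g, hg, hgp, htop⟩ := F.isStack.exists_top hp
      have h1 := F.mem_outer hg htop
      rw [← ho, ← h.mem] at h1
      obtain ⟨y, rfl⟩ := h1
      refine absurd ?_ (hn (y, false) hg)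
      rcases hgp with hgp | hgp
      · exact Or.inr ⟨hgp.symm, rfl, rfl⟩
      · exact Or.inl hgp
    · exact ho _ (h.faceOf_ι x)

variable [Finite X]

theorem rank_lt_iff {c : ℝ} (p q : C.DiskDart (fun p => F.pos (M.parallel ι p)) c) :
    C.diskRank (fun p => F.pos (M.parallel ι p)) (order F ι) c p <
      C.diskRank (fun p => F.pos (M.parallel ι p)) (order F ι) c q ↔
    h.position F p < h.position F q := by
  rw [(h.isStack F).diskRank_lt_iff]
  have h1 : C.Prec (fun p => F.pos (M.parallel ι p)) (order F ι) c p q ↔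
      M.Prec F.pos F.below c (M.parallel ι p) (M.parallel ι q) ∨
      (M.parallel ι p = M.parallel ι q ∧ (p : X × Bool).2 = true ∧ (q : X × Bool).2 = false) := by
    have hb : ∀ p : X × Bool, (C.rev p).2 = !p.2 := fun p => by
      rcases p with ⟨x, b⟩
      rw [h.rev]
    have hex := (h.toDisk F.pos p).2
    simp only [toDisk] at hex
    unfold Prec order
    simp only [h.exitsRight_iff F.pos, h.exitsLeft_iff F.pos, h.parallel_rev, hb, M.rev.injective.eq_iff,
      Bool.not_eq_true', Bool.not_eq_false']
    constructor
    · rintro (h1 | ⟨h1, h2, h3 | h3⟩ | ⟨h1, h2, h3 | h3⟩) <;> tauto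
    · rintro (h1 | ⟨h1, h2, h3⟩)
      · tauto
      · rw [← h1]
        rcases hex with hex | hex <;> tauto
  have h2 : M.parallel ι p = M.parallel ι q ↔
      M.diskRank F.pos F.below c (h.toDisk F.pos p) = M.diskRank F.pos F.below c (h.toDisk F.pos q) := by
    rw [(F.isStack.diskRank_injective c).eq_iff, ← Subtype.coe_inj]
    rfl
  have h3 := F.isStack.diskRank_lt_iff (h.toDisk F.pos p) (h.toDisk F.pos q)
  rw [h1, h2]
  change _ ↔ M.Prec F.pos F.below c (M.parallel ι p) (M.parallel ι q) at h3
  rw [← h3]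
  unfold position
  rcases (p : X × Bool).2 with _ | _ <;> rcases (q : X × Bool).2 with _ | _ <;> simp <;> omega

theorem arc_iff {c : ℝ} (p q r : C.DiskDart (fun p => F.pos (M.parallel ι p)) c) :
    Arc (C.diskRank (fun p => F.pos (M.parallel ι p)) (order F ι) c) p q r ↔
      Arc (h.position F) p q r := by
  unfold Arc
  simp only [h.rank_lt_iff]

theorem position_injective (c : ℝ) :
    Function.Injective (h.position F : C.DiskDart (fun p => F.pos (M.parallel ι p)) c → ℕ) := by
  intro p q hpq
  apply (h.isStack F).diskRank_injective c
  have h1 := h.rank_lt_iff F p q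
  have h2 := h.rank_lt_iff F q p
  omega

/-- For a `false` point this is the invariance of an arc of `M`. For a `true` point, the arc is
complementary to the closed arc from `ν d` to `d`, whose interior is invariant by the first case
because `ν` is an involution. -/
theorem noncrossing (c : ℝ) :
    Noncrossing (C.diskRank (fun p => F.pos (M.parallel ι p)) (order F ι) c)
      ((h.isPlacement F.isPlacement).diskPerm c) := by
  intro d b hb
  rw [h.arc_iff] at hb ⊢
  rcases hd : (d : X × Bool).2 with _ | _
  · exact h.arc_position_invariant F hd hb
  · obtain ⟨h1, -⟩ := h.diskPerm_true F.isPlacement d hd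
    have h2 := h.diskPerm_diskPerm F.isPlacement d
    have h3 := h.diskPerm_diskPerm F.isPlacement b
    set ν := (h.isPlacement F.isPlacement).diskPerm c
    have h4 : ¬ Arc (h.position F) (ν d) (ν b) d := fun h' => by
      have h'' : Arc (h.position F) (ν d) (ν b) (ν (ν d)) := by rwa [h2]
      have h5 := h.arc_position_invariant F h1 h''
      change Arc _ _ (ν (ν b)) (ν (ν d)) at h5
      rw [h2, h3] at h5
      have h6 : ν d ≠ d := fun h6 => by simp [h6, hd] at h1
      have h7 := (h.position_injective F c).ne h6
      unfold Arc at hb h5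
      omega
    have h5 : ν b ≠ ν d := fun h' => by
      rw [ν.injective h'] at hb
      exact not_arc_left _ _ _ hb
    have h6 : ν b ≠ d := fun h' => by
      have h7 : b = ν d := by rw [← h', h3]
      rw [h7] at hb
      unfold Arc at hb
      omega
    have h7 := (h.position_injective F c).ne h5
    have h8 := (h.position_injective F c).ne h6
    unfold Arc at h4 ⊢
    omega

/-- A `false` corner copies a corner of `M`. A `true` corner runs between the same boundary points
as a corner of `M` in the opposite direction. The terms for the sides cancel and exactly one of the
two comparisons holds, so the turns add up to 2 and the angles to 360. -/
theorem angle_disk {c : ℝ} (y : C.DiskDart (fun p => F.pos (M.parallel ι p)) c)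
    (hy : F.pos (M.parallel ι y) = c) : (C.angle y : ℤ) =
    180 * (2 - turn (C.diskRank (fun p => F.pos (M.parallel ι p)) (order F ι) c)
      (C.side (fun p => F.pos (M.parallel ι p)) c) ((h.isPlacement F.isPlacement).diskPerm c) y) := by
  classical
  rcases hp : (y : X × Bool).2 with _ | _
  · obtain ⟨h1, h2⟩ := h.diskPerm_false F.isPlacement y hp
    have h3 : C.angle y = M.angle (h.toDisk F.pos y) := by
      rcases y with ⟨⟨x, b⟩, hx⟩
      simp only at hp
      subst hp
      exact h.angle_false x
    rw [h3, F.angle_eq_turn_of_eq (h.toDisk F.pos y) hy]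
    unfold turn
    rw [h.side_eq, h.side_eq, h2]
    have h4 : C.diskRank (fun p => F.pos (M.parallel ι p)) (order F ι) c y <
        C.diskRank (fun p => F.pos (M.parallel ι p)) (order F ι) c
          ((h.isPlacement F.isPlacement).diskPerm c y) ↔
        M.diskRank F.pos F.below c (h.toDisk F.pos y) <
          M.diskRank F.pos F.below c (F.isPlacement.diskPerm c (h.toDisk F.pos y)) := by
      rw [h.rank_lt_iff, ← h2]
      unfold position
      rw [h1, hp]
      simp
      omega
    by_cases h5 : M.diskRank F.pos F.below c (h.toDisk F.pos y) <
          M.diskRank F.pos F.below c (F.isPlacement.diskPerm c (h.toDisk F.pos y))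
    · rw [if_pos h5, if_pos (h4.2 h5)]
    · rw [if_neg h5, if_neg (mt h4.1 h5)]
  · obtain ⟨h1, h2⟩ := h.diskPerm_true F.isPlacement y hp
    obtain ⟨z, hz⟩ : ∃ z, z = h.toDisk F.pos ((h.isPlacement F.isPlacement).diskPerm c y) := ⟨_, rfl⟩
    have hzy : F.isPlacement.diskPerm c z = h.toDisk F.pos y := by
      rw [hz, h2]
      exact (F.isPlacement.diskPerm c).apply_symm_apply _
    have h5 : (z : D) = M.rot⁻¹ (M.parallel ι y) := by
      rw [hz, h2, F.isPlacement.diskPerm_inv_of_eq _ hy]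
      rfl
    have hzc : F.pos z = c := by
      rw [h5, rot_inv_pos F.isPlacement, hy]
    have h3 : C.angle y = 360 - M.angle z := by
      rw [h5]
      rcases y with ⟨⟨x, b⟩, hx⟩
      simp only at hp
      subst hp
      rw [h.angle_true, h.next]
      rfl
    have h7 := F.angle_eq_turn_of_eq z hzc
    rw [h3, Nat.cast_sub (F.angle_le z), h7]
    unfold turn
    rw [hzy, h.side_eq, h.side_eq, ← hz]
    have h4 : C.diskRank (fun p => F.pos (M.parallel ι p)) (order F ι) c y <
        C.diskRank (fun p => F.pos (M.parallel ι p)) (order F ι) c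
          ((h.isPlacement F.isPlacement).diskPerm c y) ↔
        ¬ M.diskRank F.pos F.below c z < M.diskRank F.pos F.below c (h.toDisk F.pos y) := by
      rw [h.rank_lt_iff]
      unfold position
      rw [h1, hp, ← hz]
      simp
    by_cases h6 : M.diskRank F.pos F.below c z < M.diskRank F.pos F.below c (h.toDisk F.pos y)
    · rw [if_pos h6, if_neg (fun h' => h4.1 h' h6)]
      push_cast
      ring
    · rw [if_neg h6, if_pos (h4.2 h6)]
      push_cast
      ring

theorem angle (p : X × Bool) : (C.angle p : ℤ) =
    180 * (2 - turn (C.diskRank (fun p => F.pos (M.parallel ι p)) (order F ι)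
      (F.pos (M.parallel ι p))) (C.side (fun p => F.pos (M.parallel ι p)) (F.pos (M.parallel ι p)))
      ((h.isPlacement F.isPlacement).diskPerm (F.pos (M.parallel ι p)))
      ⟨p, (h.isPlacement F.isPlacement).exits_self p⟩) :=
  h.angle_disk F ⟨p, (h.isPlacement F.isPlacement).exits_self p⟩ rfl

variable (hM : M.Connected)
include hM

/-- A flat folding gives a flat folding of the cycle of every face that is the exterior face or does
not belong to it. -/
noncomputable def fold
    (ho : (∀ d, M.faceOf d = f ↔ d ∈ M.outer) ∨ ∀ d, M.faceOf d = f → d ∉ M.outer) :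
    C.FlatFolding :=
  FlatFolding.ofStack (h.isPlacement F.isPlacement) (h.isStack F) (fun c _ => h.noncrossing F c) (h.angle F)
    (fun _ _ _ hd hn => h.bottom F hM ho hd hn) (fun _ _ _ hd hn => h.top F hM ho hd hn)

/-- If the two sides are consecutive in the cycle, any edge of `M` just above the lower one would
bound `f` as well, hence would have a side of the cycle in between. -/
theorem touch_fold_iff
    (ho : (∀ d, M.faceOf d = f ↔ d ∈ M.outer) ∨ ∀ d, M.faceOf d = f → d ∉ M.outer)
    (c : ℝ) (x y : X) :
    C.Touch (h.fold F hM ho).pos (h.fold F hM ho).below c (x, false) (y, true) ↔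
      M.Touch F.pos F.below c (ι x) (M.rev (ι y)) := by
  have hb : ∀ p q, M.ExitsRight F.pos c (M.parallel ι p) →
      M.ExitsRight F.pos c (M.parallel ι q) →
      ((h.fold F hM ho).below p q ↔ order F ι p q) := by
    intro p q hp hq
    unfold fold
    rw [FlatFolding.ofStack_below]
    exact and_iff_left ⟨c, (h.exitsRight_iff F.pos).2 hp, (h.exitsRight_iff F.pos).2 hq⟩
  have hER : ∀ p, C.ExitsRight (h.fold F hM ho).pos c p ↔
      M.ExitsRight F.pos c (M.parallel ι p) := fun p => h.exitsRight_iff F.pos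
  unfold Touch
  simp only [hER]
  constructor
  · rintro ⟨hx, hy, hxy, hn⟩
    rw [hb (x, false) (y, true) hx hy] at hxy
    have hxy' : F.below (ι x) (M.rev (ι y)) := hxy.resolve_right (by simp)
    obtain ⟨g, hg, hxg, hgy, hno⟩ := F.isStack.exists_next hy hxy'
    rcases hgy with rfl | hgy
    · exact ⟨hx, hy, hxy', hno⟩
    · have h1 := (F.faceOf_eq_of_touching hM hx hg hxg hno).symm
      change _ = M.faceOf (ι x) at h1
      rw [h.faceOf_ι, ← h.mem] at h1
      obtain ⟨z, hz⟩ := h1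
      have h2 : M.parallel ι (z, true) = g := by simp [parallel, hz, M.rev_rev]
      have hg' : M.ExitsRight F.pos c (M.parallel ι (z, true)) := by rwa [h2]
      refine absurd ⟨?_, ?_⟩ (hn (z, true) hg')
      · rw [hb (x, false) (z, true) hx hg']
        exact Or.inl (by rwa [h2])
      · rw [hb (z, true) (y, true) hg' hy]
        exact Or.inl (by rwa [h2])
  · rintro ⟨hx, hy, hxy, hn⟩
    refine ⟨hx, hy, (hb (x, false) (y, true) hx hy).2 (Or.inl hxy), fun g hg hgg => hn _ hg ?_⟩
    rw [hb (x, false) g hx hg, hb g (y, true) hg hy] at hgg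
    exact ⟨hgg.1.resolve_right (by simp), hgg.2.resolve_right (by simp)⟩

theorem mem_touching_fold_iff
    (ho : (∀ d, M.faceOf d = f ↔ d ∈ M.outer) ∨ ∀ d, M.faceOf d = f → d ∉ M.outer) (x y : X) :
    s((x, false), (y, false)) ∈ (h.fold F hM ho).touching ↔ s(ι x, ι y) ∈ F.touching := by
  rw [FlatFolding.mem_touching_iff, FlatFolding.mem_touching_iff]
  simp only [h.rev, Bool.not_false, h.touch_fold_iff]
  constructor
  · rintro ⟨c, ⟨p, rfl⟩, h1⟩
    exact ⟨_, ⟨_, rfl⟩, h1⟩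
  · rintro ⟨c, hc, h1⟩
    -- Vertices of the graph need not come from the cycle, so the point is moved to the left end of
    -- the path edge of the cycle that contains it.
    have key : ∀ x y, M.Touch F.pos F.below c (ι x) (M.rev (ι y)) →
        ∃ c ∈ Set.range (h.fold F hM ho).pos, M.Touch F.pos F.below c (ι x) (M.rev (ι y)) := by
      intro x y hxy
      obtain ⟨a, b, hab, ha, hb, -⟩ :=
        exists_isPathEdge_right (pos := (h.fold F hM ho).pos) (c := c) (d := (x, false))
          (e := (x, true)) hxy.1.1 hxy.1.2
      refine ⟨a, hab.1, ?_⟩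
      rwa [← h.touch_fold_iff F hM ho, ← hab.touch_iff ha hb, h.touch_fold_iff]
    rcases h1 with h1 | h1
    · obtain ⟨c, hc, h2⟩ := key x y h1
      exact ⟨c, hc, Or.inl h2⟩
    · obtain ⟨c, hc, h2⟩ := key y x h1
      exact ⟨c, hc, Or.inr h2⟩

end Fold

end IsFaceCycle

end FaceCycle

end AngledMap

/-! ### Cyclic successors, extremal points and transport of orbit sums -/

namespace CyclicOrder

section Succ

variable {Y : Type*} [Fintype Y] {r : Y → ℕ}

theorem exists_isCyclicSucc (hr : Function.Injective r) (hlt : ∀ y, r y < Fintype.card Y) :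
    ∃ β : Equiv.Perm Y, IsCyclicSucc r β := by
  have h1 : Function.Bijective fun y => (⟨r y, hlt y⟩ : Fin (Fintype.card Y)) :=
    (Fintype.bijective_iff_injective_and_card _).2
      ⟨fun x y hxy => hr (congrArg Fin.val hxy), by simp⟩
  have h2 : ∀ y, ∃ z, r z = if r y + 1 = Fintype.card Y then 0 else r y + 1 := by
    intro y
    have := hlt y
    obtain ⟨z, hz⟩ := h1.2 ⟨if r y + 1 = Fintype.card Y then 0 else r y + 1, by
      split_ifs <;> omega⟩
    exact ⟨z, congrArg Fin.val hz⟩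
  choose f hf using h2
  have h3 : Function.Injective f := by
    intro x y hxy
    have hx := hf x
    have hy := hf y
    rw [hxy, hy] at hx
    apply hr
    split_ifs at hx <;> omega
  exact ⟨Equiv.ofBijective f (Finite.injective_iff_bijective.1 h3), hf⟩

theorem IsCyclicSucc.apply_eq {β : Equiv.Perm Y} (hβ : IsCyclicSucc r β)
    (hr : Function.Injective r) (hlt : ∀ y, r y < Fintype.card Y) {y z : Y} (hyz : r y < r z)
    (hn : ∀ x, r y < r x → ¬ r x < r z) : β y = z := by
  have h1 := hβ y
  have h2 := hlt z
  rw [if_neg (by omega)] at h1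
  have h3 := hn (β y) (by omega)
  exact hr (by omega)

/-- `b` is the last element, and `t` is the last element of side `0`, or `b` if that side is
empty. -/
structure IsExtremal (r : Y → ℕ) (σ : Y → ℤ) (t b : Y) : Prop where
  last : r b + 1 = Fintype.card Y
  zero : ∀ y, σ y = 0 → σ t = 0
  le : ∀ y, σ y = 0 → r y ≤ r t
  eq : σ t ≠ 0 → t = b

theorem exists_isExtremal (hr : Function.Injective r) (hlt : ∀ y, r y < Fintype.card Y)
    [Nonempty Y] (σ : Y → ℤ) : ∃ t b, IsExtremal r σ t b := by
  classical
  obtain ⟨β, hβ⟩ := exists_isCyclicSucc hr hlt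
  obtain ⟨b, -, hb⟩ := Finset.exists_max_image (Finset.univ : Finset Y) r Finset.univ_nonempty
  have hlast : r b + 1 = Fintype.card Y := by
    by_contra h
    have h1 := hβ b
    rw [if_neg h] at h1
    have := hb (β b) (Finset.mem_univ _)
    omega
  by_cases h0 : ∃ y, σ y = 0
  · obtain ⟨y, hy⟩ := h0
    obtain ⟨t, ht, hmax⟩ := Finset.exists_max_image (Finset.univ.filter fun y => σ y = 0) r
      ⟨y, by simpa using hy⟩
    simp only [Finset.mem_filter, Finset.mem_univ, true_and] at ht hmax
    exact ⟨t, b, hlast, fun _ _ => ht, hmax, fun h => absurd ht h⟩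
  · push Not at h0
    exact ⟨b, b, hlast, fun y hy => absurd hy (h0 y), fun y hy => absurd hy (h0 y), fun _ => rfl⟩

section Extremal

variable {σ : Y → ℤ} {t b : Y} {β : Equiv.Perm Y}

/-- Side 0 precedes side 1, so the side can change only after the last point of side 0 or after the
last point of all. -/
theorem IsExtremal.side_apply (h : IsExtremal r σ t b) (hr : Function.Injective r)
    (hlt : ∀ y, r y < Fintype.card Y) (hβ : IsCyclicSucc r β) (h01 : ∀ y, σ y = 0 ∨ σ y = 1)
    (hσ : ∀ y z, σ y = 0 → σ z = 1 → r y < r z) (y : Y) (hyt : y ≠ t) (hyb : y ≠ b) :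
    σ (β y) = σ y := by
  have h1 := hβ y
  have h2 := hlt y
  have h3 : r y + 1 ≠ Fintype.card Y := fun h3 => hyb (hr (by have := h.last; omega))
  rw [if_neg h3] at h1
  rcases h01 y with hy | hy <;> rcases h01 (β y) with hb | hb
  · rw [hy, hb]
  · have h4 := h.le y hy
    have h5 : r y ≠ r t := hr.ne hyt
    have h6 := hσ t (β y) (h.zero y hy) hb
    omega
  · have := hσ (β y) y hb hy
    omega
  · rw [hy, hb]

theorem IsExtremal.side_cases (h : IsExtremal r σ t b) (hr : Function.Injective r)
    (hlt : ∀ y, r y < Fintype.card Y) (hβ : IsCyclicSucc r β) (h01 : ∀ y, σ y = 0 ∨ σ y = 1)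
    (hσ : ∀ y z, σ y = 0 → σ z = 1 → r y < r z) : (t = b ∧ σ (β b) = σ b) ∨
      (t ≠ b ∧ σ t = 0 ∧ σ (β t) = 1 ∧ σ b = 1 ∧ σ (β b) = 0) := by
  have hb := hβ b
  rw [if_pos h.last] at hb
  by_cases htb : t = b
  · refine Or.inl ⟨htb, ?_⟩
    rcases h01 t with ht | ht
    · rw [← htb, ht]
      refine (h01 _).resolve_right fun h1 => ?_
      have h2 := hσ t _ ht h1
      have := hlt (β t)
      have := h.last
      rw [← htb] at hb
      omega
    · have h2 : ∀ y, σ y = 1 := fun y => (h01 y).resolve_left fun h3 => by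
        have := h.zero y h3
        omega
      rw [h2, h2]
  · have ht : σ t = 0 := (h01 t).resolve_right fun h1 => htb (h.eq (by omega))
    have h1 := hβ t
    have h2 := h.last
    have h3 : r t ≠ r b := hr.ne htb
    rw [if_neg (by omega)] at h1
    refine Or.inr ⟨htb, ht, (h01 _).resolve_left fun h4 => ?_, (h01 _).resolve_left fun h4 => ?_,
      (h01 _).resolve_right fun h4 => ?_⟩
    · have := h.le _ h4
      omega
    · have := h.le _ h4
      have := hlt t
      omega
    · have := hσ t _ ht h4
      omega

end Extremal

open Classical in
-- An injective map that intertwines the permutations on an invariant set carries orbits bijectively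
-- to orbits. It transports corner sums from face cycles to the graph, and from parts of a disk to
-- the disk.
theorem sum_sameCycle_map {Z A : Type*} [Fintype Z] [AddCommMonoid A] {π : Equiv.Perm Y}
    {ρ : Equiv.Perm Z} {S : Set Y} (φ : Y → Z) (hS : ∀ y ∈ S, π y ∈ S)
    (hφ : ∀ y ∈ S, φ (π y) = ρ (φ y)) (hinj : Set.InjOn φ S) {y : Y} (hy : y ∈ S) (g : Z → A) :
    ∑ z with π.SameCycle y z, g (φ z) = ∑ z with ρ.SameCycle (φ y) z, g z := by
  have hpow : ∀ n : ℕ, (π ^ n) y ∈ S ∧ φ ((π ^ n) y) = (ρ ^ n) (φ y) := by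
    intro n
    induction n with
    | zero => exact ⟨hy, rfl⟩
    | succ n ih =>
      rw [pow_succ', Equiv.Perm.mul_apply, pow_succ', Equiv.Perm.mul_apply, hφ _ ih.1, ih.2]
      exact ⟨hS _ ih.1, rfl⟩
  refine Finset.sum_bij (fun z _ => φ z) ?_ ?_ ?_ fun _ _ => rfl
  · intro z hz
    simp only [Finset.mem_filter, Finset.mem_univ, true_and] at hz ⊢
    obtain ⟨n, -, rfl⟩ := hz.exists_pow_eq'
    rw [(hpow n).2]
    exact ⟨n, by simp⟩
  · intro z hz z' hz' hzz
    simp only [Finset.mem_filter, Finset.mem_univ, true_and] at hz hz'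
    exact hinj (mem_of_sameCycle hS hy hz) (mem_of_sameCycle hS hy hz') hzz
  · intro z hz
    simp only [Finset.mem_filter, Finset.mem_univ, true_and] at hz
    obtain ⟨n, -, rfl⟩ := hz.exists_pow_eq'
    refine ⟨(π ^ n) y, ?_, (hpow n).2⟩
    simp only [Finset.mem_filter, Finset.mem_univ, true_and]
    exact ⟨n, by simp⟩

theorem sameCycle_map_iff {Z : Type*} [Fintype Z] {π : Equiv.Perm Y}
    {ρ : Equiv.Perm Z} {S : Set Y} (φ : Y → Z) (hS : ∀ y ∈ S, π y ∈ S)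
    (hφ : ∀ y ∈ S, φ (π y) = ρ (φ y)) (hinj : Set.InjOn φ S) {y z : Y} (hy : y ∈ S) (hz : z ∈ S) :
    ρ.SameCycle (φ y) (φ z) ↔ π.SameCycle y z := by
  classical
  have h1 := sum_sameCycle_map φ hS hφ hinj hy fun x => if x = φ z then 1 else 0
  have h2 : ∑ x with π.SameCycle y x, (if φ x = φ z then 1 else 0) =
      ∑ x with π.SameCycle y x, (if x = z then 1 else 0) := by
    refine Finset.sum_congr rfl fun x hx => if_congr ?_ rfl rfl
    simp only [Finset.mem_filter, Finset.mem_univ, true_and] at hx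
    exact ⟨fun h => hinj (mem_of_sameCycle hS hy hx) hz h, fun h => h ▸ rfl⟩
  rw [h2] at h1
  simp only [Finset.sum_ite_eq', Finset.mem_filter, Finset.mem_univ, true_and] at h1
  by_cases h3 : ρ.SameCycle (φ y) (φ z) <;> by_cases h4 : π.SameCycle y z <;> simp_all

end Succ

end CyclicOrder

/-! ### The successor permutation in a disk of a stack -/

namespace AngledMap

open CyclicOrder

variable {D : Type*} {M : AngledMap D} {pos : D → ℝ} {B : D → D → Prop} {c : ℝ}

theorem side_eq_zero_iff {y : M.DiskDart pos c} : M.side pos c y = 0 ↔ M.ExitsRight pos c y := by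
  classical
  unfold side
  split_ifs <;> simp_all

theorem side_eq_zero_or_one (y : M.DiskDart pos c) : M.side pos c y = 0 ∨ M.side pos c y = 1 := by
  classical
  unfold side
  split_ifs <;> simp

variable [Finite D]

theorem exitsLeft_apply {β : Equiv.Perm (M.DiskDart pos c)}
    {t b : M.DiskDart pos c} (hE : IsExtremal (M.diskRank pos B c) (M.side pos c) t b) (ht : ¬ M.ExitsRight pos c t) : M.ExitsLeft pos c (β t) := by
  refine (β t).2.resolve_left fun h1 => ht ?_
  exact side_eq_zero_iff.1 (hE.zero _ (side_eq_zero_iff.2 h1))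

namespace IsStack

variable (h : M.IsStack pos B)
include h

theorem diskRank_lt_of_side {y z : M.DiskDart pos c} (hy : M.side pos c y = 0)
    (hz : M.side pos c z = 1) : M.diskRank pos B c y < M.diskRank pos B c z := by
  rw [h.diskRank_lt_iff]
  rw [side_eq_zero_iff] at hy
  have h1 : ¬ M.ExitsRight pos c z := fun h' => by
    rw [← side_eq_zero_iff] at h'
    omega
  exact Or.inl ⟨hy, z.2.resolve_left h1⟩

theorem not_exitsRight_of_lt {y z : M.DiskDart pos c} (hy : M.ExitsLeft pos c y)
    (hyz : M.diskRank pos B c y < M.diskRank pos B c z) : ¬ M.ExitsRight pos c z := by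
  rw [h.diskRank_lt_iff] at hyz
  exact fun h1 => not_prec_left_right hy h1 hyz

variable {β : Equiv.Perm (M.DiskDart pos c)} (hβ : IsCyclicSucc (M.diskRank pos B c) β)

theorem diskRank_lt_of_touch {d e : M.DiskDart pos c} (hde : M.Touch pos B c d e) :
    M.diskRank pos B c d < M.diskRank pos B c e :=
  (h.diskRank_lt_iff d e).2 ((prec_right_iff hde.1 hde.2.1).2 hde.2.2.1)

theorem diskRank_lt_of_touch_left {a : ℝ}
    (ha : ∀ d, M.ExitsLeft pos c d ↔ M.ExitsRight pos a (M.rev d)) {d e : M.DiskDart pos c}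
    (hde : M.Touch pos B a (M.rev e) (M.rev d)) :
    M.diskRank pos B c d < M.diskRank pos B c e :=
  (h.diskRank_lt_iff d e).2 ((prec_left_iff ((ha _).2 hde.2.1) ((ha _).2 hde.1)).2 hde.2.2.1)

variable {t b : M.DiskDart pos c} (hE : IsExtremal (M.diskRank pos B c) (M.side pos c) t b)

section

include hE

theorem eq_of_top {d : M.DiskDart pos c} (hd : M.ExitsRight pos c d)
    (hn : ∀ e, M.ExitsRight pos c e → ¬ B d e) : d = t := by
  have ht := side_eq_zero_iff.1 (hE.zero d (side_eq_zero_iff.2 hd))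
  have h1 := hE.le d (side_eq_zero_iff.2 hd)
  have h2 := h.diskRank_lt_iff d t
  rw [prec_right_iff hd ht] at h2
  exact h.diskRank_injective c (by have := mt h2.1 (hn t ht); omega)

theorem top_right (ht : M.ExitsRight pos c t) (e : D) (he : M.ExitsRight pos c e) : ¬ B t e := by
  intro hte
  have h1 := (h.diskRank_lt_iff t ⟨e, Or.inl he⟩).2 ((prec_right_iff ht he).2 hte)
  have h2 := hE.le ⟨e, Or.inl he⟩ (side_eq_zero_iff.2 he)
  omega

end

include hβ

theorem apply_eq_of_touch {d e : M.DiskDart pos c} (hde : M.Touch pos B c d e) : β d = e := by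
  refine hβ.apply_eq (h.diskRank_injective c) h.diskRank_lt_card (h.diskRank_lt_of_touch hde)
    fun x h1 h2 => ?_
  have hx : M.ExitsRight pos c x := x.2.resolve_right fun hx =>
    h.not_exitsRight_of_lt hx h2 hde.2.1
  rw [h.diskRank_lt_iff, prec_right_iff hde.1 hx] at h1
  rw [h.diskRank_lt_iff, prec_right_iff hx hde.2.1] at h2
  exact hde.2.2.2 x hx ⟨h1, h2⟩

theorem apply_eq_of_touch_left {a : ℝ}
    (ha : ∀ d, M.ExitsLeft pos c d ↔ M.ExitsRight pos a (M.rev d)) {d e : M.DiskDart pos c}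
    (hde : M.Touch pos B a (M.rev e) (M.rev d)) : β d = e := by
  refine hβ.apply_eq (h.diskRank_injective c) h.diskRank_lt_card
    (h.diskRank_lt_of_touch_left ha hde) fun x h1 h2 => ?_
  have hd := (ha _).2 hde.2.1
  have he := (ha _).2 hde.1
  have hx : M.ExitsLeft pos c x := x.2.resolve_left (h.not_exitsRight_of_lt hd h1)
  rw [h.diskRank_lt_iff, prec_left_iff hd hx] at h1
  rw [h.diskRank_lt_iff, prec_left_iff hx he] at h2
  exact hde.2.2.2 (M.rev x) ((ha _).1 hx) ⟨h2, h1⟩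

include hE

/-- The successor of the highest right point is the first left point. If there is nothing on the
right, then `t = b` and its successor has rank 0. -/
theorem diskRank_apply_le {x : M.DiskDart pos c} (hx : M.ExitsLeft pos c x) :
    M.diskRank pos B c (β t) ≤ M.diskRank pos B c x := by
  have h1 := hβ t
  rcases side_eq_zero_or_one t with ht | ht
  · have h2 := h.diskRank_lt_of_side (y := t) (z := x) ht
      ((side_eq_zero_or_one x).resolve_left fun h' =>
        not_exitsRight_of_exitsLeft hx (side_eq_zero_iff.1 h'))
    split_ifs at h1 <;> omega
  · rw [if_pos (by rw [hE.eq (by omega)]; exact hE.last)] at h1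
    omega

theorem eq_apply_of_top_left {d : M.DiskDart pos c} (hd : M.ExitsLeft pos c d)
    (hn : ∀ e, M.ExitsLeft pos c e → ¬ B (M.rev d) (M.rev e)) : d = β t := by
  have h1 := h.diskRank_apply_le hβ hE hd
  by_contra hne
  have h2 := (h.diskRank_injective c).ne hne
  have h3 : M.diskRank pos B c (β t) < M.diskRank pos B c d := by omega
  by_cases hr : M.ExitsRight pos c (β t)
  · rcases side_eq_zero_or_one t with ht | ht
    · have h4 := hE.le (β t) (side_eq_zero_iff.2 hr)
      have h5 := hβ t
      have h6 := hE.last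
      have h7 := h.diskRank_lt_card d
      have h8 := h.diskRank_lt_of_side (y := t) (z := d) ht
        ((side_eq_zero_or_one d).resolve_left fun h' =>
          not_exitsRight_of_exitsLeft hd (side_eq_zero_iff.1 h'))
      split_ifs at h5 <;> omega
    · have h4 := hE.zero (β t) (side_eq_zero_iff.2 hr)
      omega
  · have hl := (β t).2.resolve_left hr
    rw [h.diskRank_lt_iff, prec_left_iff hl hd] at h3
    exact hn _ hl h3

theorem top_left (hl : M.ExitsLeft pos c (β t)) (e : D) (he : M.ExitsLeft pos c e) :
    ¬ B (M.rev (β t)) (M.rev e) := by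
  intro hte
  have h1 := h.diskRank_apply_le hβ hE (x := ⟨e, Or.inr he⟩) he
  have h2 := (h.diskRank_lt_iff ⟨e, Or.inr he⟩ (β t)).2 ((prec_left_iff he hl).2 hte)
  omega

end IsStack

end AngledMap

/-! ### Foldings of face cycles over a common placement -/

namespace AngledMap

open CyclicOrder

section Germ

variable {D : Type*} {M : AngledMap D} {pos : D → ℝ} {B : D → D → Prop} {c : ℝ}

/-- The left side of `c` and the right side of `a` show the same interval. -/
def Germ (M : AngledMap D) (pos : D → ℝ) (a c : ℝ) : Prop :=
  ∀ d, M.ExitsLeft pos c d ↔ M.ExitsRight pos a (M.rev d)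

theorem IsPathEdge.germ {a b : ℝ} (h : IsPathEdge pos a b) : M.Germ pos a b := fun d => by
  rw [← over_iff_exitsRight h le_rfl h.2.2.1, over_rev_iff_exitsLeft h h.2.2.1 le_rfl]

theorem exists_germ [Finite D] {d : D} (hd : M.ExitsLeft pos c d) : ∃ a, M.Germ pos a c := by
  obtain ⟨a, b, hab, h1, h2, -⟩ := exists_isPathEdge_left hd.2 hd.1
  exact ⟨a, fun d => by
    rw [← over_iff_exitsRight hab le_rfl hab.2.2.1, over_rev_iff_exitsLeft hab h1 h2]⟩

/-- The turn that the angles prescribe in a disk. -/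
noncomputable def weight (M : AngledMap D) (pos : D → ℝ) (c : ℝ) (d : D) : ℤ :=
  open Classical in if pos d = c then 2 - (M.angle d / 180 : ℕ) else 1

variable [Finite D]

/-- A passing edge has its two ends on opposite sides, like a straight angle. -/
theorem IsStack.turn_of_ne (h : M.IsStack pos B) (hp : M.IsPlacement pos) (y : M.DiskDart pos c)
    (hy : pos y ≠ c) : turn (M.diskRank pos B c) (M.side pos c) (hp.diskPerm c) y = 1 := by
  have h1 := hp.diskPerm_of_ne y hy
  have h01 := side_eq_zero_or_one (M := M) (pos := pos) (c := c)
  unfold turn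
  by_cases hr : M.ExitsRight pos c y
  · have h2 : M.side pos c (hp.diskPerm c y) = 1 := (h01 _).resolve_left fun h' => by
      rw [side_eq_zero_iff, h1] at h'
      have := h'.2
      rw [M.rev_rev] at this
      exact absurd hr.1 (not_le.2 this)
    rw [side_eq_zero_iff.2 hr, h2, if_pos (h.diskRank_lt_of_side (side_eq_zero_iff.2 hr) h2)]
    norm_num
  · have h2 : M.side pos c y = 1 := (h01 _).resolve_left fun h' => hr (side_eq_zero_iff.1 h')
    have h3 : M.side pos c (hp.diskPerm c y) = 0 := by
      rw [side_eq_zero_iff, h1]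
      have hl := y.2.resolve_left hr
      exact ⟨hl.2.le, by rw [M.rev_rev]; exact lt_of_le_of_ne hl.1 (Ne.symm hy)⟩
    have h4 := h.diskRank_lt_of_side h3 h2
    rw [h2, h3, if_neg (by omega)]
    norm_num

end Germ

section FaceStack

variable {D : Type*} {M : AngledMap D} {X : Type*} {f : M.Face} {C : AngledMap (X × Bool)}
  {ι : X → D} {τ : Equiv.Perm X} {pos : D → ℝ} {B : X × Bool → X × Bool → Prop}

/-- A flat folding of the cycle of a face over a given placement of `M`. -/
structure IsFaceStack (M : AngledMap D) (C : AngledMap (X × Bool)) [Finite X] (ι : X → D)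
    (pos : D → ℝ) (B : X × Bool → X × Bool → Prop) : Prop where
  stack : C.IsStack (fun p => pos (M.parallel ι p)) B
  noncrossing : ∀ (hp : C.IsPlacement fun p => pos (M.parallel ι p)) c,
    Noncrossing (C.diskRank (fun p => pos (M.parallel ι p)) B c) (hp.diskPerm c)
  turn_eq : ∀ (hp : C.IsPlacement fun p => pos (M.parallel ι p)) c
    (y : C.DiskDart (fun p => pos (M.parallel ι p)) c), (y : X × Bool).2 = false →
    turn (C.diskRank (fun p => pos (M.parallel ι p)) B c)
      (C.side (fun p => pos (M.parallel ι p)) c) (hp.diskPerm c) y =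
      M.weight pos c (M.parallel ι y)
  touch : ∀ c p q, C.Touch (fun p => pos (M.parallel ι p)) B c p q → p.2 ≠ q.2
  top : ∀ c p, C.ExitsRight (fun p => pos (M.parallel ι p)) c p →
    (∀ q, C.ExitsRight (fun p => pos (M.parallel ι p)) c q → ¬ B p q) →
    (p.2 = false ↔ ι p.1 ∈ M.outer)
  bottom : ∀ c p, C.ExitsRight (fun p => pos (M.parallel ι p)) c p →
    (∀ q, C.ExitsRight (fun p => pos (M.parallel ι p)) c q → ¬ B q p) →
    (p.2 = true ↔ ι p.1 ∈ M.outer)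

theorem IsFaceCycle.isFaceStack (h : M.IsFaceCycle f C ι τ) [Finite D] [Finite X]
    (F : C.FlatFolding) (hF : F.pos = fun p => pos (M.parallel ι p)) :
    M.IsFaceStack C ι pos F.below where
  stack := hF ▸ F.isStack
  noncrossing := hF ▸ fun _ => F.noncrossing
  turn_eq := by
    rw [← hF]
    intro hp c y hy
    have hy' : pos (M.parallel ι y) = F.pos y := (congrFun hF y).symm
    unfold weight
    rw [hy']
    split_ifs with hc
    · have h1 := F.angle_eq_turn_of_eq y hc
      have h2 : M.angle (M.parallel ι y) = C.angle y := by
        rcases y with ⟨⟨x, b⟩, hx⟩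
        simp only at hy
        subst hy
        exact (h.angle_false x).symm
      rw [h2]
      push_cast
      rw [h1, Int.mul_ediv_cancel_left _ (by norm_num)]
      ring
    · exact F.isStack.turn_of_ne hp y hc
  touch := by
    rw [← hF]
    intro c p q hpq
    -- Touching edges border the same one of the two faces of the cycle.
    have h1 := h.faceOf_snd (F.faceOf_eq_of_touching h.connected hpq.1 hpq.2.1 hpq.2.2.1 hpq.2.2.2)
    rcases q with ⟨y, b⟩
    rw [h1, h.rev]
    cases b <;> simp
  top := by
    rw [← hF]
    intro c p hp hn
    exact (h.outer p).1 (F.mem_outer hp hn)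
  bottom := by
    rw [← hF]
    intro c p hp hn
    have h1 := (h.outer _).1 (F.rev_mem_outer hp hn)
    rcases p with ⟨y, b⟩
    rw [h.rev] at h1
    cases b <;> simpa using h1

namespace IsFaceStack

variable (h : M.IsFaceCycle f C ι τ) {c : ℝ}

include h

theorem germ {a : ℝ} (ha : M.Germ pos a c) : C.Germ (fun p => pos (M.parallel ι p)) a c :=
  fun p => by rw [h.exitsLeft_iff, h.exitsRight_iff, h.parallel_rev, ha]

theorem snd_rev (p : X × Bool) : (C.rev p).2 = !p.2 := by
  rcases p with ⟨x, b⟩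
  rw [h.rev]

theorem fst_rev (p : X × Bool) : (C.rev p).1 = p.1 := by
  rcases p with ⟨x, b⟩
  rw [h.rev]

variable [Finite X] (hB : M.IsFaceStack C ι pos B)
include hB

theorem top_left {p : X × Bool} (hp : C.ExitsLeft (fun p => pos (M.parallel ι p)) c p)
    (hn : ∀ q, C.ExitsLeft (fun p => pos (M.parallel ι p)) c q → ¬ B (C.rev p) (C.rev q)) :
    p.2 = true ↔ ι p.1 ∈ M.outer := by
  obtain ⟨a, ha⟩ := exists_germ hp
  have h1 := hB.top a (C.rev p) ((ha p).1 hp) fun q hq hpq => by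
    refine hn (C.rev q) ((ha _).2 (by rwa [C.rev_rev])) (by rwa [C.rev_rev])
  rw [snd_rev h, fst_rev h] at h1
  simpa using h1

theorem bottom_left {p : X × Bool} (hp : C.ExitsLeft (fun p => pos (M.parallel ι p)) c p)
    (hn : ∀ q, C.ExitsLeft (fun p => pos (M.parallel ι p)) c q → ¬ B (C.rev q) (C.rev p)) :
    p.2 = false ↔ ι p.1 ∈ M.outer := by
  obtain ⟨a, ha⟩ := exists_germ hp
  have h1 := hB.bottom a (C.rev p) ((ha p).1 hp) fun q hq hpq => by
    refine hn (C.rev q) ((ha _).2 (by rwa [C.rev_rev])) (by rwa [C.rev_rev])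
  rw [snd_rev h, fst_rev h] at h1
  simpa using h1

section Cycle

variable {β : Equiv.Perm (C.DiskDart (fun p => pos (M.parallel ι p)) c)}
  (hβ : IsCyclicSucc (C.diskRank (fun p => pos (M.parallel ι p)) B c) β)
  {t b : C.DiskDart (fun p => pos (M.parallel ι p)) c}
  (hE : IsExtremal (C.diskRank (fun p => pos (M.parallel ι p)) B c)
    (C.side (fun p => pos (M.parallel ι p)) c) t b)

section

include hE

/-- The last boundary point is the lowest edge on the left or, if the left side is empty, the
highest one on the right. In both cases the gap after it is exterior. -/
theorem last_iff : (b : X × Bool).2 = false ↔ ι (b : X × Bool).1 ∈ M.outer := by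
  have hmax : ∀ x : C.DiskDart (fun p => pos (M.parallel ι p)) c, ¬
      C.diskRank (fun p => pos (M.parallel ι p)) B c b <
        C.diskRank (fun p => pos (M.parallel ι p)) B c x := fun x => by
    have := hB.stack.diskRank_lt_card x
    have := hE.last
    omega
  rcases b.2 with hb | hb
  · refine hB.top c b hb fun q hq hbq => hmax ⟨q, Or.inl hq⟩ ?_
    rw [hB.stack.diskRank_lt_iff]
    exact (prec_right_iff hb hq).2 hbq
  · refine bottom_left h hB hb fun q hq hqb => hmax ⟨q, Or.inr hq⟩ ?_
    rw [hB.stack.diskRank_lt_iff]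
    exact (prec_left_iff hb hq).2 hqb

theorem top_iff : (t : X × Bool).2 = false ↔ ι (t : X × Bool).1 ∈ M.outer := by
  by_cases ht : C.ExitsRight (fun p => pos (M.parallel ι p)) c t
  · exact hB.top c t ht (hB.stack.top_right hE ht)
  · rw [hE.eq fun h' => ht (side_eq_zero_iff.1 h')]
    exact last_iff h hB hE

end

theorem first_iff {y : C.DiskDart (fun p => pos (M.parallel ι p)) c}
    (hy : C.diskRank (fun p => pos (M.parallel ι p)) B c y = 0) :
    (y : X × Bool).2 = true ↔ ι (y : X × Bool).1 ∈ M.outer := by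
  rcases y.2 with hb | hb
  · refine hB.bottom c y hb fun q hq hbq => ?_
    have := (hB.stack.diskRank_lt_iff ⟨q, Or.inl hq⟩ y).2 ((prec_right_iff hq hb).2 hbq)
    omega
  · refine top_left h hB hb fun q hq hqb => ?_
    have := (hB.stack.diskRank_lt_iff ⟨q, Or.inr hq⟩ y).2 ((prec_left_iff hq hb).2 hqb)
    omega

include hβ hE

/-- Consecutive boundary points border a common gap. Inside a side of the disk they touch, across
the sides both border the exterior face; in either case they have the same face of the cycle between
them and opposite Booleans. -/
theorem snd_apply (ho : ∀ x y, ι x ∈ M.outer ↔ ι y ∈ M.outer)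
    (y : C.DiskDart (fun p => pos (M.parallel ι p)) c) :
    (β y : X × Bool).2 = !(y : X × Bool).2 := by
  have key : ∀ p q : X × Bool, (p.2 = false ↔ ι p.1 ∈ M.outer) →
      (q.2 = true ↔ ι q.1 ∈ M.outer) → q.2 = !p.2 := by
    intro p q hp hq
    rw [ho p.1 q.1] at hp
    rcases hp2 : p.2 with _ | _ <;> rcases hq2 : q.2 with _ | _ <;> simp_all
  rcases y.2 with hy | hy
  · by_cases hex : ∃ e, C.ExitsRight (fun p => pos (M.parallel ι p)) c e ∧ B y e
    · obtain ⟨e, he, hye⟩ := hex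
      obtain ⟨g, hg, hyg, -, hn⟩ := hB.stack.exists_next he hye
      have h1 := hB.stack.apply_eq_of_touch hβ (d := y) (e := ⟨g, Or.inl hg⟩) ⟨hy, hg, hyg, hn⟩
      have h2 := hB.touch c y g ⟨hy, hg, hyg, hn⟩
      rw [h1]
      rcases hp2 : (y : X × Bool).2 with _ | _ <;> rcases hq2 : (g : X × Bool).2 with _ | _ <;>
        simp_all
    · push Not at hex
      have h1 := hB.top c y hy hex
      have h2 := hB.stack.eq_of_top hE hy hex
      refine key _ _ h1 ?_
      by_cases hl : C.ExitsLeft (fun p => pos (M.parallel ι p)) c (β t)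
      · rw [h2]
        exact top_left h hB hl (hB.stack.top_left hβ hE hl)
      · have h3 := (β t).2.resolve_right hl
        refine first_iff h hB ?_
        have h4 := hβ y
        rw [h2] at h4 ⊢
        have h5 := hE.le _ (side_eq_zero_iff.2 h3)
        split_ifs at h4 <;> omega
  · by_cases hex : ∃ e, C.ExitsLeft (fun p => pos (M.parallel ι p)) c e ∧ B (C.rev e) (C.rev y)
    · obtain ⟨e, he, hye⟩ := hex
      obtain ⟨a, ha⟩ := exists_germ hy
      obtain ⟨g, hg, hyg, -, hn⟩ := hB.stack.exists_prev ((ha _).1 he) hye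
      have hT : C.Touch (fun p => pos (M.parallel ι p)) B a g (C.rev y) :=
        ⟨hg, (ha _).1 hy, hyg, hn⟩
      have hg' : C.ExitsLeft (fun p => pos (M.parallel ι p)) c (C.rev g) :=
        (ha _).2 (by rwa [C.rev_rev])
      have h1 := hB.stack.apply_eq_of_touch_left hβ ha (d := y) (e := ⟨C.rev g, Or.inr hg'⟩)
        (by rw [C.rev_rev]; exact hT)
      have h2 := hB.touch a _ _ hT
      rw [h1, snd_rev h]
      rw [snd_rev h] at h2
      rcases hp2 : (y : X × Bool).2 with _ | _ <;> rcases hq2 : (g : X × Bool).2 with _ | _ <;>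
        simp_all
    · push Not at hex
      refine key _ _ (bottom_left h hB hy hex) (first_iff h hB ?_)
      have h4 := hβ y
      split_ifs at h4 with h5
      · exact h4
      · exfalso
        have h6 : C.diskRank (fun p => pos (M.parallel ι p)) B c y <
          C.diskRank (fun p => pos (M.parallel ι p)) B c (β y) := by omega
        have h7 := (β y).2.resolve_left (hB.stack.not_exitsRight_of_lt hy h6)
        rw [hB.stack.diskRank_lt_iff, prec_left_iff hy h7] at h6
        exact hex _ h7 h6

include hβ hE

theorem snd_inv_mul (hp : M.IsPlacement pos) (ho : ∀ x y, ι x ∈ M.outer ↔ ι y ∈ M.outer)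
    {y : C.DiskDart (fun p => pos (M.parallel ι p)) c} (hy : (y : X × Bool).2 = false) :
    ((((h.isPlacement hp).diskPerm c)⁻¹ * β) y : X × Bool).2 = false := by
  have h1 : (β y : X × Bool).2 = true := by rw [snd_apply h hB hβ hE ho, hy]; rfl
  have h2 : ((h.isPlacement hp).diskPerm c)⁻¹ (β y) = (h.isPlacement hp).diskPerm c (β y) := by
    rw [Equiv.Perm.inv_eq_iff_eq, h.diskPerm_diskPerm hp]
  rw [Equiv.Perm.mul_apply, h2]
  exact (h.diskPerm_true hp _ h1).1

/-- `β` leads from a `false` point to a `true` one, where the involution of the cycle acts as the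
inverse of the disk permutation of `M`. -/
theorem toDisk_inv_mul (hp : M.IsPlacement pos) (ho : ∀ x y, ι x ∈ M.outer ↔ ι y ∈ M.outer)
    {y : C.DiskDart (fun p => pos (M.parallel ι p)) c} (hy : (y : X × Bool).2 = false) :
    h.toDisk pos ((((h.isPlacement hp).diskPerm c)⁻¹ * β) y) =
      (hp.diskPerm c)⁻¹ (h.toDisk pos (β y)) := by
  have h1 : (β y : X × Bool).2 = true := by rw [snd_apply h hB hβ hE ho, hy]; rfl
  have h2 : ((h.isPlacement hp).diskPerm c)⁻¹ (β y) = (h.isPlacement hp).diskPerm c (β y) := by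
    rw [Equiv.Perm.inv_eq_iff_eq, h.diskPerm_diskPerm hp]
  rw [Equiv.Perm.mul_apply, h2]
  exact (h.diskPerm_true hp _ h1).2

open Classical in
-- The regions on the side of `f` consist of `false` points, whose turns are the weights of `M`.
theorem sum_region [Finite D] (hp : M.IsPlacement pos)
    (ho : ∀ x y, ι x ∈ M.outer ↔ ι y ∈ M.outer)
    (y : C.DiskDart (fun p => pos (M.parallel ι p)) c) (hy : (y : X × Bool).2 = false) :
    ∑ z with (((h.isPlacement hp).diskPerm c)⁻¹ * β).SameCycle y z,
        M.weight pos c (h.toDisk pos z) =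
      2 - (if (((h.isPlacement hp).diskPerm c)⁻¹ * β).SameCycle y t then 1 else 0) -
        (if (((h.isPlacement hp).diskPerm c)⁻¹ * β).SameCycle y b then 1 else 0) := by
  have h01 := side_eq_zero_or_one (M := C) (pos := fun p => pos (M.parallel ι p)) (c := c)
  have hσ := fun y z => hB.stack.diskRank_lt_of_side (c := c) (y := y) (z := z)
  have key := ((hB.noncrossing (h.isPlacement hp) c).sum_turn_inv_mul (hB.stack.diskRank_injective c)
    hB.stack.diskRank_lt_card hβ hE.last
    (hE.side_apply (hB.stack.diskRank_injective c) hB.stack.diskRank_lt_card hβ h01 hσ)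
    (hE.side_cases (hB.stack.diskRank_injective c) hB.stack.diskRank_lt_card hβ h01 hσ) y)
  refine Eq.trans ?_ (key.trans (by congr!))
  refine Finset.sum_congr (by congr!) fun z hz => ?_
  simp only [Finset.mem_filter, Finset.mem_univ, true_and] at hz
  refine (hB.turn_eq _ c z ?_).symm
  exact mem_of_sameCycle
    (S := {z : C.DiskDart (fun p => pos (M.parallel ι p)) c | (z : X × Bool).2 = false})
    (fun x hx => snd_inv_mul h hB hβ hE hp ho hx) hy hz

end Cycle

end IsFaceStack

end FaceStack

end AngledMap

/-! ### Gluing the face cycles in one disk -/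

namespace AngledMap

open CyclicOrder

section Gluing

variable {D : Type*} {M : AngledMap D} {pos : D → ℝ}
  {B : ∀ f : M.Face, M.FaceDart f × Bool → M.FaceDart f × Bool → Prop} {c : ℝ}

/-- The placement of the cycle of a face over a placement of the graph. -/
abbrev tourPos (M : AngledMap D) (pos : D → ℝ) (f : M.Face) : M.FaceDart f × Bool → ℝ :=
  fun p => pos (M.parallel Subtype.val p)

/-- The edge `e` lies above `d` just to the right of `c`, and they touch in a face. -/
def FaceTouch (M : AngledMap D) (pos : D → ℝ)
    (B : ∀ f : M.Face, M.FaceDart f × Bool → M.FaceDart f × Bool → Prop) (c : ℝ) (d e : D) : Prop :=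
  ∃ (f : M.Face) (hd : M.faceOf d = f) (he : M.faceOf (M.rev e) = f),
    (M.eulerCycle f).Touch (M.tourPos pos f) (B f) c (⟨d, hd⟩, false) (⟨M.rev e, he⟩, true)

/-- Just to the right of `c`, `d` is the highest edge of the exterior face, which lies above it. -/
def FaceTop (M : AngledMap D) (pos : D → ℝ)
    (B : ∀ f : M.Face, M.FaceDart f × Bool → M.FaceDart f × Bool → Prop) (c : ℝ) (d : D) : Prop :=
  ∃ (f : M.Face) (hd : M.faceOf d = f), d ∈ M.outer ∧ M.ExitsRight pos c d ∧
    ∀ q, (M.eulerCycle f).ExitsRight (M.tourPos pos f) c q → ¬ B f (⟨d, hd⟩, false) q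

theorem FaceTouch.exitsRight_left {d e : D} (h : M.FaceTouch pos B c d e) :
    M.ExitsRight pos c d := by
  obtain ⟨f, hd, he, h⟩ := h
  exact ((eulerCycle_isFaceCycle f).exitsRight_iff pos).1 h.1

theorem FaceTouch.exitsRight_right {d e : D} (h : M.FaceTouch pos B c d e) :
    M.ExitsRight pos c e := by
  obtain ⟨f, hd, he, h⟩ := h
  have := ((eulerCycle_isFaceCycle f).exitsRight_iff pos).1 h.2.1
  change M.ExitsRight pos c (M.rev (M.rev e)) at this
  rwa [M.rev_rev] at this

theorem IsPathEdge.tour_exitsRight_iff {a b : ℝ} (h : IsPathEdge pos a b) (h1 : a ≤ c)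
    (h2 : c < b) {f : M.Face} (p : M.FaceDart f × Bool) :
    (M.eulerCycle f).ExitsRight (M.tourPos pos f) c p ↔
      (M.eulerCycle f).ExitsRight (M.tourPos pos f) a p := by
  rw [(eulerCycle_isFaceCycle f).exitsRight_iff pos, (eulerCycle_isFaceCycle f).exitsRight_iff pos,
    h.exitsRight_iff h1 h2]

theorem IsPathEdge.faceTouch_iff {a b : ℝ} (h : IsPathEdge pos a b) (h1 : a ≤ c)
    (h2 : c < b) (d e : D) : M.FaceTouch pos B c d e ↔ M.FaceTouch pos B a d e := by
  unfold FaceTouch Touch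
  simp only [h.tour_exitsRight_iff h1 h2]

variable [Finite D]

/-- The edge is a side of its left face, and in the cycle of that face it is either on top or has a
next side above it. Alternation of the Booleans makes that side an upper wall of the gap. -/
theorem exists_faceTouch_or_top
    (hB : ∀ f, M.IsFaceStack (M.eulerCycle f) Subtype.val pos (B f)) {d : D}
    (hd : M.ExitsRight pos c d) : (∃ e, M.FaceTouch pos B c d e) ∨ M.FaceTop pos B c d := by
  have hd' := ((eulerCycle_isFaceCycle (M.faceOf d)).exitsRight_iff pos
    (p := (⟨d, rfl⟩, false))).2 hd
  by_cases hex : ∃ q, (M.eulerCycle (M.faceOf d)).ExitsRight (M.tourPos pos (M.faceOf d)) c q ∧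
      B (M.faceOf d) (⟨d, rfl⟩, false) q
  · obtain ⟨q, hq, hdq⟩ := hex
    obtain ⟨⟨⟨x, hx⟩, b⟩, hg, hyg, -, hn⟩ := (hB (M.faceOf d)).stack.exists_next hq hdq
    have h2 := (hB (M.faceOf d)).touch c _ _ ⟨hd', hg, hyg, hn⟩
    obtain rfl : b = true := by cases b <;> simp_all
    refine Or.inl ⟨M.rev x, _, rfl, by rw [M.rev_rev, hx], ?_⟩
    have h3 : (⟨M.rev (M.rev x), by rw [M.rev_rev, hx]⟩ : M.FaceDart (M.faceOf d)) = ⟨x, hx⟩ :=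
      Subtype.ext (M.rev_rev x)
    rw [h3]
    exact ⟨hd', hg, hyg, hn⟩
  · push Not at hex
    exact Or.inr ⟨_, rfl, by simpa using (hB (M.faceOf d)).top c _ hd' hex, hd, hex⟩

theorem exists_faceTouch_or_bottom
    (hB : ∀ f, M.IsFaceStack (M.eulerCycle f) Subtype.val pos (B f)) {d : D}
    (hd : M.ExitsRight pos c d) : (∃ e, M.FaceTouch pos B c e d) ∨ M.rev d ∈ M.outer := by
  have hd' := ((eulerCycle_isFaceCycle (M.faceOf (M.rev d))).exitsRight_iff pos
    (p := (⟨M.rev d, rfl⟩, true))).2 (by change M.ExitsRight pos c (M.rev (M.rev d));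
                                          rwa [M.rev_rev])
  by_cases hex : ∃ q, (M.eulerCycle (M.faceOf (M.rev d))).ExitsRight
      (M.tourPos pos (M.faceOf (M.rev d))) c q ∧ B (M.faceOf (M.rev d)) q (⟨M.rev d, rfl⟩, true)
  · obtain ⟨q, hq, hdq⟩ := hex
    obtain ⟨⟨⟨x, hx⟩, b⟩, hg, hyg, -, hn⟩ := (hB (M.faceOf (M.rev d))).stack.exists_prev hq hdq
    have h2 := (hB (M.faceOf (M.rev d))).touch c _ _ ⟨hg, hd', hyg, hn⟩
    obtain rfl : b = false := by cases b <;> simp_all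
    exact Or.inl ⟨x, _, hx, rfl, hg, hd', hyg, hn⟩
  · push Not at hex
    exact Or.inr (by simpa using (hB (M.faceOf (M.rev d))).bottom c _ hd' hex)

open Classical in
/-- `β` is the order of the boundary points of the disk at `c` in which the edges that touch in
a face are consecutive, `t` is the highest one on the right, and `b` is the last one. -/
structure IsGlue (hP : M.IsPlacement pos)
    (B : ∀ f : M.Face, M.FaceDart f × Bool → M.FaceDart f × Bool → Prop) (c : ℝ)
    (β : Equiv.Perm (M.DiskDart pos c)) (t b : M.DiskDart pos c) : Prop where
  sum_region : ∀ y, ∑ z with ((hP.diskPerm c)⁻¹ * β).SameCycle y z, M.weight pos c z =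
      2 - (if ((hP.diskPerm c)⁻¹ * β).SameCycle y t then 1 else 0) -
        (if ((hP.diskPerm c)⁻¹ * β).SameCycle y b then 1 else 0)
  apply_eq : ∀ d e : M.DiskDart pos c, M.FaceTouch pos B c d e → β d = e
  apply_eq_left : ∀ a, M.Germ pos a c → ∀ d e : M.DiskDart pos c,
    M.FaceTouch pos B a (M.rev e) (M.rev d) → β d = e
  eq_of_top : ∀ d : M.DiskDart pos c, M.FaceTop pos B c d → d = t
  top : M.ExitsRight pos c t → M.FaceTop pos B c t
  top_left : ∀ a, M.Germ pos a c → ¬ M.ExitsRight pos c t → M.FaceTop pos B a (M.rev (β t))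
  eq_apply : ∀ a, M.Germ pos a c → ∀ d : M.DiskDart pos c, M.FaceTop pos B a (M.rev d) → d = β t
  eq : ¬ M.ExitsRight pos c t → t = b
  not_touch : ∀ e, ¬ M.FaceTouch pos B c b e
  not_touch_left : ∀ a, M.Germ pos a c → ∀ e, ¬ M.FaceTouch pos B a e (M.rev b)
  ne : ∀ a, M.Germ pos a c → M.ExitsRight pos c t → ∀ d, M.FaceTop pos B a d → t ≠ b

/-- Each dart takes its successor from the cycle of the face on its left, and the gaps are those of
the exterior face. The disk has to contain a boundary point of that face; this is not yet known for
every disk. -/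
theorem exists_isGlue (hP : M.IsPlacement pos)
    (hB : ∀ f, M.IsFaceStack (M.eulerCycle f) Subtype.val pos (B f)) {f₀ : M.Face}
    (ho : ∀ d, d ∈ M.outer ↔ M.faceOf d = f₀) {d₀ : D} (hd₀ : M.Exits pos c d₀)
    (hf₀ : M.faceOf d₀ = f₀) : ∃ β t b, M.IsGlue hP B c β t b := by
  classical
  have E := fun f : M.Face => eulerCycle_isFaceCycle f
  have hof : ∀ f : M.Face, ∀ x y : M.FaceDart f, (x : D) ∈ M.outer ↔ (y : D) ∈ M.outer :=
    fun f x y => by rw [ho, ho, x.2, y.2]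
  have hex : ∀ f : M.Face, ∃ β, IsCyclicSucc
      ((M.eulerCycle f).diskRank (M.tourPos pos f) (B f) c) β := fun f =>
    exists_isCyclicSucc ((hB f).stack.diskRank_injective c) (hB f).stack.diskRank_lt_card
  choose γ hγ using hex
  have hex : ∀ f : M.Face, ∀ _ : (M.eulerCycle f).DiskDart (M.tourPos pos f) c, ∃ t b, IsExtremal
      ((M.eulerCycle f).diskRank (M.tourPos pos f) (B f) c)
      ((M.eulerCycle f).side (M.tourPos pos f) c) t b := fun f y =>
    haveI : Nonempty ((M.eulerCycle f).DiskDart (M.tourPos pos f) c) := ⟨y⟩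
    exists_isExtremal ((hB f).stack.diskRank_injective c) (hB f).stack.diskRank_lt_card _
  have hflip : ∀ f y, (γ f y : M.FaceDart f × Bool).2 = !(y : M.FaceDart f × Bool).2 := by
    intro f y
    obtain ⟨t, b, hE⟩ := hex f y
    exact IsFaceStack.snd_apply (E f) (hB f) (hγ f) hE (hof f) y
  let lift : ∀ (f : M.Face) (d : M.DiskDart pos c), M.faceOf d = f →
      (M.eulerCycle f).DiskDart (M.tourPos pos f) c :=
    fun f d hd => ⟨(⟨d, hd⟩, false), ((E f).exits_iff pos).2 d.2⟩
  have hlift : ∀ f (y : (M.eulerCycle f).DiskDart (M.tourPos pos f) c),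
      (y : M.FaceDart f × Bool).2 = false → ∃ hd, lift f ((E f).toDisk pos y) hd = y := by
    rintro f ⟨⟨⟨x, hx⟩, b⟩, hy⟩ h2
    simp only at h2
    subst h2
    exact ⟨hx, rfl⟩
  have hface : ∀ f (y : (M.eulerCycle f).DiskDart (M.tourPos pos f) c),
      (y : M.FaceDart f × Bool).2 = true → M.faceOf (M.rev ((E f).toDisk pos y : D)) = f := by
    rintro f ⟨⟨⟨x, hx⟩, b⟩, hy⟩ h2
    simp only at h2
    subst h2
    change M.faceOf (M.rev (M.rev x)) = f
    rw [M.rev_rev, hx]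
  -- Every boundary point is the `false` point of exactly one face cycle. The successor there is a
  -- `true` point, and it is the other side of the next boundary point.
  obtain ⟨β', hβ'⟩ : ∃ β' : M.DiskDart pos c → M.DiskDart pos c,
      ∀ f (d : M.DiskDart pos c) (hd : M.faceOf d = f),
      β' d = (E f).toDisk pos (γ f (lift f d hd)) :=
    ⟨fun d => (E _).toDisk pos (γ _ (lift _ d rfl)), by rintro f d rfl; rfl⟩
  have htrue : ∀ f (d : M.DiskDart pos c) (hd : M.faceOf d = f),
      (γ f (lift f d hd) : M.FaceDart f × Bool).2 = true :=
    fun f d hd => hflip f _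
  have hinj : Function.Injective β' := by
    intro d e hde
    have h1 := hface _ _ (htrue _ d rfl)
    have h2 := hface _ _ (htrue _ e rfl)
    rw [← hβ'] at h1 h2
    have h3 : M.faceOf e = M.faceOf d := by rw [← h1, ← h2, hde]
    rw [hβ' _ d rfl, hβ' _ e h3] at hde
    have h4 := (γ _).injective ((E _).toDisk_injective pos hde
      ((htrue _ _ _).trans (htrue _ _ _).symm))
    have h5 := congrArg (fun y => (y.1.1 : D)) h4
    exact Subtype.ext h5
  let β : Equiv.Perm (M.DiskDart pos c) :=
    Equiv.ofBijective β' (Finite.injective_iff_bijective.1 hinj)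
  have hβ : ∀ f (y : (M.eulerCycle f).DiskDart (M.tourPos pos f) c),
      (y : M.FaceDart f × Bool).2 = false → β ((E f).toDisk pos y) = (E f).toDisk pos (γ f y) := by
    intro f y hy
    obtain ⟨hd, h1⟩ := hlift f y hy
    change β' _ = _
    rw [hβ' f _ hd, h1]
  obtain ⟨t₀, b₀, hE₀⟩ := hex f₀ (lift f₀ ⟨d₀, hd₀⟩ hf₀)
  have ht₀ : (t₀ : M.FaceDart f₀ × Bool).2 = false :=
    (IsFaceStack.top_iff (E f₀) (hB f₀) hE₀).2 ((ho _).2 (t₀ : M.FaceDart f₀ × Bool).1.2)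
  have hb₀ : (b₀ : M.FaceDart f₀ × Bool).2 = false :=
    (IsFaceStack.last_iff (E f₀) (hB f₀) hE₀).2 ((ho _).2 (b₀ : M.FaceDart f₀ × Bool).1.2)
  have hS : ∀ f, ∀ y ∈ {y : (M.eulerCycle f).DiskDart (M.tourPos pos f) c |
      (y : M.FaceDart f × Bool).2 = false}, ((((E f).isPlacement hP).diskPerm c)⁻¹ * γ f) y ∈
      {y : (M.eulerCycle f).DiskDart (M.tourPos pos f) c |
      (y : M.FaceDart f × Bool).2 = false} := by
    intro f y hy
    obtain ⟨t, b, hE⟩ := hex f y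
    exact IsFaceStack.snd_inv_mul (E f) (hB f) (hγ f) hE hP (hof f) hy
  have hφ : ∀ f, ∀ y ∈ {y : (M.eulerCycle f).DiskDart (M.tourPos pos f) c |
      (y : M.FaceDart f × Bool).2 = false}, (E f).toDisk pos
        (((((E f).isPlacement hP).diskPerm c)⁻¹ * γ f) y) =
        ((hP.diskPerm c)⁻¹ * β) ((E f).toDisk pos y) := by
    intro f y hy
    obtain ⟨t, b, hE⟩ := hex f y
    rw [IsFaceStack.toDisk_inv_mul (E f) (hB f) (hγ f) hE hP (hof f) hy, Equiv.Perm.mul_apply,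
      hβ f y hy]
  have hφi : ∀ f, Set.InjOn ((E f).toDisk pos)
      {y : (M.eulerCycle f).DiskDart (M.tourPos pos f) c | (y : M.FaceDart f × Bool).2 = false} :=
    fun f y hy z hz hyz => (E f).toDisk_injective pos hyz (Eq.trans hy hz.symm)
  have hψf : ∀ (d : M.DiskDart pos c), M.faceOf (((hP.diskPerm c)⁻¹ * β) d : D) = M.faceOf d := by
    intro d
    have h1 := hφ _ (lift _ d rfl) rfl
    have h2 := hlift _ _ (hS _ (lift _ d rfl) rfl)
    rw [h1] at h2
    exact h2.1
  have hmax := fun x => Nat.lt_succ_iff.1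
    (lt_of_lt_of_eq ((hB f₀).stack.diskRank_lt_card (c := c) x) hE₀.last.symm)
  refine ⟨β, (E f₀).toDisk pos t₀, (E f₀).toDisk pos b₀, ?_, ?_, ?_, ?_, ?_, ?_, ?_, ?_, ?_, ?_, ?_⟩
  · intro y
    obtain ⟨f, hf⟩ : ∃ f, M.faceOf y = f := ⟨_, rfl⟩
    have h1 := sum_sameCycle_map _ (hS f) (hφ f) (hφi f) (y := lift f y hf) rfl
      fun z => M.weight pos c z
    have h2 : (E f).toDisk pos (lift f y hf) = y := rfl
    rw [h2] at h1
    refine Eq.trans (Finset.sum_congr (by congr!) fun _ _ => rfl) (h1.symm.trans ?_)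
    -- The regions in `f` are those of its cycle. Only for the exterior face are the extremal points
    -- `false` points, so only its regions can contain the two gaps.
    by_cases hff : f = f₀
    · subst hff
      have h3 := sameCycle_map_iff _ (hS f) (hφ f) (hφi f) (y := lift f y hf) (z := t₀) rfl ht₀
      have h4 := sameCycle_map_iff _ (hS f) (hφ f) (hφi f) (y := lift f y hf) (z := b₀) rfl hb₀
      rw [h2] at h3 h4
      refine Eq.trans (Eq.trans (Finset.sum_congr (by congr!) fun _ _ => rfl)
        (IsFaceStack.sum_region (E f) (hB f) (hγ f) hE₀ hP (hof f) (lift f y hf) rfl)) ?_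
      split_ifs <;> first | rfl | (exfalso; tauto)
    · obtain ⟨t, b, hE⟩ := hex f (lift f y hf)
      refine Eq.trans (Eq.trans (Finset.sum_congr (by congr!) fun _ _ => rfl)
        (IsFaceStack.sum_region (E f) (hB f) (hγ f) hE hP (hof f) (lift f y hf) rfl)) ?_
      have hn : ∀ z : (M.eulerCycle f).DiskDart (M.tourPos pos f) c,
          ((z : M.FaceDart f × Bool).2 = false ↔ ((z : M.FaceDart f × Bool).1 : D) ∈ M.outer) →
          ¬ ((((E f).isPlacement hP).diskPerm c)⁻¹ * γ f).SameCycle (lift f y hf) z := by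
        intro z hz hs
        have h3 := mem_of_sameCycle (hS f) rfl hs
        exact hff (((z : M.FaceDart f × Bool).1.2).symm.trans ((ho _).1 (hz.1 h3)))
      have hn₀ : ∀ z : (M.eulerCycle f₀).DiskDart (M.tourPos pos f₀) c,
          (z : M.FaceDart f₀ × Bool).2 = false →
          ¬ ((hP.diskPerm c)⁻¹ * β).SameCycle y ((E f₀).toDisk pos z) := by
        intro z hz hs
        have h3 := mem_of_sameCycle
          (S := {z : M.DiskDart pos c | M.faceOf (z : D) = f})
          (fun x hx => (hψf x).trans hx) hf hs
        exact hff (h3.symm.trans (hlift f₀ z hz).1)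
      rw [if_neg (hn t (IsFaceStack.top_iff (E f) (hB f) hE)),
        if_neg (hn b (IsFaceStack.last_iff (E f) (hB f) hE)), if_neg (hn₀ t₀ ht₀),
        if_neg (hn₀ b₀ hb₀)]
  · rintro d e ⟨f, hd, he, hT⟩
    have h1 := (hB f).stack.apply_eq_of_touch (hγ f) (d := lift f d hd)
      (e := ⟨(⟨M.rev e, he⟩, true), Or.inl hT.2.1⟩) hT
    have h2 := hβ f (lift f d hd) rfl
    rw [h1] at h2
    exact h2.trans (Subtype.ext (M.rev_rev _))
  · rintro a ha d e ⟨f, hd, he, hT⟩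
    have hd' : M.faceOf d = f := by rwa [M.rev_rev] at he
    have h3 : (⟨M.rev (M.rev d), he⟩ : M.FaceDart f) = ⟨d, hd'⟩ := Subtype.ext (M.rev_rev _)
    rw [h3] at hT
    have h1 := (hB f).stack.apply_eq_of_touch_left (hγ f) (IsFaceStack.germ (E f) ha)
      (d := lift f d hd')
      (e := ⟨(⟨M.rev e, hd⟩, true), ((E f).exits_iff pos).2 (by
        change M.Exits pos c (M.rev (M.rev e)); rw [M.rev_rev]; exact e.2)⟩) hT
    have h2 := hβ f (lift f d hd') rfl
    rw [h1] at h2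
    exact h2.trans (Subtype.ext (M.rev_rev _))
  · rintro d ⟨f, hd, hdo, hr, hn⟩
    obtain rfl : f = f₀ := hd.symm.trans ((ho _).1 hdo)
    have h1 := (hB f).stack.eq_of_top hE₀ (d := lift f d hd)
      (((E f).exitsRight_iff pos).2 hr) hn
    exact congrArg ((E f).toDisk pos) h1
  · intro hr
    obtain ⟨hd, h1⟩ := hlift f₀ t₀ ht₀
    have h2 := (hB f₀).stack.top_right hE₀ (((E f₀).exitsRight_iff pos).2 hr)
    rw [← h1] at h2
    exact ⟨f₀, hd, (ho _).2 hd, hr, h2⟩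
  · intro a ha hr
    have h1 := (hB f₀).stack
    have h2 := exitsLeft_apply (β := γ f₀) hE₀ (fun h' => hr (((E f₀).exitsRight_iff pos).1 h'))
    have h3 := (hB f₀).stack.top_left (hγ f₀) hE₀ h2
    have h4 := hflip f₀ t₀
    have h5 := hβ f₀ t₀ ht₀
    rw [h5]
    rw [ht₀] at h4
    have ha' := IsFaceStack.germ (E f₀) ha
    have h6 := (ha' _).1 h2
    generalize γ f₀ t₀ = z at h2 h3 h4 h6
    obtain ⟨⟨⟨x, hx⟩, b⟩, hz⟩ := z
    obtain rfl : b = true := h4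
    change M.FaceTop pos B a (M.rev (M.rev x))
    rw [M.rev_rev]
    refine ⟨f₀, hx, (ho _).2 hx, ((E f₀).exitsRight_iff pos).1 h6, fun q hq hxq => ?_⟩
    refine h3 ((M.eulerCycle f₀).rev q) ((ha' _).2 (by rwa [(M.eulerCycle f₀).rev_rev])) ?_
    rw [(M.eulerCycle f₀).rev_rev]
    exact hxq
  · rintro a ha d ⟨f, hd, hdo, hr, hn⟩
    obtain rfl : f = f₀ := hd.symm.trans ((ho _).1 hdo)
    have ha' := IsFaceStack.germ (E f) ha
    have h0 : (M.eulerCycle f).ExitsLeft (M.tourPos pos f) c (⟨M.rev d, hd⟩, true) := by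
      rw [(E f).exitsLeft_iff]
      change M.ExitsLeft pos c (M.rev (M.rev d))
      rw [M.rev_rev]
      exact (ha _).2 hr
    have h1 := (hB f).stack.eq_apply_of_top_left (hγ f) hE₀
      (d := ⟨(⟨M.rev d, hd⟩, true), Or.inr h0⟩) h0 fun e he => hn _ ((ha' _).1 he)
    have h2 := congrArg ((E f).toDisk pos) h1
    rw [← hβ f t₀ ht₀] at h2
    rw [← h2]
    exact Subtype.ext (M.rev_rev _).symm
  · intro hr
    exact congrArg ((E f₀).toDisk pos) (hE₀.eq fun h' =>
      hr (((E f₀).exitsRight_iff pos).1 (side_eq_zero_iff.1 h')))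
  · rintro e ⟨f, hd, he, hT⟩
    obtain ⟨hb, h1⟩ := hlift f₀ b₀ hb₀
    obtain rfl : f = f₀ := hd.symm.trans hb
    have h2 := (hB f).stack.diskRank_lt_of_touch (d := lift f _ hb)
      (e := ⟨(⟨M.rev e, he⟩, true), Or.inl hT.2.1⟩) hT
    rw [h1] at h2
    exact absurd h2 (not_lt.2 (hmax _))
  · rintro a ha e ⟨f, hd, he, hT⟩
    obtain ⟨hb, h1⟩ := hlift f₀ b₀ hb₀
    have he' : M.faceOf ((E f₀).toDisk pos b₀ : D) = f := by rwa [M.rev_rev] at he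
    obtain rfl : f = f₀ := he'.symm.trans hb
    have h3 : (⟨M.rev (M.rev ((E f).toDisk pos b₀ : D)), he⟩ : M.FaceDart f) = ⟨_, he'⟩ :=
      Subtype.ext (M.rev_rev _)
    rw [h3] at hT
    have hl : (M.eulerCycle f).ExitsLeft (M.tourPos pos f) c (⟨e, hd⟩, true) := by
      rw [IsFaceStack.germ (E f) ha]
      exact hT.1
    have h2 := (hB f).stack.diskRank_lt_of_touch_left (IsFaceStack.germ (E f) ha)
      (d := lift f _ hb) (e := ⟨(⟨e, hd⟩, true), Or.inr hl⟩) hT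
    rw [h1] at h2
    exact absurd h2 (not_lt.2 (hmax _))
  · rintro a ha hr d ⟨f, hd, hdo, hrd, hn⟩ htb
    obtain rfl : f = f₀ := hd.symm.trans ((ho _).1 hdo)
    have h1 : t₀ = b₀ := (E f).toDisk_injective pos htb (ht₀.trans hb₀.symm)
    have hl : (M.eulerCycle f).ExitsLeft (M.tourPos pos f) c (⟨d, hd⟩, true) := by
      rw [IsFaceStack.germ (E f) ha, (E f).exitsRight_iff]
      exact hrd
    have h2 := (hB f).stack.diskRank_lt_of_side (y := t₀) (z := ⟨_, Or.inr hl⟩)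
      (side_eq_zero_iff.2 (((E f).exitsRight_iff pos).2 hr))
      ((side_eq_zero_or_one _).resolve_left fun h' =>
        not_exitsRight_of_exitsLeft hl (side_eq_zero_iff.1 h'))
    rw [h1] at h2
    exact absurd h2 (not_lt.2 (hmax _))

end Gluing

end AngledMap

/-! ### The part of a disk that contains the upper gap -/

namespace CyclicOrder

/-- A transitive part that contains `t` is a disk. -/
theorem sameCycle_of_transitive {Y K : Type*} [Fintype Y] [Fintype K] {ν ψ : Equiv.Perm Y}
    {w : Y → ℤ} {t b : Y}
    (hν : open Classical in ∀ y, ∑ z with ν.SameCycle y z, (2 - w z) = 2)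
    (hψ : open Classical in ∀ y, ∑ z with ψ.SameCycle y z, w z =
      2 - (if ψ.SameCycle y t then 1 else 0) - (if ψ.SameCycle y b then 1 else 0))
    {φ : K → Y} (hφ : Function.Injective φ) {νK ψK : Equiv.Perm K} (h1 : ∀ k, φ (νK k) = ν (φ k))
    (h2 : ∀ k, φ (ψK k) = ψ (φ k)) (hT : Transitive νK ψK) {tK : K} (ht : φ tK = t) (k : K) :
    (ν * ψ).SameCycle t (φ k) := by
  classical
  have hν' : ∀ y : K, ∑ z with νK.SameCycle y z, (2 - w (φ z)) = 2 := fun y =>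
    (sum_sameCycle_map (S := Set.univ) φ (fun _ _ => trivial) (fun k _ => h1 k) hφ.injOn
      (y := y) trivial fun z => 2 - w z).trans (hν _)
  have hS : ∀ y z : K, ψ.SameCycle (φ y) (φ z) ↔ ψK.SameCycle y z := fun y z =>
    sameCycle_map_iff (S := Set.univ) φ (fun _ _ => trivial) (fun k _ => h2 k) hφ.injOn
      trivial trivial
  have hψ' : ∀ y : K, ∑ z with ψK.SameCycle y z, w (φ z) =
      2 - (if ψ.SameCycle (φ y) t then 1 else 0) - (if ψ.SameCycle (φ y) b then 1 else 0) :=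
    fun y => (sum_sameCycle_map (S := Set.univ) φ (fun _ _ => trivial) (fun k _ => h2 k) hφ.injOn
      (y := y) trivial w).trans (hψ _)
  subst ht
  -- By parity, the part cannot contain only one of the two gaps.
  have hb : ∃ bK, φ bK = b := by
    by_contra hb
    refine not_sum_region_single (t := tK) hν' fun y => (hψ' y).trans ?_
    have h3 : ¬ ψ.SameCycle (φ y) b := fun h => hb
      (mem_of_sameCycle (S := Set.range φ) (by rintro _ ⟨x, rfl⟩; exact ⟨_, h2 x⟩) ⟨y, rfl⟩ h)
    rw [if_neg h3, sub_zero]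
    exact congrArg _ (if_congr (hS y tK) rfl rfl)
  obtain ⟨bK, rfl⟩ := hb
  have hD : IsDisk νK ψK (fun z => w (φ z)) tK bK := by
    refine ⟨hT, hν', fun y => (hψ' y).trans ?_⟩
    have h3 := hS y tK
    have h4 := hS y bK
    split_ifs <;> first | rfl | (exfalso; tauto)
  exact (sameCycle_map_iff (π := νK * ψK) (S := Set.univ) φ
    (fun _ _ => trivial) (fun k _ => by rw [Equiv.Perm.mul_apply, Equiv.Perm.mul_apply, h1, h2])
    hφ.injOn trivial trivial).2 (hD.sameCycle tK k)

/-- The component of `t` is a disk. -/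
theorem sameCycle_of_eqvGen {Y : Type*} [Fintype Y] {ν ψ : Equiv.Perm Y} {w : Y → ℤ} {t b : Y}
    (hν : open Classical in ∀ y, ∑ z with ν.SameCycle y z, (2 - w z) = 2)
    (hψ : open Classical in ∀ y, ∑ z with ψ.SameCycle y z, w z =
      2 - (if ψ.SameCycle y t then 1 else 0) - (if ψ.SameCycle y b then 1 else 0)) {y : Y}
    (hy : Relation.EqvGen (fun a b => b = ν a ∨ b = ψ a) t y) : (ν * ψ).SameCycle t y := by
  classical
  set R : Y → Y → Prop := fun a b => b = ν a ∨ b = ψ a with hR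
  have hRν : ∀ x, Relation.EqvGen R x (ν x) := fun x => .rel _ _ (Or.inl rfl)
  have hRψ : ∀ x, Relation.EqvGen R x (ψ x) := fun x => .rel _ _ (Or.inr rfl)
  have hKν : ∀ x, Relation.EqvGen R t (ν x) ↔ Relation.EqvGen R t x := fun x =>
    ⟨fun h => h.trans _ _ _ ((hRν x).symm _ _), fun h => h.trans _ _ _ (hRν x)⟩
  have hKψ : ∀ x, Relation.EqvGen R t (ψ x) ↔ Relation.EqvGen R t x := fun x =>
    ⟨fun h => h.trans _ _ _ ((hRψ x).symm _ _), fun h => h.trans _ _ _ (hRψ x)⟩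
  have key : ∀ x y, Relation.EqvGen R x y → ∀ (hx : Relation.EqvGen R t x)
      (hy : Relation.EqvGen R t y), Relation.EqvGen (fun a b : {x // Relation.EqvGen R t x} =>
        b = ν.subtypePerm hKν a ∨ b = ψ.subtypePerm hKψ a) ⟨x, hx⟩ ⟨y, hy⟩ := by
    intro x y h
    induction h with
    | rel x y h => exact fun hx hy => .rel _ _ (h.imp Subtype.ext Subtype.ext)
    | refl x => exact fun hx hy => .refl _
    | symm x y _ ih => exact fun hx hy => (ih hy hx).symm _ _
    | trans x y z h1 _ ih1 ih2 =>
      exact fun hx hz => (ih1 hx (hx.trans _ _ _ h1)).trans _ _ _ (ih2 _ hz)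
  exact sameCycle_of_transitive hν hψ (φ := Subtype.val) Subtype.val_injective
    (νK := ν.subtypePerm hKν) (ψK := ψ.subtypePerm hKψ) (fun _ => rfl) (fun _ => rfl)
    (fun x y => key _ _ ((x.2.symm _ _).trans _ _ _ y.2) _ _) (tK := ⟨t, .refl _⟩) rfl ⟨y, hy⟩

end CyclicOrder

/-! ### Component sums, and chains of touching edges to the exterior face -/

namespace AngledMap

open CyclicOrder

section Component

variable {D : Type*} {M : AngledMap D} {pos : D → ℝ} {c : ℝ}

theorem IsPlacement.weight_of_eq (hangle : ∀ d, M.angle d = 0 ∨ M.angle d = 180 ∨ M.angle d = 360)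
    {d : D} (hd : pos d = c) : (M.angle d : ℤ) = 180 * (2 - M.weight pos c d) := by
  unfold weight
  rw [if_pos hd]
  rcases hangle d with h | h | h <;> rw [h] <;> norm_num

open Classical in
-- At a vertex this is the angle sum of 360 in units of 180; a passing edge contributes two straight
-- corners.
theorem IsPlacement.sum_weight [Fintype D] (hP : M.IsPlacement pos) (hM : M.IsConsistent)
    (y : M.DiskDart pos c) :
    ∑ z with (hP.diskPerm c).SameCycle y z, (2 - M.weight pos c z) = 2 := by
  by_cases hy : pos y = c
  · have hS : ∀ z ∈ {z : M.DiskDart pos c | pos z = c},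
        hP.diskPerm c z ∈ {z : M.DiskDart pos c | pos z = c} := fun z hz => by
      change pos (hP.diskPerm c z : D) = c
      rw [hP.diskPerm_of_eq z hz, hP.rot]
      exact hz
    have h1 := sum_sameCycle_map (π := hP.diskPerm c) (ρ := M.rot) Subtype.val hS
      (fun z hz => hP.diskPerm_of_eq z hz) Subtype.val_injective.injOn (y := y) hy
      fun z => 2 - M.weight pos c z
    refine Eq.trans (Finset.sum_congr (by congr!) fun _ _ => rfl) (h1.trans ?_)
    have h2 := congrArg (Nat.cast (R := ℤ)) (hM.angle_sum y)
    rw [Nat.cast_sum] at h2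
    have h3 : ∑ z with M.rot.SameCycle (y : D) z, (M.angle z : ℤ) =
        ∑ z with M.rot.SameCycle (y : D) z, 180 * (2 - M.weight pos c z) := by
      refine Finset.sum_congr rfl fun z hz => IsPlacement.weight_of_eq hM.angle_mem ?_
      simp only [Finset.mem_filter, Finset.mem_univ, true_and] at hz
      exact mem_of_sameCycle (S := {z | pos z = c}) (fun x hx => (hP.rot x).trans hx) hy hz
    have h4 : ∑ z with M.rot.SameCycle (y : D) z, 180 * (2 - M.weight pos c z) = 360 := by
      rw [← h3]
      refine Eq.trans (Finset.sum_congr (by congr!) fun _ _ => rfl) (h2.trans (by norm_num))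
    rw [← Finset.mul_sum] at h4
    refine Eq.trans (Finset.sum_congr (by congr!) fun _ _ => rfl)
      (show ∑ z with M.rot.SameCycle (y : D) z, (2 - M.weight pos c z) = 2 by omega)
  · have h1 := hP.diskPerm_of_ne y hy
    have h2 : pos (hP.diskPerm c y : D) ≠ c := by
      rw [h1]
      exact (y.2.rev hy).2
    have h3 : hP.diskPerm c (hP.diskPerm c y) = y := Subtype.ext (by
      rw [hP.diskPerm_of_ne _ h2, h1, M.rev_rev])
    have h4 : y ≠ hP.diskPerm c y := fun h => M.rev_ne y (by rw [← h1, ← h])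
    have h5 : (Finset.univ.filter fun z => (hP.diskPerm c).SameCycle y z) =
        {y, hP.diskPerm c y} := by
      ext z
      simp only [Finset.mem_filter, Finset.mem_univ, true_and, Finset.mem_insert,
        Finset.mem_singleton]
      constructor
      · intro hz
        refine mem_of_sameCycle (S := {z | z = y ∨ z = hP.diskPerm c y}) ?_ (Or.inl rfl) hz
        rintro x (rfl | rfl)
        · exact Or.inr rfl
        · exact Or.inl h3
      · rintro (rfl | rfl)
        · exact .refl _ _
        · exact Equiv.Perm.sameCycle_apply_right.2 (.refl _ _)
    rw [h5, Finset.sum_pair h4]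
    unfold weight
    rw [if_neg hy, if_neg h2]
    norm_num

end Component

section Reach

variable {D : Type*} {M : AngledMap D} {pos : D → ℝ}
  {B : ∀ f : M.Face, M.FaceDart f × Bool → M.FaceDart f × Bool → Prop} {c : ℝ}

/-- `d` is linked to the highest edge of the exterior face through touching edges. -/
def Reach (M : AngledMap D) (pos : D → ℝ)
    (B : ∀ f : M.Face, M.FaceDart f × Bool → M.FaceDart f × Bool → Prop) (c : ℝ) (d : D) : Prop :=
  ∃ T, M.FaceTop pos B c T ∧ Relation.ReflTransGen (M.FaceTouch pos B c) d T

variable [Finite D] {hP : M.IsPlacement pos}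
  (hB : ∀ f, M.IsFaceStack (M.eulerCycle f) Subtype.val pos (B f))
  {β : Equiv.Perm (M.DiskDart pos c)} {t b : M.DiskDart pos c} (G : M.IsGlue hP B c β t b)

namespace IsGlue
include G

theorem sameCycle_of_reflTransGen {T : D} (hT : M.FaceTop pos B c T) {d : D}
    (h : Relation.ReflTransGen (M.FaceTouch pos B c) d T) (hd : M.Exits pos c d) :
    β.SameCycle t ⟨d, hd⟩ := by
  induction h using Relation.ReflTransGen.head_induction_on with
  | refl => rw [G.eq_of_top ⟨T, hd⟩ hT]
  | @head x y hxy _ ih =>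
    have h1 := G.apply_eq ⟨x, hd⟩ ⟨y, Or.inl hxy.exitsRight_right⟩ hxy
    rw [← Equiv.Perm.sameCycle_apply_right, h1]
    exact ih _

theorem sameCycle_of_reflTransGen_left {a : ℝ} (ha : M.Germ pos a c) {T : D}
    (hT : M.FaceTop pos B a T) {d : D}
    (h : Relation.ReflTransGen (M.FaceTouch pos B a) d T) (hd : M.Exits pos c (M.rev d)) :
    β.SameCycle t ⟨M.rev d, hd⟩ := by
  induction h using Relation.ReflTransGen.head_induction_on with
  | refl =>
    rw [G.eq_apply a ha ⟨M.rev T, hd⟩ (by rwa [M.rev_rev])]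
    exact Equiv.Perm.sameCycle_apply_right.2 (.refl _ _)
  | @head x y hxy _ ih =>
    have hy : M.Exits pos c (M.rev y) :=
      Or.inr ((ha _).2 (by rw [M.rev_rev]; exact hxy.exitsRight_right))
    have h1 := G.apply_eq_left a ha ⟨M.rev y, hy⟩ ⟨M.rev x, hd⟩ (by rwa [M.rev_rev, M.rev_rev])
    rw [← h1, Equiv.Perm.sameCycle_apply_right]
    exact ih _

include hB

/-- Follow `β` from `y` to `t`: on the right side each step climbs to the touching edge above, until
the top is reached. -/
theorem reach_of_sameCycle {y : M.DiskDart pos c} (hy : β.SameCycle t y)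
    (hr : M.ExitsRight pos c y) : M.Reach pos B c y := by
  obtain ⟨n, -, hn⟩ := hy.symm.exists_pow_eq'
  induction n generalizing y with
  | zero =>
    obtain rfl : y = t := by simpa using hn
    exact ⟨y, G.top hr, .refl⟩
  | succ n ih =>
    rcases exists_faceTouch_or_top hB hr with ⟨e, he⟩ | ht
    · have h1 := G.apply_eq y ⟨e, Or.inl he.exitsRight_right⟩ he
      have h2 := ih (y := β y) (Equiv.Perm.sameCycle_apply_right.2 hy)
        (by rw [h1]; exact he.exitsRight_right) (by rw [← hn, pow_succ, Equiv.Perm.mul_apply])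
      rw [h1] at h2
      obtain ⟨T, hT, h3⟩ := h2
      exact ⟨T, hT, .head he h3⟩
    · exact ⟨y, ht, .refl⟩

/-- On the left side `β` descends, so the induction counts the steps from `β t` down to `y`. -/
theorem reach_of_sameCycle_left {a : ℝ} (ha : M.Germ pos a c) {y : M.DiskDart pos c}
    (hy : β.SameCycle t y) (hl : M.ExitsLeft pos c y) : M.Reach pos B a (M.rev y) := by
  have h0 := (Equiv.Perm.sameCycle_apply_left (f := β)).2 hy
  obtain ⟨n, -, hn⟩ := h0.exists_pow_eq'
  clear h0 hy
  induction n generalizing y with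
  | zero =>
    obtain rfl : β t = y := by simpa using hn
    rcases exists_faceTouch_or_top hB ((ha _).1 hl) with ⟨e, he⟩ | ht
    · have hl' : M.ExitsLeft pos c (M.rev e) := by
        rw [ha, M.rev_rev]
        exact he.exitsRight_right
      have h1 := G.apply_eq_left a ha ⟨M.rev e, Or.inr hl'⟩ (β t) (by rwa [M.rev_rev])
      have h2 := β.injective h1
      refine ⟨_, G.top_left a ha ?_, .refl⟩
      rw [← h2]
      exact not_exitsRight_of_exitsLeft hl'
    · exact ⟨_, ht, .refl⟩
  | succ n ih =>
    rcases exists_faceTouch_or_top hB ((ha _).1 hl) with ⟨e, he⟩ | ht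
    · have hl' : M.ExitsLeft pos c (M.rev e) := by
        rw [ha, M.rev_rev]
        exact he.exitsRight_right
      have h1 := G.apply_eq_left a ha ⟨M.rev e, Or.inr hl'⟩ y (by rwa [M.rev_rev])
      rw [← h1, pow_succ', Equiv.Perm.mul_apply] at hn
      have h2 := ih (y := ⟨M.rev e, Or.inr hl'⟩) hl' (β.injective hn)
      rw [M.rev_rev] at h2
      obtain ⟨T, hT, h3⟩ := h2
      exact ⟨T, hT, .head he h3⟩
    · exact ⟨_, ht, .refl⟩

theorem sameCycle_iff_reach {y : M.DiskDart pos c} (hr : M.ExitsRight pos c y) :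
    β.SameCycle t y ↔ M.Reach pos B c y :=
  ⟨fun h => G.reach_of_sameCycle hB h hr, fun ⟨_, hT, h⟩ => G.sameCycle_of_reflTransGen hT h _⟩

theorem sameCycle_iff_reach_left {a : ℝ} (ha : M.Germ pos a c) {y : M.DiskDart pos c}
    (hl : M.ExitsLeft pos c y) : β.SameCycle t y ↔ M.Reach pos B a (M.rev y) := by
  refine ⟨fun h => G.reach_of_sameCycle_left hB ha h hl, fun ⟨_, hT, h⟩ => ?_⟩
  have hy : M.Exits pos c (M.rev (M.rev y)) := by rw [M.rev_rev]; exact y.2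
  have h1 := G.sameCycle_of_reflTransGen_left ha hT h hy
  rwa [show (⟨M.rev (M.rev y), hy⟩ : M.DiskDart pos c) = y from Subtype.ext (M.rev_rev _)] at h1

end IsGlue

end Reach

end AngledMap

/-! ### Connectivity makes the glued successor a single cycle -/

namespace AngledMap

open CyclicOrder

section Linked

variable {D : Type*} {M : AngledMap D} {pos : D → ℝ}
  {B : ∀ f : M.Face, M.FaceDart f × Bool → M.FaceDart f × Bool → Prop} {c : ℝ}

/-- The cycle of `t` is the whole part of the disk that is generated from `t` by components and
regions, so it is a union of components. This is how reachability crosses a disk. -/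
theorem IsGlue.sameCycle_diskPerm_iff [Fintype D] {hP : M.IsPlacement pos}
    {β : Equiv.Perm (M.DiskDart pos c)} {t b : M.DiskDart pos c} (G : M.IsGlue hP B c β t b)
    (hM : M.IsConsistent) (y : M.DiskDart pos c) :
    β.SameCycle t (hP.diskPerm c y) ↔ β.SameCycle t y := by
  have h1 : hP.diskPerm c * ((hP.diskPerm c)⁻¹ * β) = β := mul_inv_cancel_left _ _
  set R : M.DiskDart pos c → M.DiskDart pos c → Prop :=
    fun a b => b = hP.diskPerm c a ∨ b = ((hP.diskPerm c)⁻¹ * β) a with hR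
  have hRν : ∀ x, Relation.EqvGen R x (hP.diskPerm c x) := fun x => .rel _ _ (Or.inl rfl)
  have hRψ : ∀ x, Relation.EqvGen R x (((hP.diskPerm c)⁻¹ * β) x) := fun x => .rel _ _ (Or.inr rfl)
  have hRβ : ∀ x, Relation.EqvGen R x (β x) := fun x => by
    have h2 := (hRψ x).trans _ _ _ (hRν _)
    rwa [← Equiv.Perm.mul_apply, h1] at h2
  have h2 : ∀ y, β.SameCycle t y ↔ Relation.EqvGen R t y := by
    intro y
    constructor
    · intro h
      exact mem_of_sameCycle (S := {y | Relation.EqvGen R t y})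
        (fun x hx => Relation.EqvGen.trans _ _ _ hx (hRβ x)) (.refl _) h
    · intro h
      have h3 := sameCycle_of_eqvGen (ν := hP.diskPerm c) (ψ := (hP.diskPerm c)⁻¹ * β)
        (w := fun z => M.weight pos c z) (b := b)
        (fun y => Eq.trans (Finset.sum_congr (by congr!) fun _ _ => rfl) (hP.sum_weight hM y))
        (fun y => Eq.trans (Finset.sum_congr (by congr!) fun _ _ => rfl)
          ((G.sum_region y).trans (by congr!))) h
      rwa [h1] at h3
  have h3 : Relation.EqvGen R (hP.diskPerm c y) y := (hRν y).symm _ _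
  exact (h2 _).trans (Iff.trans ⟨fun h => Relation.EqvGen.trans t _ y h h3,
    fun h => Relation.EqvGen.trans t y _ h (hRν y)⟩ (h2 y).symm)

theorem Reach.exists_isGlue [Finite D] (hP : M.IsPlacement pos)
    (hB : ∀ f, M.IsFaceStack (M.eulerCycle f) Subtype.val pos (B f)) {f₀ : M.Face}
    (ho : ∀ d, d ∈ M.outer ↔ M.faceOf d = f₀) {d : D} (h : M.Reach pos B c d) :
    ∃ β t b, M.IsGlue hP B c β t b := by
  obtain ⟨T, ⟨f, hf, hTo, hr, -⟩, -⟩ := h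
  exact AngledMap.exists_isGlue hP hB ho (Or.inl hr) ((ho T).1 hTo)

theorem Reach.exists_isGlue_left [Finite D] (hP : M.IsPlacement pos)
    (hB : ∀ f, M.IsFaceStack (M.eulerCycle f) Subtype.val pos (B f)) {f₀ : M.Face}
    (ho : ∀ d, d ∈ M.outer ↔ M.faceOf d = f₀) {a : ℝ} (hac : IsPathEdge pos a c) {d : D}
    (h : M.Reach pos B a d) : ∃ β t b, M.IsGlue hP B c β t b := by
  obtain ⟨T, ⟨f, hf, hTo, hr, -⟩, -⟩ := h
  have h1 : M.ExitsLeft pos c (M.rev T) := by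
    rw [hac.germ, M.rev_rev]
    exact hr
  -- The exterior edge over the interval ends at `c`, where its successor along the face leaves the
  -- disk, or it passes through `c`.
  rcases h1.1.eq_or_lt with h2 | h2
  · refine AngledMap.exists_isGlue hP hB ho (d₀ := M.faceNext T) ?_ ?_
    · have h3 : pos (M.faceNext T) = c := by
        rw [← hP.rot, rot_faceNext, h2]
      rw [← h3]
      exact hP.exits_self _
    · rw [M.faceOf_faceNext, (ho T).1 hTo]
  · refine AngledMap.exists_isGlue hP hB ho (d₀ := T) (Or.inl ⟨?_, h2⟩) ((ho T).1 hTo)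
    have := h1.2
    rw [M.rev_rev] at this
    exact this.le

/-- An edge that is linked to the highest edge of the exterior face through touching edges. -/
def Linked (M : AngledMap D) (pos : D → ℝ)
    (B : ∀ f : M.Face, M.FaceDart f × Bool → M.FaceDart f × Bool → Prop) (d : D) : Prop :=
  (pos d < pos (M.rev d) → M.Reach pos B (pos d) d) ∧
    (pos (M.rev d) < pos d → M.Reach pos B (pos (M.rev d)) (M.rev d))

variable [Fintype D] (hP : M.IsPlacement pos) (hM : M.IsConsistent)
  (hB : ∀ f, M.IsFaceStack (M.eulerCycle f) Subtype.val pos (B f)) {f₀ : M.Face}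
  (ho : ∀ d, d ∈ M.outer ↔ M.faceOf d = f₀)

include hP hM hB ho

/-- Both ends of a passing edge belong to one component of the disk at `b`, so both or neither lie
in the cycle of the top point. -/
theorem reach_step {a b : ℝ} (hab : IsPathEdge pos a b) {e : D} (h1 : pos e ≤ a)
    (h2 : b < pos (M.rev e)) : M.Reach pos B a e ↔ M.Reach pos B b e := by
  have key : ∀ β t s, M.IsGlue hP B b β t s → (M.Reach pos B a e ↔ M.Reach pos B b e) := by
    intro β t s G
    have hl : M.ExitsLeft pos b (M.rev e) :=
      ⟨h2.le, by rw [M.rev_rev]; exact h1.trans_lt hab.2.2.1⟩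
    have h3 := G.sameCycle_iff_reach_left hB hab.germ (y := ⟨M.rev e, Or.inr hl⟩) hl
    have h4 : (hP.diskPerm b ⟨M.rev e, Or.inr hl⟩ : D) = e := by
      rw [hP.diskPerm_of_ne _ h2.ne', M.rev_rev]
    have h5 := G.sameCycle_iff_reach hB (y := hP.diskPerm b ⟨M.rev e, Or.inr hl⟩)
      (by rw [h4]; exact ⟨h1.trans hab.2.2.1.le, h2⟩)
    rw [G.sameCycle_diskPerm_iff hM, h3, M.rev_rev, h4] at h5
    exact h5
  constructor
  · intro h
    obtain ⟨β, t, s, G⟩ := h.exists_isGlue_left hP hB ho hab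
    exact (key _ _ _ G).1 h
  · intro h
    obtain ⟨β, t, s, G⟩ := h.exists_isGlue hP hB ho
    exact (key _ _ _ G).2 h

theorem reach_along {e : D} (hc : c ∈ Set.range pos) (h1 : pos e ≤ c) (h2 : c < pos (M.rev e)) :
    M.Reach pos B c e ↔ M.Reach pos B (pos e) e :=
  path_induction (pos := pos) (p := fun c => M.Reach pos B c e ↔ M.Reach pos B (pos e) e) ⟨e, rfl⟩
    Iff.rfl (fun _ _ hab ha hb ih => (reach_step hP hM hB ho hab ha (hb.trans_lt h2)).symm.trans ih)
    hc h1 le_rfl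

theorem IsGlue.sameCycle_iff_linked {β : Equiv.Perm (M.DiskDart pos c)} {t b : M.DiskDart pos c}
    (G : M.IsGlue hP B c β t b) (hc : c ∈ Set.range pos) (y : M.DiskDart pos c) :
    β.SameCycle t y ↔ M.Linked pos B y := by
  rcases y.2 with hr | hl
  · have h1 : pos y < pos (M.rev y) := hr.1.trans_lt hr.2
    rw [G.sameCycle_iff_reach hB hr, reach_along hP hM hB ho hc hr.1 hr.2]
    exact ⟨fun h => ⟨fun _ => h, fun h' => absurd h' h1.not_gt⟩, fun h => h.1 h1⟩
  · have h1 : pos (M.rev y) < pos y := hl.2.trans_le hl.1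
    obtain ⟨a, b, hab, h2, h3, h4⟩ := exists_isPathEdge_left hl.2 hl.1
    obtain rfl := h4 hc
    have h5 := (hab.germ (M := M) y).1 hl
    rw [G.sameCycle_iff_reach_left hB hab.germ hl, reach_along hP hM hB ho hab.1 h5.1 h5.2]
    exact ⟨fun h => ⟨fun h' => absurd h' h1.not_gt, fun _ => h⟩, fun h => h.2 h1⟩

theorem Linked.exists_isGlue {d : D} (h : M.Linked pos B d) :
    ∃ β t b, M.IsGlue hP B (pos d) β t b := by
  rcases (hP.pos_ne d).symm.lt_or_gt with h1 | h1
  · exact (h.1 h1).exists_isGlue hP hB ho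
  · obtain ⟨a, b, hab, h2, h3, h4⟩ := exists_isPathEdge_left (pos := pos) h1 le_rfl
    obtain rfl := h4 ⟨d, rfl⟩
    have hl : M.ExitsLeft pos (pos d) d := ⟨le_rfl, h1⟩
    have h5 := (hab.germ (M := M) d).1 hl
    have h6 := h.2 h1
    rw [← reach_along hP hM hB ho hab.1 h5.1 h5.2] at h6
    exact h6.exists_isGlue_left hP hB ho hab

/-- Either hypothesis puts an exterior boundary point into the disk, so that a glued successor
exists there; its cycle is a union of components. -/
theorem linked_rot_iff (d : D) : M.Linked pos B (M.rot d) ↔ M.Linked pos B d := by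
  have key : ∀ c, pos d = c → ∀ β t b, M.IsGlue hP B c β t b →
      (M.Linked pos B (M.rot d) ↔ M.Linked pos B d) := by
    rintro c rfl β t b G
    have h1 := G.sameCycle_diskPerm_iff hM ⟨d, hP.exits_self d⟩
    rw [G.sameCycle_iff_linked hP hM hB ho ⟨d, rfl⟩, G.sameCycle_iff_linked hP hM hB ho ⟨d, rfl⟩,
      hP.diskPerm_of_eq _ rfl] at h1
    exact h1
  constructor
  · intro h
    obtain ⟨β, t, b, G⟩ := h.exists_isGlue hP hM hB ho
    exact (key _ (hP.rot d).symm _ _ _ G).1 h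
  · intro h
    obtain ⟨β, t, b, G⟩ := h.exists_isGlue hP hM hB ho
    exact (key _ rfl _ _ _ G).2 h

/-- The order of the boundary points of every disk is a single cycle. -/
theorem exists_isGlue_sameCycle (hc : M.Connected) (hcr : c ∈ Set.range pos) :
    ∃ β t b, M.IsGlue hP B c β t b ∧ ∀ y, β.SameCycle t y := by
  have hrev : ∀ d, M.Linked pos B (M.rev d) ↔ M.Linked pos B d := fun d => by
    unfold Linked
    rw [M.rev_rev]
    exact and_comm
  -- A vertex on the exterior face supplies a disk where the gluing certainly exists; its top point
  -- is linked, and linkedness spreads over the connected graph.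
  obtain ⟨d₀, hd₀⟩ : ∃ d, M.faceOf d = f₀ := Quotient.exists_rep f₀
  obtain ⟨β, t, b, G⟩ := exists_isGlue hP hB ho (hP.exits_self d₀) hd₀
  have ht := (G.sameCycle_iff_linked hP hM hB ho ⟨d₀, rfl⟩ t).1 (.refl _ _)
  have hall : ∀ d, M.Linked pos B d := fun d => by
    rw [hc.eq_of_invariant (s := M.Linked pos B)
      (fun d => propext (linked_rot_iff hP hM hB ho d)) (fun d => propext (hrev d)) d t]
    exact ht
  obtain ⟨d, rfl⟩ := hcr
  obtain ⟨β, t, b, G⟩ := (hall d).exists_isGlue hP hM hB ho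
  exact ⟨β, t, b, G, fun y => (G.sameCycle_iff_linked hP hM hB ho ⟨d, rfl⟩ y).2 (hall y)⟩

end Linked

end AngledMap

/-! ### Ranks with prescribed turns -/

namespace CyclicOrder

/-- If the order of the boundary points is a single cycle, then it starts at some point such that
the last one is `b`, it is noncrossing, and the turns are the prescribed ones. -/
theorem exists_rank_turn_eq {Y : Type*} [Fintype Y] {ν β : Equiv.Perm Y} {w : Y → ℤ} {t b : Y}
    (hν : open Classical in ∀ y, ∑ z with ν.SameCycle y z, (2 - w z) = 2)
    (hψ : open Classical in ∀ y, ∑ z with (ν⁻¹ * β).SameCycle y z, w z =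
      2 - (if (ν⁻¹ * β).SameCycle y t then 1 else 0) -
        (if (ν⁻¹ * β).SameCycle y b then 1 else 0))
    (hc : ∀ y, β.SameCycle t y) :
    ∃ r : Y → ℕ, Function.Injective r ∧ (∀ y, r y < Fintype.card Y) ∧ IsCyclicSucc r β ∧
      r b + 1 = Fintype.card Y ∧ Noncrossing r ν ∧
      ∀ σ : Y → ℤ, (∀ y, σ y = 0 ∨ σ y = 1) → (∀ y z, σ y = 0 → σ z = 1 → r y < r z) →
        IsExtremal r σ t b → ∀ y, turn r σ ν y = w y := by
  classical
  have h1 : ν * (ν⁻¹ * β) = β := mul_inv_cancel_left _ _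
  -- Counting starts after the lower gap, so that `b` becomes the last point.
  obtain ⟨r, hr, hlt, hβ, h0⟩ := exists_rank (fun x y => (hc x).symm.trans (hc y)) (β b)
  have hb : r b + 1 = Fintype.card Y := by
    by_contra h
    have := hβ b
    rw [if_neg h] at this
    omega
  have hT : Transitive ν (ν⁻¹ * β) := by
    intro x y
    set R : Y → Y → Prop := fun a b => b = ν a ∨ b = (ν⁻¹ * β) a with hR
    have hRν : ∀ x, Relation.EqvGen R x (ν x) := fun x => .rel _ _ (Or.inl rfl)
    have hRψ : ∀ x, Relation.EqvGen R x ((ν⁻¹ * β) x) := fun x => .rel _ _ (Or.inr rfl)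
    refine mem_of_sameCycle (S := {y | Relation.EqvGen R x y}) (fun z hz => ?_)
      (.refl _) ((hc x).symm.trans (hc y))
    have h2 := (hRψ z).trans _ _ _ (hRν _)
    rw [← Equiv.Perm.mul_apply, h1] at h2
    exact Relation.EqvGen.trans _ _ _ hz h2
  have hD : IsDisk ν (ν⁻¹ * β) w t b := ⟨hT, hν, hψ⟩
  have hn : Noncrossing r ν := hD.noncrossing hr hlt (by rwa [h1])
  refine ⟨r, hr, hlt, hβ, hb, hn, fun σ h01 hσ hE y => ?_⟩
  have h2 := hn.sum_turn hr σ
  have h3 := hn.sum_turn_inv_mul hr hlt hβ hE.last (hE.side_apply hr hlt hβ h01 hσ)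
    (hE.side_cases hr hlt hβ h01 hσ)
  -- The prescribed weights and the actual turns have the same sums over all components and regions,
  -- so they coincide.
  have h4 := hD.eq_zero (u := fun y => ((w y - turn r σ ν y : ℤ) : ℚ)) (fun y => by
    rw [← Int.cast_sum]
    norm_cast
    have h5 := hν y
    have h6 := h2 y
    have h7 : ∑ z with ν.SameCycle y z, (w z - turn r σ ν z) =
      ∑ z with ν.SameCycle y z, ((2 - turn r σ ν z) - (2 - w z)) :=
        Finset.sum_congr rfl fun _ _ => by ring
    rw [h7, Finset.sum_sub_distrib, h5, h6, sub_self]) (fun y => by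
    rw [← Int.cast_sum]
    norm_cast
    rw [Finset.sum_sub_distrib, hψ y, h3 y, sub_self]) y
  have h5 : w y - turn r σ ν y = 0 := by exact_mod_cast h4
  omega

end CyclicOrder

/-! ### Ranks of the glued disks and chains of touching edges -/

namespace AngledMap

open CyclicOrder

section GlueRank

variable {D : Type*} {M : AngledMap D} {pos : D → ℝ}
  {B : ∀ f : M.Face, M.FaceDart f × Bool → M.FaceDart f × Bool → Prop} {c : ℝ}

/-- `r` numbers the boundary points of the disk at `c` so that the edges that touch in a face are
consecutive. -/
structure IsGlueRank [Finite D] (hP : M.IsPlacement pos)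
    (B : ∀ f : M.Face, M.FaceDart f × Bool → M.FaceDart f × Bool → Prop) (c : ℝ)
    (r : M.DiskDart pos c → ℕ) : Prop where
  injective : Function.Injective r
  noncrossing : Noncrossing r (hP.diskPerm c)
  turn_eq : ∀ y, turn r (M.side pos c) (hP.diskPerm c) y = M.weight pos c y
  succ : ∀ d e : M.DiskDart pos c, M.FaceTouch pos B c d e → r e = r d + 1
  succ_left : ∀ a, M.Germ pos a c → ∀ d e : M.DiskDart pos c,
    M.FaceTouch pos B a (M.rev e) (M.rev d) → r e = r d + 1
  top : ∀ d e : M.DiskDart pos c, M.FaceTop pos B c d → M.ExitsRight pos c e → r e ≤ r d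
  top_left : ∀ a, M.Germ pos a c → ∀ d e : M.DiskDart pos c, M.FaceTop pos B a (M.rev d) →
    M.ExitsLeft pos c e → r d ≤ r e
  lt : ∀ d e : M.DiskDart pos c, M.ExitsRight pos c d → M.ExitsLeft pos c e → r d < r e

variable [Fintype D] (hP : M.IsPlacement pos) (hM : M.IsConsistent)
  (hB : ∀ f, M.IsFaceStack (M.eulerCycle f) Subtype.val pos (B f)) {f₀ : M.Face}
  (ho : ∀ d, d ∈ M.outer ↔ M.faceOf d = f₀)

include hM hB ho

/-- The single cycle gives a rank. The chains of touching edges then show that the right side ends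
at `t` and that the left side begins at `β t`. -/
theorem exists_isGlueRank (hc : M.Connected) (hcr : c ∈ Set.range pos) :
    ∃ r, M.IsGlueRank hP B c r := by
  classical
  obtain ⟨β, t, b, G, hy⟩ := exists_isGlue_sameCycle hP hM hB ho hc hcr
  obtain ⟨r, hr, hlt, hβ, hb, hn, hturn⟩ := exists_rank_turn_eq (ν := hP.diskPerm c) (β := β)
    (w := fun z => M.weight pos c z) (t := t) (b := b)
    (fun y => Eq.trans (Finset.sum_congr (by congr!) fun _ _ => rfl) (hP.sum_weight hM y))
    (fun y => Eq.trans (Finset.sum_congr (by congr!) fun _ _ => rfl)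
      ((G.sum_region y).trans (by congr!))) hy
  have hsucc : ∀ d e : M.DiskDart pos c, M.FaceTouch pos B c d e → r e = r d + 1 := by
    intro d e hde
    have h1 := hβ d
    rw [G.apply_eq d e hde, if_neg fun h => ?_] at h1
    · exact h1
    · obtain rfl : d = b := hr (by omega)
      exact G.not_touch _ hde
  have hsuccl : ∀ a, M.Germ pos a c → ∀ d e : M.DiskDart pos c,
      M.FaceTouch pos B a (M.rev e) (M.rev d) → r e = r d + 1 := by
    intro a ha d e hde
    have h1 := hβ d
    rw [G.apply_eq_left a ha d e hde, if_neg fun h => ?_] at h1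
    · exact h1
    · obtain rfl : d = b := hr (by omega)
      exact G.not_touch_left a ha _ hde
  -- Each touching edge above raises the rank by one, so the climb stops, and only at `t`.
  have hup : ∀ n, ∀ d : M.DiskDart pos c, M.ExitsRight pos c d → r d + n = Fintype.card
      (M.DiskDart pos c) → M.ExitsRight pos c t ∧ r d ≤ r t := by
    intro n
    induction n with
    | zero => exact fun d _ h => absurd h (hlt d).ne
    | succ n ih =>
      intro d hd h
      rcases exists_faceTouch_or_top hB hd with ⟨e, he⟩ | ht
      · have h1 := hsucc d ⟨e, Or.inl he.exitsRight_right⟩ he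
        obtain ⟨h2, h3⟩ := ih ⟨e, Or.inl he.exitsRight_right⟩ he.exitsRight_right (by omega)
        exact ⟨h2, by omega⟩
      · rw [← G.eq_of_top d ht]
        exact ⟨hd, le_rfl⟩
  have hup' : ∀ d : M.DiskDart pos c, M.ExitsRight pos c d → M.ExitsRight pos c t ∧ r d ≤ r t :=
    fun d hd => hup _ d hd (Nat.add_sub_cancel' (hlt d).le)
  have hdown : ∀ a, M.Germ pos a c → ∀ n, ∀ d : M.DiskDart pos c, M.ExitsLeft pos c d → r d = n →
      M.FaceTop pos B a (M.rev (β t)) ∧ r (β t) ≤ r d := by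
    intro a ha n
    induction n with
    | zero =>
      intro d hd h
      rcases exists_faceTouch_or_top hB ((ha _).1 hd) with ⟨e, he⟩ | ht
      · have hl : M.ExitsLeft pos c (M.rev e) := by
          rw [ha, M.rev_rev]
          exact he.exitsRight_right
        have h1 := hsuccl a ha ⟨M.rev e, Or.inr hl⟩ d (by rwa [M.rev_rev])
        omega
      · rw [← G.eq_apply a ha d ht]
        exact ⟨ht, le_rfl⟩
    | succ n ih =>
      intro d hd h
      rcases exists_faceTouch_or_top hB ((ha _).1 hd) with ⟨e, he⟩ | ht
      · have hl : M.ExitsLeft pos c (M.rev e) := by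
          rw [ha, M.rev_rev]
          exact he.exitsRight_right
        have h1 := hsuccl a ha ⟨M.rev e, Or.inr hl⟩ d (by rwa [M.rev_rev])
        obtain ⟨h2, h3⟩ := ih ⟨M.rev e, Or.inr hl⟩ hl (by omega)
        exact ⟨h2, by omega⟩
      · rw [← G.eq_apply a ha d ht]
        exact ⟨ht, le_rfl⟩
  -- If both sides are inhabited then `t ≠ b`, so `β t` comes right after `t`.
  have hlr : ∀ d e : M.DiskDart pos c, M.ExitsRight pos c d → M.ExitsLeft pos c e →
      r d < r e := by
    intro d e hd he
    obtain ⟨a, ha⟩ := exists_germ he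
    obtain ⟨h1, h2⟩ := hup' d hd
    obtain ⟨h3, h4⟩ := hdown a ha _ e he rfl
    have h5 := hβ t
    rw [if_neg fun h => G.ne a ha h1 _ h3 (hr (by omega))] at h5
    omega
  have h01 := side_eq_zero_or_one (M := M) (pos := pos) (c := c)
  have hE : IsExtremal r (M.side pos c) t b := by
    refine ⟨hb, fun y hy => side_eq_zero_iff.2 (hup' y (side_eq_zero_iff.1 hy)).1,
      fun y hy => (hup' y (side_eq_zero_iff.1 hy)).2, fun h => G.eq fun h' => h
        (side_eq_zero_iff.2 h')⟩
  refine ⟨r, hr, hn, hturn _ h01 (fun y z hy hz => ?_) hE, hsucc, hsuccl, fun d e hd he => ?_,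
    fun a ha d e hd he => ?_, hlr⟩
  · exact hlr y z (side_eq_zero_iff.1 hy) (z.2.resolve_left fun h' => by
      rw [← side_eq_zero_iff] at h'
      omega)
  · rw [G.eq_of_top d hd]
    exact (hup' e he).2
  · rw [G.eq_apply a ha d hd]
    exact (hdown a ha _ e he rfl).2

end GlueRank

section Chain

variable {D : Type*} {M : AngledMap D} {pos : D → ℝ}
  {B : ∀ f : M.Face, M.FaceDart f × Bool → M.FaceDart f × Bool → Prop} {c : ℝ}

theorem exitsRight_of_transGen_left {d e : D} (h : Relation.TransGen (M.FaceTouch pos B c) d e) :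
    M.ExitsRight pos c d := by
  induction h using Relation.TransGen.head_induction_on with
  | single h => exact h.exitsRight_left
  | head h _ _ => exact h.exitsRight_left

theorem exitsRight_of_transGen_right {d e : D} (h : Relation.TransGen (M.FaceTouch pos B c) d e) :
    M.ExitsRight pos c e := by
  induction h with
  | single h => exact h.exitsRight_right
  | tail _ h _ => exact h.exitsRight_right

variable [Finite D] {hP : M.IsPlacement pos}
  (hB : ∀ f, M.IsFaceStack (M.eulerCycle f) Subtype.val pos (B f))
  {r : M.DiskDart pos c → ℕ} (hr : M.IsGlueRank hP B c r)

include hB hr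

/-- A touch raises the rank by exactly one, and an edge that touches nothing above has the largest
rank on the right. Chains are thus intervals of ranks. -/
theorem IsGlueRank.transGen_iff {d e : M.DiskDart pos c} (hd : M.ExitsRight pos c d)
    (he : M.ExitsRight pos c e) : Relation.TransGen (M.FaceTouch pos B c) d e ↔ r d < r e := by
  constructor
  · intro h
    have key : ∀ y : D, Relation.TransGen (M.FaceTouch pos B c) d y →
        ∀ hy : M.Exits pos c y, r d < r ⟨y, hy⟩ := by
      intro y h
      induction h with
      | single h => exact fun hy => by have := hr.succ d ⟨_, hy⟩ h; omega
      | @tail x y _ h ih =>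
        intro hy
        have h1 := ih (Or.inl h.exitsRight_left)
        have h2 := hr.succ ⟨x, Or.inl h.exitsRight_left⟩ ⟨y, hy⟩ h
        omega
    exact key e h e.2
  · intro h
    obtain ⟨n, hn⟩ := Nat.exists_eq_add_of_lt h
    induction n generalizing d with
    | zero =>
      rcases exists_faceTouch_or_top hB hd with ⟨x, hx⟩ | ht
      · have h1 := hr.succ d ⟨x, Or.inl hx.exitsRight_right⟩ hx
        rw [← hr.injective (a₁ := ⟨x, Or.inl hx.exitsRight_right⟩) (a₂ := e) (by omega)]
        exact .single hx
      · have := hr.top d e ht he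
        omega
    | succ n ih =>
      rcases exists_faceTouch_or_top hB hd with ⟨x, hx⟩ | ht
      · have h1 := hr.succ d ⟨x, Or.inl hx.exitsRight_right⟩ hx
        exact .head hx (ih (d := ⟨x, Or.inl hx.exitsRight_right⟩) hx.exitsRight_right
          (by omega) (by omega))
      · have := hr.top d e ht he
        omega

theorem IsGlueRank.transGen_left_iff {a : ℝ} (ha : M.Germ pos a c) {d e : M.DiskDart pos c}
    (hd : M.ExitsLeft pos c d) (he : M.ExitsLeft pos c e) :
    Relation.TransGen (M.FaceTouch pos B a) (M.rev e) (M.rev d) ↔ r d < r e := by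
  have hl : ∀ {x}, M.ExitsRight pos a x → M.ExitsLeft pos c (M.rev x) := fun {x} hx => by
    rw [ha, M.rev_rev]
    exact hx
  constructor
  · intro h
    have key : ∀ y : D, Relation.TransGen (M.FaceTouch pos B a) (M.rev e) y →
        ∀ hy : M.Exits pos c (M.rev y), r ⟨M.rev y, hy⟩ < r e := by
      intro y h
      induction h with
      | single h => exact fun hy => by
                      have := hr.succ_left a ha ⟨_, hy⟩ e (by rwa [M.rev_rev]); omega
      | @tail x y _ h ih =>
        intro hy
        have h1 := ih (Or.inr (hl h.exitsRight_left))
        have h2 := hr.succ_left a ha ⟨_, hy⟩ ⟨M.rev x, Or.inr (hl h.exitsRight_left)⟩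
          (by rwa [M.rev_rev, M.rev_rev])
        omega
    have h1 := key _ h (by rw [M.rev_rev]; exact d.2)
    rwa [show (⟨M.rev (M.rev d), by rw [M.rev_rev]; exact d.2⟩ : M.DiskDart pos c) = d from
      Subtype.ext (M.rev_rev _)] at h1
  · intro h
    obtain ⟨n, hn⟩ := Nat.exists_eq_add_of_lt h
    induction n generalizing e with
    | zero =>
      rcases exists_faceTouch_or_top hB ((ha _).1 he) with ⟨x, hx⟩ | ht
      · have h1 := hr.succ_left a ha ⟨M.rev x, Or.inr (hl hx.exitsRight_right)⟩ e
          (by rwa [M.rev_rev])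
        rw [← hr.injective (a₁ := ⟨M.rev x, Or.inr (hl hx.exitsRight_right)⟩) (a₂ := d)
          (by omega), M.rev_rev]
        exact .single hx
      · have := hr.top_left a ha e d ht hd
        omega
    | succ n ih =>
      rcases exists_faceTouch_or_top hB ((ha _).1 he) with ⟨x, hx⟩ | ht
      · have h1 := hr.succ_left a ha ⟨M.rev x, Or.inr (hl hx.exitsRight_right)⟩ e
          (by rwa [M.rev_rev])
        have h2 := ih (e := ⟨M.rev x, Or.inr (hl hx.exitsRight_right)⟩) (hl hx.exitsRight_right)
          (by omega) (by omega)
        rw [M.rev_rev] at h2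
        exact .head hx h2
      · have := hr.top_left a ha e d ht hd
        omega

end Chain

end AngledMap

/-! ### The glued order and the folding that it defines -/

namespace AngledMap

open CyclicOrder

section GlueOrder

variable {D : Type*} {M : AngledMap D} {pos : D → ℝ}
  {B : ∀ f : M.Face, M.FaceDart f × Bool → M.FaceDart f × Bool → Prop} {c : ℝ}

/-- The edge `e` is reached from `d` upwards through touching edges over some interval. -/
def GlueBelow (M : AngledMap D) (pos : D → ℝ)
    (B : ∀ f : M.Face, M.FaceDart f × Bool → M.FaceDart f × Bool → Prop) (d e : D) : Prop :=
  ∃ c ∈ Set.range pos, Relation.TransGen (M.FaceTouch pos B c) d e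

variable [Finite D] (hP : M.IsPlacement pos)
  (hB : ∀ f, M.IsFaceStack (M.eulerCycle f) Subtype.val pos (B f))
  (hr : ∀ c ∈ Set.range pos, ∃ r, M.IsGlueRank hP B c r)

include hB hr

/-- Both edges pass through the disk at `b`. Its glued rank is noncrossing, so the order of their
ends on the left mirrors the order on the right. -/
theorem transGen_faceTouch_step {a b : ℝ} (hab : IsPathEdge pos a b) {d e : D} (hd : pos d ≤ a)
    (hd' : b < pos (M.rev d)) (he : pos e ≤ a) (he' : b < pos (M.rev e)) :
    Relation.TransGen (M.FaceTouch pos B a) d e ↔ Relation.TransGen (M.FaceTouch pos B b) d e := by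
  obtain ⟨r, hr⟩ := hr b hab.2.1
  have hR : ∀ x, pos x ≤ a → b < pos (M.rev x) → M.ExitsRight pos b x ∧
      M.ExitsLeft pos b (M.rev x) ∧ pos x ≠ b := fun x h1 h2 =>
    ⟨⟨h1.trans hab.2.2.1.le, h2⟩, ⟨h2.le, by rw [M.rev_rev]; exact h1.trans_lt hab.2.2.1⟩,
      (h1.trans_lt hab.2.2.1).ne⟩
  obtain ⟨d1, d2, d3⟩ := hR d hd hd'
  obtain ⟨e1, e2, e3⟩ := hR e he he'
  set x : M.DiskDart pos b := ⟨d, Or.inl d1⟩ with hx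
  set y : M.DiskDart pos b := ⟨e, Or.inl e1⟩ with hy
  have hx' : hP.diskPerm b x = ⟨M.rev d, Or.inr d2⟩ := Subtype.ext (hP.diskPerm_of_ne x d3)
  have hy' : hP.diskPerm b y = ⟨M.rev e, Or.inr e2⟩ := Subtype.ext (hP.diskPerm_of_ne y e3)
  have h1 := hr.transGen_iff hB (d := x) (e := y) d1 e1
  have h2 := hr.transGen_left_iff hB hab.germ (d := hP.diskPerm b y) (e := hP.diskPerm b x)
    (by rw [hy']; exact e2) (by rw [hx']; exact d2)
  have h2' : Relation.TransGen (M.FaceTouch pos B a) d e ↔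
      r (hP.diskPerm b y) < r (hP.diskPerm b x) := by
    rw [hx', hy'] at h2 ⊢
    simp only [M.rev_rev] at h2
    exact h2
  have h3 := hr.lt x (hP.diskPerm b x) d1 (by rw [hx']; exact d2)
  have h4 := hr.lt y (hP.diskPerm b x) e1 (by rw [hx']; exact d2)
  have h5 := hr.lt x (hP.diskPerm b y) d1 (by rw [hy']; exact e2)
  have h6 := hr.lt y (hP.diskPerm b y) e1 (by rw [hy']; exact e2)
  have h7 := hr.noncrossing x y
  have h8 := hr.noncrossing y x
  have h9 : r x = r y → r (hP.diskPerm b x) = r (hP.diskPerm b y) := fun h => by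
    rw [hr.injective h]
  rw [h2', show Relation.TransGen (M.FaceTouch pos B b) d e ↔ r x < r y from h1]
  unfold Arc at h7 h8
  omega

theorem transGen_faceTouch_iff {c₀ : ℝ} (h₀ : c₀ ∈ Set.range pos) (hc : c ∈ Set.range pos)
    (hle : c₀ ≤ c) {d e : D} (hd : pos d ≤ c₀) (hd' : c < pos (M.rev d)) (he : pos e ≤ c₀)
    (he' : c < pos (M.rev e)) : Relation.TransGen (M.FaceTouch pos B c) d e ↔
      Relation.TransGen (M.FaceTouch pos B c₀) d e :=
  path_induction (pos := pos) (p := fun c => Relation.TransGen (M.FaceTouch pos B c) d e ↔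
      Relation.TransGen (M.FaceTouch pos B c₀) d e) h₀ Iff.rfl
    (fun _ _ hab ha hb ih => (transGen_faceTouch_step hP hB hr hab (hd.trans ha)
      (hb.trans_lt hd') (he.trans ha) (hb.trans_lt he')).symm.trans ih) hc hle le_rfl

theorem glueBelow_iff (hc : c ∈ Set.range pos) {d e : D} (hd : M.ExitsRight pos c d)
    (he : M.ExitsRight pos c e) :
    M.GlueBelow pos B d e ↔ Relation.TransGen (M.FaceTouch pos B c) d e := by
  refine ⟨?_, fun h => ⟨c, hc, h⟩⟩
  rintro ⟨c', hc', h⟩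
  have hd' := exitsRight_of_transGen_left h
  have he' := exitsRight_of_transGen_right h
  -- The larger of the two left ends is the first point where both edges are present; both chains
  -- are moved there.
  obtain ⟨m, hm, h1, h2, h3⟩ : ∃ m ∈ Set.range pos, pos d ≤ m ∧ pos e ≤ m ∧
      ∀ c, pos d ≤ c → pos e ≤ c → m ≤ c := by
    rcases le_total (pos d) (pos e) with h | h
    · exact ⟨_, ⟨e, rfl⟩, h, le_rfl, fun _ _ h => h⟩
    · exact ⟨_, ⟨d, rfl⟩, le_rfl, h, fun _ h _ => h⟩
  rw [transGen_faceTouch_iff hP hB hr hm hc' (h3 _ hd'.1 he'.1) h1 hd'.2 h2 he'.2] at h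
  rwa [transGen_faceTouch_iff hP hB hr hm hc (h3 _ hd.1 he.1) h1 hd.2 h2 he.2]

theorem IsGlueRank.glueBelow_iff_lt {r : M.DiskDart pos c → ℕ} (h : M.IsGlueRank hP B c r)
    (hc : c ∈ Set.range pos) (d e : M.DiskDart pos c) (hd : M.ExitsRight pos c d)
    (he : M.ExitsRight pos c e) : M.GlueBelow pos B d e ↔ r d < r e := by
  rw [glueBelow_iff hP hB hr hc hd he, h.transGen_iff hB hd he]

theorem isStack_glueBelow : M.IsStack pos (M.GlueBelow pos B) where
  irrefl d := by
    rintro ⟨c, hc, h⟩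
    obtain ⟨r, hr⟩ := hr c hc
    have hd := exitsRight_of_transGen_left h
    have := (hr.transGen_iff hB (d := ⟨d, Or.inl hd⟩) (e := ⟨d, Or.inl hd⟩) hd hd).1 h
    omega
  trans := by
    intro c d e g hd he hg h1 h2
    obtain ⟨a, b, hab, ha, hb, -⟩ := exists_isPathEdge_right hd.1 hd.2
    rw [hab.exitsRight_iff ha hb] at hd he hg
    rw [glueBelow_iff hP hB hr hab.1 hd he] at h1
    rw [glueBelow_iff hP hB hr hab.1 he hg] at h2
    rw [glueBelow_iff hP hB hr hab.1 hd hg]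
    exact h1.trans h2
  total := by
    intro c d e hd he hne
    obtain ⟨a, b, hab, ha, hb, -⟩ := exists_isPathEdge_right hd.1 hd.2
    rw [hab.exitsRight_iff ha hb] at hd he
    obtain ⟨r, h⟩ := hr a hab.1
    rw [h.glueBelow_iff_lt hP hB hr hab.1 ⟨d, Or.inl hd⟩ ⟨e, Or.inl he⟩ hd he,
      h.glueBelow_iff_lt hP hB hr hab.1 ⟨e, Or.inl he⟩ ⟨d, Or.inl hd⟩ he hd]
    have := h.injective.ne (a₁ := ⟨d, Or.inl hd⟩) (a₂ := ⟨e, Or.inl he⟩)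
      (fun h => hne (congrArg Subtype.val h))
    omega

theorem IsGlueRank.diskRank_lt_iff {r : M.DiskDart pos c → ℕ} (h : M.IsGlueRank hP B c r)
    (hc : c ∈ Set.range pos) (d e : M.DiskDart pos c) :
    M.diskRank pos (M.GlueBelow pos B) c d < M.diskRank pos (M.GlueBelow pos B) c e ↔
      r d < r e := by
  rw [(isStack_glueBelow hP hB hr).diskRank_lt_iff]
  rcases d.2 with hd | hd <;> rcases e.2 with he | he
  · rw [prec_right_iff hd he, h.glueBelow_iff_lt hP hB hr hc _ _ hd he]
  · exact iff_of_true (Or.inl ⟨hd, he⟩) (h.lt _ _ hd he)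
  · exact iff_of_false (not_prec_left_right hd he) (h.lt _ _ he hd).not_gt
  · rw [prec_left_iff hd he]
    obtain ⟨a, b, hab, h1, h2, h3⟩ := exists_isPathEdge_left hd.2 hd.1
    obtain rfl := h3 hc
    rw [← h.transGen_left_iff hB hab.germ hd he,
      glueBelow_iff hP hB hr hab.1 ((hab.germ _).1 he) ((hab.germ _).1 hd)]

theorem touch_glueBelow_iff (hc : c ∈ Set.range pos) {d e : D} :
    M.Touch pos (M.GlueBelow pos B) c d e ↔ M.FaceTouch pos B c d e := by
  obtain ⟨r, h⟩ := hr c hc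
  constructor
  · rintro ⟨hd, he, hde, hn⟩
    rw [glueBelow_iff hP hB hr hc hd he, Relation.TransGen.head'_iff] at hde
    obtain ⟨x, hdx, hxe⟩ := hde
    rcases Relation.reflTransGen_iff_eq_or_transGen.1 hxe with rfl | hxe
    · exact hdx
    · exact absurd ⟨⟨c, hc, .single hdx⟩, ⟨c, hc, hxe⟩⟩ (hn x hdx.exitsRight_right)
  · intro hde
    refine ⟨hde.exitsRight_left, hde.exitsRight_right, ⟨c, hc, .single hde⟩, fun g hg hdg => ?_⟩
    rw [h.glueBelow_iff_lt hP hB hr hc ⟨d, Or.inl hde.exitsRight_left⟩ ⟨g, Or.inl hg⟩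
      hde.exitsRight_left hg,
      h.glueBelow_iff_lt hP hB hr hc ⟨g, Or.inl hg⟩ ⟨e, Or.inl hde.exitsRight_right⟩ hg
      hde.exitsRight_right] at hdg
    have := h.succ ⟨d, Or.inl hde.exitsRight_left⟩ ⟨e, Or.inl hde.exitsRight_right⟩ hde
    omega

end GlueOrder

section Glue

variable {D : Type*} {M : AngledMap D} {pos : D → ℝ}

theorem FlatFolding.mem_touching_iff_exists [Finite D] (F : M.FlatFolding) {d e : D} :
    s(d, e) ∈ F.touching ↔ ∃ c, M.Touch F.pos F.below c d (M.rev e) ∨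
      M.Touch F.pos F.below c e (M.rev d) := by
  have key : ∀ c x y, M.Touch F.pos F.below c x y → ∃ a ∈ Set.range F.pos,
      M.Touch F.pos F.below a x y := by
    intro c x y h
    obtain ⟨a, b, hab, ha, hb, -⟩ := exists_isPathEdge_right h.1.1 h.1.2
    exact ⟨a, hab.1, (hab.touch_iff ha hb _ _).1 h⟩
  rw [F.mem_touching_iff]
  constructor
  · rintro ⟨c, -, h⟩
    exact ⟨c, h⟩
  · rintro ⟨c, h | h⟩
    · obtain ⟨a, ha, h⟩ := key _ _ _ h
      exact ⟨a, ha, Or.inl h⟩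
    · obtain ⟨a, ha, h⟩ := key _ _ _ h
      exact ⟨a, ha, Or.inr h⟩

/-- Flat foldings of the cycles of all faces over a common placement are the faces of a flat
folding. -/
theorem exists_flatFolding_of_faces [Fintype D] (hc : M.Connected) (hM : M.IsConsistent)
    (hP : M.IsPlacement pos) {f₀ : M.Face} (ho : ∀ d, d ∈ M.outer ↔ M.faceOf d = f₀)
    (Φ : ∀ f, (M.eulerCycle f).FlatFolding) (hΦ : ∀ f, (Φ f).pos = M.tourPos pos f) :
    ∃ F : M.FlatFolding, F.pos = pos ∧ ∀ f (s : Sym2 (M.FaceDart f)),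
      s.map Subtype.val ∈ F.touching ↔ s ∈ M.internalPattern f (Φ f) := by
  set B : ∀ f : M.Face, M.FaceDart f × Bool → M.FaceDart f × Bool → Prop :=
    fun f => (Φ f).below with hBdef
  have hB : ∀ f, M.IsFaceStack (M.eulerCycle f) Subtype.val pos (B f) := fun f =>
    (eulerCycle_isFaceCycle f).isFaceStack (Φ f) (hΦ f)
  have hr : ∀ c ∈ Set.range pos, ∃ r, M.IsGlueRank hP B c r := fun c hcr =>
    exists_isGlueRank hP hM hB ho hc hcr
  have hS := isStack_glueBelow hP hB hr
  have hlt := fun (c : ℝ) (hc : c ∈ Set.range pos) r (h : M.IsGlueRank hP B c r) =>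
    h.diskRank_lt_iff hP hB hr hc
  have planar : ∀ c ∈ Set.range pos,
      Noncrossing (M.diskRank pos (M.GlueBelow pos B) c) (hP.diskPerm c) := by
    intro c hc
    obtain ⟨r, h⟩ := hr c hc
    unfold Noncrossing Arc
    simp only [hlt c hc r h]
    exact h.noncrossing
  have angle : ∀ d, (M.angle d : ℤ) = 180 * (2 - turn (M.diskRank pos (M.GlueBelow pos B) (pos d))
      (M.side pos (pos d)) (hP.diskPerm (pos d)) ⟨d, hP.exits_self d⟩) := by
    intro d
    obtain ⟨r, h⟩ := hr (pos d) ⟨d, rfl⟩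
    have h1 := h.turn_eq ⟨d, hP.exits_self d⟩
    unfold turn at h1 ⊢
    simp only [hlt _ ⟨d, rfl⟩ r h]
    rw [h1]
    exact IsPlacement.weight_of_eq hM.angle_mem rfl
  have bottom : ∀ c ∈ Set.range pos, ∀ d, M.ExitsRight pos c d →
      (∀ e, M.ExitsRight pos c e → ¬ M.GlueBelow pos B e d) → M.rev d ∈ M.outer := by
    intro c hc d hd hn
    refine (exists_faceTouch_or_bottom hB hd).resolve_left ?_
    rintro ⟨e, he⟩
    exact hn e he.exitsRight_left ⟨c, hc, .single he⟩
  have top : ∀ c ∈ Set.range pos, ∀ d, M.ExitsRight pos c d →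
      (∀ e, M.ExitsRight pos c e → ¬ M.GlueBelow pos B d e) → d ∈ M.outer := by
    intro c hc d hd hn
    rcases exists_faceTouch_or_top hB hd with ⟨e, he⟩ | ⟨f, hf, ht, -⟩
    · exact absurd ⟨c, hc, .single he⟩ (hn e he.exitsRight_right)
    · exact ht
  refine ⟨.ofStack hP hS planar angle bottom top, rfl, fun f s => ?_⟩
  have hT : ∀ c ∈ Set.range pos, ∀ d e, M.Touch pos
      (FlatFolding.ofStack hP hS planar angle bottom top).below c d e ↔
      M.FaceTouch pos B c d e := by
    intro c hc d e
    rw [← touch_glueBelow_iff hP hB hr hc]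
    unfold Touch
    refine and_congr_right fun hd => and_congr_right fun he => ?_
    have hb : ∀ x y, M.ExitsRight pos c x → M.ExitsRight pos c y →
        ((FlatFolding.ofStack hP hS planar angle bottom top).below x y ↔
          M.GlueBelow pos B x y) := fun x y hx hy => by
      rw [FlatFolding.ofStack_below]
      exact and_iff_left ⟨c, hx, hy⟩
    rw [hb d e hd he]
    exact and_congr_right fun _ => forall_congr' fun g => imp_congr_right fun hg => by
      rw [hb d g hd hg, hb g e hg he]
  have hF : ∀ c (x y : M.FaceDart f), M.FaceTouch pos B c x (M.rev y) ↔
      (M.eulerCycle f).Touch (Φ f).pos (Φ f).below c (x, false)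
        ((M.eulerCycle f).rev (y, false)) := by
    intro c x y
    rw [hΦ]
    have hy : M.faceOf (M.rev (M.rev (y : D))) = f := by rw [M.rev_rev]; exact y.2
    have h1 : (⟨M.rev (M.rev (y : D)), hy⟩ : M.FaceDart f) = y := Subtype.ext (M.rev_rev _)
    constructor
    · rintro ⟨g, hx, hy', h⟩
      obtain rfl : f = g := x.2.symm.trans hx
      rw [h1] at h
      exact h
    · intro h
      refine ⟨f, x.2, hy, ?_⟩
      rw [h1]
      exact h
  induction s using Sym2.ind with
  | _ x y =>
    change s((x : D), (y : D)) ∈ _ ↔ s((x, false), (y, false)) ∈ (Φ f).touching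
    rw [FlatFolding.mem_touching_iff, FlatFolding.mem_touching_iff_exists]
    simp only [← hF]
    constructor
    · rintro ⟨c, hc, h⟩
      exact ⟨c, h.imp (hT c hc _ _).1 (hT c hc _ _).1⟩
    -- The glued order is controlled at vertices of the graph, so the point is moved to the left end
    -- of its path edge.
    · have key : ∀ c x y, M.FaceTouch pos B c x y →
          ∃ a ∈ Set.range pos, M.FaceTouch pos B a x y := by
        intro c x y h
        obtain ⟨a, b, hab, ha, hb, -⟩ :=
          exists_isPathEdge_right h.exitsRight_left.1 h.exitsRight_left.2
        exact ⟨a, hab.1, (hab.faceTouch_iff ha hb _ _).1 h⟩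
      rintro ⟨c, h | h⟩
      · obtain ⟨a, ha, h⟩ := key _ _ _ h
        exact ⟨a, ha, Or.inl ((hT a ha _ _).2 h)⟩
      · obtain ⟨a, ha, h⟩ := key _ _ _ h
        exact ⟨a, ha, Or.inr ((hT a ha _ _).2 h)⟩

end Glue

end AngledMap

/-! ### Exactness on the sphere and the common placement -/

namespace AngledMap

open CyclicOrder

section Exact

variable {D : Type*} {M : AngledMap D} {K : Type*} [Field K]

theorem IsPlane.transitive (h : M.IsPlane) : Transitive M.rot M.faceNext := by
  intro x y
  set R : D → D → Prop := fun a b => b = M.rot a ∨ b = M.faceNext a with hR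
  have h1 : ∀ x, Relation.EqvGen R x (M.rot x) := fun x => .rel _ _ (Or.inl rfl)
  have h2 : ∀ x, Relation.EqvGen R x (M.faceNext x) := fun x => .rel _ _ (Or.inr rfl)
  have h3 : ∀ x, Relation.EqvGen R x (M.rev x) := fun x => by
    rw [← M.rot_faceNext x]
    exact (h2 x).trans _ _ _ (h1 _)
  induction h.connected x y with
  | rel x y hxy =>
    rcases hxy with rfl | rfl
    · exact h1 x
    · exact h3 x
  | refl => exact .refl _
  | symm _ _ _ ih => exact ih.symm _ _
  | trans _ _ _ _ _ ih1 ih2 => exact ih1.trans _ _ _ ih2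

theorem card_eq_two_mul_card_edge [Finite D] : Nat.card D = 2 * Nat.card M.Edge := by
  classical
  have : Fintype D := Fintype.ofFinite D
  have : Fintype (Orbits M.rev) := Fintype.ofFinite _
  have h1 := sum_orbits M.rev (fun _ => 1)
  have h2 : ∀ d : D, ∑ z with M.rev.SameCycle d z, 1 = 2 := by
    intro d
    have h3 : (Finset.univ.filter fun z => M.rev.SameCycle d z) = {d, M.rev d} := by
      ext z
      simp only [Finset.mem_filter, Finset.mem_univ, true_and, Finset.mem_insert,
        Finset.mem_singleton]
      constructor
      · intro hz
        refine mem_of_sameCycle (S := {z | z = d ∨ z = M.rev d}) ?_ (Or.inl rfl) hz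
        rintro x (rfl | rfl)
        · exact Or.inr rfl
        · exact Or.inl (M.rev_rev _)
      · rintro (rfl | rfl)
        · exact .refl _ _
        · exact Equiv.Perm.sameCycle_apply_right.2 (.refl _ _)
    rw [h3, Finset.sum_pair (M.rev_ne d).symm]
  have h4 : ∑ q : Orbits M.rev, ∑ z with M.rev.SameCycle q.out z, 1 = ∑ q : Orbits M.rev, 2 :=
    Finset.sum_congr rfl fun q _ => (Finset.sum_congr (by congr!) fun _ _ => rfl).trans (h2 q.out)
  rw [h4] at h1
  simp only [Finset.sum_const, Finset.card_univ, smul_eq_mul, mul_one] at h1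
  rw [Nat.card_eq_fintype_card, ← h1, mul_comm, ← Nat.card_eq_fintype_card]
  rfl

open Classical in
/-- Exactness in the middle of the cellular complex of the sphere. -/
theorem IsPlane.exists_coboundary [Fintype D] (h : M.IsPlane) {u : D → K}
    (hu : ∀ d, ∑ z with M.rot.SameCycle d z, u z = 0)
    (hu' : ∀ d, ∑ z with M.faceNext.SameCycle d z, u z = 0) :
    ∃ t : D → K, (∀ d, t (M.rev d) = t d) ∧ ∀ d, t (M.rot d) = t d + u d := by
  have : Fintype (Orbits M.rev) := Fintype.ofFinite _
  have hmk : ∀ (π : Equiv.Perm D) (d : D), (Quotient.mk _ (π d) : Orbits π) = Quotient.mk _ d :=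
    fun π d => Quotient.sound (s := Equiv.Perm.SameCycle.setoid π)
      (Equiv.Perm.sameCycle_apply_left.2 (.refl _ _))
  let δ : (Orbits M.rev → K) →ₗ[K] (D → K) :=
    { toFun := fun τ d => τ (Quotient.mk _ (M.rot d)) - τ (Quotient.mk _ d)
      map_add' := fun _ _ => by ext; simp; ring
      map_smul' := fun _ _ => by ext; simp; ring }
  let W := LinearMap.range (incidence K M.rot M.faceNext)
  -- The field will be `ZMod 2` as well as the reals, so only nondegeneracy of the dot product is
  -- available, and the argument counts dimensions.
  let β : LinearMap.BilinForm K (D → K) := dotProductBilin K K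
  have hβ : β.Nondegenerate := by
    refine ⟨fun v hv => (dotProduct_eq_zero_iff (v := v)).1 hv, fun v hv =>
      (dotProduct_eq_zero_iff (v := v)).1 fun w => ?_⟩
    rw [dotProduct_comm]
    exact hv w
  -- This is where Euler's formula enters: vertices plus faces minus 1 equals edges plus 1.
  have hW : Nat.card M.Edge + 1 ≤ Module.finrank K W := by
    have h1 : Nat.card M.Vertex + Nat.card M.Face ≤ Module.finrank K W + 1 :=
      finrank_range_incidence (K := K) h.transitive
    have := h.euler
    omega
  have hort : Module.finrank K (β.orthogonal W) = Nat.card D - Module.finrank K W := by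
    rw [LinearMap.BilinForm.finrank_orthogonal hβ, Module.finrank_pi, Nat.card_eq_fintype_card]
  have hker : Module.finrank K (LinearMap.ker δ) ≤ 1 := by
    have h2 : LinearMap.ker δ ≤ Submodule.span K {fun _ => 1} := by
      intro τ hτ
      rw [LinearMap.mem_ker] at hτ
      have h3 : ∀ d, τ (Quotient.mk _ (M.rot d)) = τ (Quotient.mk _ d) := fun d =>
        sub_eq_zero.1 (congrFun hτ d)
      rw [Submodule.mem_span_singleton]
      rcases isEmpty_or_nonempty D with hD | ⟨⟨d0⟩⟩
      · exact ⟨0, funext fun q => q.inductionOn fun y => hD.elim y⟩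
      · refine ⟨τ (Quotient.mk _ d0), funext fun q => q.inductionOn fun d => ?_⟩
        have := Connected.eq_of_invariant (M := M) h.connected
          (s := fun d => τ (Quotient.mk _ d)) h3 (fun d => congrArg τ (hmk _ d)) d d0
        simp [this]
    exact (Submodule.finrank_mono h2).trans ((finrank_span_le_card _).trans (by simp))
  have hrange := LinearMap.finrank_range_add_finrank_ker δ
  rw [Module.finrank_pi] at hrange
  have hE : Fintype.card (Orbits M.rev) = Nat.card M.Edge := Nat.card_eq_fintype_card.symm
  have hD := card_eq_two_mul_card_edge (M := M)
  have hle : LinearMap.range δ ≤ β.orthogonal W := by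
    rintro _ ⟨τ, rfl⟩
    rw [LinearMap.BilinForm.mem_orthogonal_iff]
    rintro _ ⟨⟨φ, χ⟩, rfl⟩
    change ∑ d, (φ (Quotient.mk _ d) - χ (Quotient.mk _ d)) *
      (τ (Quotient.mk _ (M.rot d)) - τ (Quotient.mk _ d)) = 0
    have h3 : ∑ d, φ (Quotient.mk _ d) * τ (Quotient.mk _ (M.rot d)) =
        ∑ d, φ (Quotient.mk _ d) * τ (Quotient.mk _ d) := by
      rw [← Equiv.sum_comp M.rot fun d => φ (Quotient.mk _ d) * τ (Quotient.mk _ d)]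
      exact Finset.sum_congr rfl fun d _ => by rw [hmk M.rot]
    have h4 : ∑ d, χ (Quotient.mk _ d) * τ (Quotient.mk _ (M.rot d)) =
        ∑ d, χ (Quotient.mk _ d) * τ (Quotient.mk _ d) := by
      rw [← Equiv.sum_comp M.faceNext fun d => χ (Quotient.mk _ d) * τ (Quotient.mk _ (M.rot d))]
      exact Finset.sum_congr rfl fun d _ => by rw [hmk M.faceNext, M.rot_faceNext, hmk M.rev]
    simp only [sub_mul, mul_sub, Finset.sum_sub_distrib, h3, h4, sub_self]
  -- The range of `δ` has dimension at least the number of edges minus 1, and the orthogonal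
  -- complement of `W` has at most that dimension.
  have heq : LinearMap.range δ = β.orthogonal W :=
    Submodule.eq_of_le_of_finrank_le hle (by omega)
  have hmem : u ∈ LinearMap.range δ := by
    rw [heq, LinearMap.BilinForm.mem_orthogonal_iff]
    rintro _ ⟨⟨φ, χ⟩, rfl⟩
    change ∑ d, (φ (Quotient.mk _ d) - χ (Quotient.mk _ d)) * u d = 0
    have h3 := sum_mul_invariant (φ := fun d => φ (Quotient.mk _ d))
      (fun d => congrArg φ (hmk M.rot d)) hu
    have h4 := sum_mul_invariant (φ := fun d => χ (Quotient.mk _ d))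
      (fun d => congrArg χ (hmk M.faceNext d)) hu'
    simp only [mul_comm (u _)] at h3 h4
    rw [← sub_eq_zero.2 (h3.trans h4.symm), ← Finset.sum_sub_distrib]
    exact Finset.sum_congr rfl fun d _ => by ring
  obtain ⟨τ, rfl⟩ := hmem
  exact ⟨fun d => τ (Quotient.mk _ d), fun d => congrArg τ (hmk M.rev d), fun d =>
    (add_sub_cancel _ _).symm⟩

open Classical in
/-- A function with prescribed differences exists if it exists around every vertex and along
every face. -/
theorem IsPlane.exists_potential [Fintype D] (h : M.IsPlane) {ρ α g : D → K}
    (hρ : ∀ d, ρ (M.rev d) = -ρ d) (hα : ∀ d, ∑ z with M.rot.SameCycle d z, α z = 0)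
    (hg : ∀ d, g (M.faceNext d) + α (M.faceNext d) = g d + ρ d) :
    ∃ s : D → K, (∀ d, s (M.rev d) = s d + ρ d) ∧ ∀ d, s (M.rot d) = s d + α d := by
  -- First satisfy only the condition on edges, by choosing one dart per edge. The error around
  -- vertices is then corrected by a function of the edges.
  obtain ⟨s₀, hs₀⟩ : ∃ s₀ : D → K, ∀ d, s₀ (M.rev d) = s₀ d + ρ d := by
    let o : D → D := fun d => (Quotient.mk (Equiv.Perm.SameCycle.setoid M.rev) d).out
    have ho : ∀ d, o (M.rev d) = o d := fun d => congrArg Quotient.out (Quotient.sound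
      (s := Equiv.Perm.SameCycle.setoid M.rev) (Equiv.Perm.sameCycle_apply_left.2 (.refl _ _)))
    have ho' : ∀ d, d = o d ∨ d = M.rev (o d) := fun d => by
      have h1 : M.rev.SameCycle (o d) d :=
        Quotient.exact (s := Equiv.Perm.SameCycle.setoid M.rev) (Quotient.out_eq _)
      refine mem_of_sameCycle (S := {z | z = o d ∨ z = M.rev (o d)}) ?_ (Or.inl rfl) h1
      rintro x (hx | hx)
      · exact Or.inr (congrArg _ hx)
      · exact Or.inl (by rw [hx, M.rev_rev])
    refine ⟨fun d => if d = o d then 0 else ρ (o d), fun d => ?_⟩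
    have h2 := M.rev_ne (o d)
    simp only [ho]
    rcases ho' d with h1 | h1
    · have h3 : M.rev d ≠ o d := fun h => M.rev_ne d (h.trans h1.symm)
      rw [if_neg h3, if_pos h1, ← h1, zero_add]
    · have h3 : M.rev d = o d := (congrArg M.rev h1).trans (M.rev_rev _)
      have h4 : d ≠ o d := fun h => h2 (h1.symm.trans h)
      rw [if_pos h3, if_neg h4, ← h3, hρ, neg_add_cancel]
  obtain ⟨t, h1, h2⟩ := h.exists_coboundary (u := fun d => α d + s₀ d - s₀ (M.rot d))
    (fun d => by
      rw [Finset.sum_sub_distrib, Finset.sum_add_distrib, hα, sum_sameCycle_comp M.rot d s₀]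
      ring)
    (fun d => by
      rw [← sum_sameCycle_comp]
      -- Along a face the error is the difference of consecutive values of `s₀ - g`, so it
      -- telescopes.
      have h3 : ∀ z, α (M.faceNext z) + s₀ (M.faceNext z) - s₀ (M.rot (M.faceNext z)) =
          (s₀ (M.faceNext z) - g (M.faceNext z)) - (s₀ z - g z) := fun z => by
        rw [M.rot_faceNext, hs₀]
        linear_combination hg z
      simp only [h3]
      rw [Finset.sum_sub_distrib, sum_sameCycle_comp M.faceNext d fun z => s₀ z - g z, sub_self])
  refine ⟨fun d => t d + s₀ d, fun d => ?_, fun d => ?_⟩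
  · change t _ + s₀ _ = t d + s₀ d + ρ d
    rw [h1, hs₀]
    ring
  · change t _ + s₀ _ = t d + s₀ d + α d
    rw [h2]
    ring

end Exact

section Place

variable {D : Type*} {M : AngledMap D} [Fintype D]

/-- If the cycles of all faces are flat-foldable, then the graph has a placement in which exactly
the angles of `180` degrees change the direction. -/
theorem IsPlane.exists_placement (h : M.IsPlane) (hM : M.IsConsistent)
    (hF : ∀ f, (M.eulerCycle f).FlatFoldable) : ∃ pos, M.IsPlacement pos ∧
      ∀ d, M.angle d ≠ 180 ↔
        (pos d < pos (M.rev d) ↔ pos (M.rot d) < pos (M.rev (M.rot d))) := by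
  classical
  -- `P` and `Q` are the positions of the start and the end of a dart in the folding of the cycle of
  -- its left face. They are unrelated between different faces.
  obtain ⟨P, Q, h1, h2, h3⟩ : ∃ P Q : D → ℝ, (∀ d, P (M.faceNext d) = Q d) ∧
      (∀ d, |Q d - P d| = M.len d) ∧ ∀ d, M.angle (M.faceNext d) ≠ 180 ↔
        (P (M.faceNext d) < Q (M.faceNext d) ↔ Q d < P d) := by
    let Φ := fun f => (hF f).some
    let R : Bool → D → ℝ := fun b d => (Φ (M.faceOf d)).pos (⟨d, rfl⟩, b)
    have hR : ∀ b f (x : M.FaceDart f), R b x = (Φ f).pos (x, b) := by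
      rintro b f ⟨d, rfl⟩
      rfl
    have hnext : ∀ b d, R b (M.faceNext d) =
        (Φ (M.faceOf d)).pos (M.tourNext (M.faceOf d) ⟨d, rfl⟩, b) := fun b d =>
      hR b _ (M.tourNext (M.faceOf d) ⟨d, rfl⟩)
    refine ⟨R false, R true, fun d => ?_, fun d => ?_, fun d => ?_⟩
    · rw [hnext]
      exact (Φ _).pos_rot (⟨d, rfl⟩, true)
    · exact (Φ _).abs_pos (⟨d, rfl⟩, false)
    · rw [hnext, hnext]
      have h4 := (Φ _).foldedAngle_eq_180_iff (M.tourNext (M.faceOf d) ⟨d, rfl⟩, false)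
      have h5 : (M.eulerCycle (M.faceOf d)).rot (M.tourNext (M.faceOf d) ⟨d, rfl⟩, false) =
          (⟨d, rfl⟩, true) := by
        rw [(eulerCycle_isFaceCycle _).rot_false, Equiv.Perm.inv_eq_iff_eq.2 rfl]
      rw [h5] at h4
      exact h4
  have hne : ∀ d, Q d ≠ P d := fun d h => by
    have := h2 d
    rw [h, sub_self, abs_zero] at this
    exact (M.len_pos d).ne this
  have h01 : ∀ x : ZMod 2, x = 0 ∨ x = 1 := by decide
  have h11 : (1 : ZMod 2) + 1 = 0 := by decide
  set α : D → ZMod 2 := fun d => if M.angle d = 180 then 1 else 0 with hαdef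
  set g : D → ZMod 2 := fun d => if P d < Q d then 0 else 1 with hgdef
  have hg : ∀ d, g (M.faceNext d) + α (M.faceNext d) = g d + 1 := by
    intro d
    have key : ∀ a p q : Prop, (¬ a ↔ (p ↔ ¬ q)) → ((if p then 0 else 1 : ZMod 2) +
        (if a then 1 else 0) = (if q then 0 else 1) + 1) := by
      intro a p q h
      by_cases ha : a <;> by_cases hp : p <;> by_cases hq : q <;> simp_all
    have h4 := key _ _ _ ((h3 d).trans (iff_congr Iff.rfl
      ⟨fun h => h.not_gt, fun h => lt_of_le_of_ne (not_lt.1 h) (hne d)⟩))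
    simp only [hgdef, hαdef]
    convert h4
  -- The direction of the darts, modulo 2: reversal flips it and a corner flips it exactly at 180
  -- degrees. Around a vertex the number of such corners is even because the angles sum to 360;
  -- along a face the cycle provides a solution.
  obtain ⟨s, hs, hs'⟩ := h.exists_potential (K := ZMod 2) (ρ := fun _ => 1) (α := α) (g := g)
    (fun _ => by decide) (fun d => by
      have h4 : ∀ z, α z = ((M.angle z / 180 : ℕ) : ZMod 2) := fun z => by
        simp only [hαdef]
        rcases hM.angle_mem z with h | h | h <;> rw [h] <;> decide
      simp only [h4]
      rw [← Nat.cast_sum]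
      have h5 := hM.angle_sum d
      have h6 : ∑ z with M.rot.SameCycle d z, M.angle z =
          ∑ z with M.rot.SameCycle d z, 180 * (M.angle z / 180) := by
        refine Finset.sum_congr rfl fun z _ => ?_
        rcases hM.angle_mem z with h | h | h <;> rw [h]
      have h7 : ∑ z with M.rot.SameCycle d z, 180 * (M.angle z / 180) = 360 :=
        h6.symm.trans (Eq.trans (Finset.sum_congr (by congr!) fun _ _ => rfl) h5)
      rw [← Finset.mul_sum] at h7
      rw [show ∑ z with M.rot.SameCycle d z, M.angle z / 180 = 2 by omega]
      decide) hg
  set σ : D → ℝ := fun d => if s d = 0 then 1 else -1 with hσdef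
  -- This sign says whether the folding of the cycle must be reflected to match the chosen
  -- directions; it is constant along a face.
  set κ : D → ℝ := fun d => if s d = g d then 1 else -1 with hκdef
  have hκ : ∀ d, κ (M.faceNext d) = κ d := by
    intro d
    have h4 := hs' (M.faceNext d)
    rw [M.rot_faceNext, hs] at h4
    have h5 : s (M.faceNext d) = g (M.faceNext d) ↔ s d = g d := by
      rw [← add_left_inj (α (M.faceNext d)), ← h4, hg, add_left_inj]
    simp only [hκdef, h5]
  have hσ : ∀ d, κ d * Q d = κ d * P d + σ d * M.len d := by
    intro d
    rw [← h2]
    simp only [hκdef, hσdef, hgdef]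
    rcases (hne d).lt_or_gt with hq | hq
    · rw [abs_of_neg (sub_neg.2 hq), if_neg hq.not_gt]
      rcases h01 (s d) with h | h
      · rw [h]
        norm_num
        ring
      · rw [h]
        norm_num
    · rw [abs_of_pos (sub_pos.2 hq), if_pos hq]
      rcases h01 (s d) with h | h
      · rw [h]
        norm_num
      · rw [h]
        norm_num
        ring
  -- Now that the directions are fixed, the signed lengths close up along every face, as the
  -- reflected cycles show.
  obtain ⟨pos, hp, hp'⟩ := h.exists_potential (ρ := fun d => σ d * M.len d) (α := fun _ => 0)
    (g := fun d => κ d * P d)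
    (fun d => by
      simp only [hσdef, M.len_rev, hs]
      rcases h01 (s d) with h | h
      · rw [h, if_neg (by decide), if_pos rfl, neg_one_mul, one_mul]
      · rw [h, if_pos h11, if_neg (by decide), neg_one_mul, neg_neg, one_mul])
    (fun d => by simp) (fun d => by
      change κ _ * P _ + 0 = κ d * P d + σ d * M.len d
      rw [hκ, h1, add_zero, hσ])
  have hdir : ∀ d, pos d < pos (M.rev d) ↔ s d = 0 := by
    intro d
    rw [hp, lt_add_iff_pos_right, mul_pos_iff_of_pos_right (M.len_pos d)]
    simp only [hσdef]
    split_ifs with h4 <;> simp [h4]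
  refine ⟨pos, ⟨fun d => by rw [hp', add_zero], fun d => ?_⟩, fun d => ?_⟩
  · rw [hp, add_sub_cancel_left, abs_mul, abs_of_pos (M.len_pos d)]
    simp only [hσdef]
    split_ifs <;> simp
  · rw [hdir, hdir, hs']
    simp only [hαdef]
    rcases h01 (s d) with h | h <;> by_cases h4 : M.angle d = 180 <;>
      simp only [h, h4, if_true, if_false, ne_eq, not_true, not_false_eq_true] <;> decide

/-- The flat folding of the cycle of a face can be moved over a placement of the graph. -/
theorem IsPlacement.exists_tour {pos : D → ℝ} (hP : M.IsPlacement pos) (hM : M.IsConsistent)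
    (hdir : ∀ d, M.angle d ≠ 180 ↔
      (pos d < pos (M.rev d) ↔ pos (M.rot d) < pos (M.rev (M.rot d)))) {f : M.Face}
    (Φ : (M.eulerCycle f).FlatFolding) :
    ∃ Ψ : (M.eulerCycle f).FlatFolding, Φ.Equivalent Ψ ∧ Ψ.pos = M.tourPos pos f := by
  have E := eulerCycle_isFaceCycle f
  refine Φ.exists_equivalent_pos (E.connected.placement_unique Φ.isPlacement (E.isPlacement hP)
    fun p => ?_)
  rw [← Φ.foldedAngle_eq_180_iff]
  have hpn := fun d => (hP.pos_ne d)
  have hflip : ∀ d, pos (M.rev d) < pos d ↔ ¬ pos d < pos (M.rev d) := fun d =>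
    ⟨fun h => h.not_gt, fun h => lt_of_le_of_ne (not_lt.1 h) (hP.pos_ne d)⟩
  have key : ∀ x : M.FaceDart f, M.angle (M.tourNext f x) ≠ 180 ↔
      (pos (M.tourNext f x) < pos (M.rev (M.tourNext f x)) ↔ pos (M.rev x) < pos x) := fun x => by
    have h1 := hdir (M.tourNext f x)
    have h2 : M.rot (M.tourNext f x) = M.rev x := M.rot_faceNext x
    rw [h2, M.rev_rev] at h1
    exact h1
  rcases p with ⟨x, _ | _⟩
  · obtain ⟨y, rfl⟩ := (M.tourNext f).surjective x
    rw [E.rot_false, Equiv.Perm.inv_eq_iff_eq.2 rfl, E.rev, E.rev, E.angle_false]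
    change _ ↔ (pos (M.tourNext f y) < pos (M.rev (M.tourNext f y)) ↔ pos (M.rev y) < pos y)
    exact key y
  · rw [E.rot_true, E.rev, E.rev, E.angle_true]
    change _ ↔ (pos (M.rev x) < pos x ↔
      pos (M.tourNext f x) < pos (M.rev (M.tourNext f x)))
    rw [iff_comm (a := pos (M.rev x) < pos x), ← key x]
    have := hM.angle_mem (M.tourNext f x)
    omega

end Place

end AngledMap

/-! ### Counting foldings by the patterns of the faces -/

namespace AngledMap

section Count

variable {D : Type*} {M : AngledMap D}

/-- The pairs of sides of edges that touch in the face `f`. -/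
def FlatFolding.visibility (F : M.FlatFolding) (f : M.Face) : Set (Sym2 (M.FaceDart f)) :=
  {s | s.map Subtype.val ∈ F.touching}

theorem IsPlane.outer_cases (h : M.IsPlane) (f : M.Face) :
    (∀ d, M.faceOf d = f ↔ d ∈ M.outer) ∨ ∀ d, M.faceOf d = f → d ∉ M.outer := by
  obtain ⟨f₀, hf₀⟩ := h.outer_face
  by_cases hf : f = f₀
  · exact Or.inl fun d => by rw [hf₀, hf]
  · exact Or.inr fun d hd hdo => hf (hd.symm.trans ((hf₀ d).1 hdo))

theorem FlatFolding.visibility_mem_range [Finite D] (h : M.IsPlane) (F : M.FlatFolding)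
    (f : M.Face) : F.visibility f ∈ Set.range (M.internalPattern f) := by
  refine ⟨(eulerCycle_isFaceCycle f).fold F h.connected (h.outer_cases f), ?_⟩
  ext s
  induction s using Sym2.ind with
  | _ x y => exact (eulerCycle_isFaceCycle f).mem_touching_fold_iff F h.connected _ x y

/-- Every touching pair lies in one face, so the patterns of the faces together contain all touching
pairs. -/
theorem FlatFolding.equivalent_of_visibility_eq [Finite D] (h : M.IsPlane) {F G : M.FlatFolding}
    (hFG : ∀ f, F.visibility f = G.visibility f) : F.Equivalent G := by
  refine FlatFolding.equivalent_of_touching_subset h.connected fun s hs => ?_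
  have hs' := hs
  obtain ⟨a, b, d, e, hde, hn, rfl⟩ := hs'
  obtain ⟨hab, hd, he, hbe⟩ := F.view_iff.1 hde
  have ho := over_iff_exitsRight (M := M) hab le_rfl hab.2.2.1
  have hf := F.faceOf_eq_of_touching h.connected ((ho d).1 hd) ((ho e).1 he) hbe
    fun g hg hdg => hn g ⟨F.view_iff.2 ⟨hab, hd, (ho g).2 hg, hdg.1⟩,
      F.view_iff.2 ⟨hab, (ho g).2 hg, he, hdg.2⟩⟩
  have h1 : s((⟨d, hf⟩ : M.FaceDart (M.faceOf (M.rev e))), ⟨M.rev e, rfl⟩) ∈ F.visibility _ := hs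
  rw [hFG] at h1
  exact h1

theorem internalPattern_congr {f : M.Face} {Φ Ψ : (M.eulerCycle f).FlatFolding}
    (h : Φ.Equivalent Ψ) : M.internalPattern f Φ = M.internalPattern f Ψ := by
  unfold internalPattern
  rw [h.touching_eq]

/-- A flat folding whose faces show given patterns. -/
theorem IsPlane.exists_visibility_eq [Fintype D] (h : M.IsPlane) (hM : M.IsConsistent)
    (Φ : ∀ f, (M.eulerCycle f).FlatFolding) :
    ∃ F : M.FlatFolding, ∀ f, F.visibility f = M.internalPattern f (Φ f) := by
  obtain ⟨pos, hP, hdir⟩ := h.exists_placement hM fun f => ⟨Φ f⟩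
  choose Ψ hΨ hpos using fun f => hP.exists_tour hM hdir (Φ f)
  obtain ⟨f₀, hf₀⟩ := h.outer_face
  obtain ⟨F, -, hF⟩ := exists_flatFolding_of_faces h.connected hM hP hf₀ Ψ hpos
  exact ⟨F, fun f => by rw [internalPattern_congr (hΨ f)]; exact Set.ext (hF f)⟩

variable (M) in
/-- The patterns of the faces of a flat folding. -/
def visibilityClass (q : M.FoldingClass) (f : M.Face) : Set (Sym2 (M.FaceDart f)) :=
  Quotient.lift (s := FlatFolding.setoid) (fun F : M.FlatFolding => F.visibility f)
    (fun F G hFG => by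
      unfold FlatFolding.visibility
      rw [FlatFolding.Equivalent.touching_eq hFG]) q

theorem IsPlane.bijective_visibilityClass [Fintype D] (h : M.IsPlane) (hM : M.IsConsistent) :
    ∃ Θ : M.FoldingClass → ∀ f, Set.range (M.internalPattern f), Function.Bijective Θ := by
  refine ⟨fun q f => ⟨M.visibilityClass q f, q.inductionOn fun F => F.visibility_mem_range h f⟩,
    fun p q hpq => ?_, fun p => ?_⟩
  · induction p, q using Quotient.inductionOn₂ with
    | _ F G =>
      refine Quotient.sound (s := FlatFolding.setoid)
        (FlatFolding.equivalent_of_visibility_eq h fun f => ?_)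
      exact congrArg Subtype.val (congrFun hpq f)
  · choose Φ hΦ using fun f => (p f).2
    obtain ⟨F, hF⟩ := h.exists_visibility_eq hM Φ
    exact ⟨Quotient.mk _ F, funext fun f => Subtype.ext ((hF f).trans (hΦ f))⟩

theorem IsPlane.finite_foldingClass [Fintype D] (h : M.IsPlane) (hM : M.IsConsistent) :
    Finite M.FoldingClass := by
  obtain ⟨Θ, hΘ⟩ := h.bijective_visibilityClass hM
  have : ∀ f : M.Face, Finite (Sym2 (M.FaceDart f)) := fun f => Quot.finite _
  exact Finite.of_injective Θ hΘ.1

theorem IsPlane.numFlatFoldings_eq [Fintype D] (h : M.IsPlane) (hM : M.IsConsistent) :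
    M.numFlatFoldings = ∏ f : M.Face, M.numPatterns f := by
  obtain ⟨Θ, hΘ⟩ := h.bijective_visibilityClass hM
  unfold numFlatFoldings numPatterns
  rw [Nat.card_congr (Equiv.ofBijective Θ hΘ), Nat.card_pi]
  rfl

end Count

end AngledMap

/-! ### First-return maps of noncrossing permutations -/

namespace CyclicOrder

section Return

variable {Y : Type*} [Finite Y] {r : Y → ℕ} {ν : Equiv.Perm Y} (h : Noncrossing r ν)
  (hr : Function.Injective r)

include h hr

/-- The points of a component lie in the order of its rotation. -/
theorem Noncrossing.arc_pow {d : Y} {n : ℕ} (hn : (ν ^ n) d ≠ d) :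
    Arc r d ((ν ^ n) d) ((ν ^ (n + 1)) d) := by
  rw [pow_succ', Equiv.Perm.mul_apply]
  have hc : ν.SameCycle ((ν ^ n) d) d := Equiv.Perm.SameCycle.symm ⟨n, by simp⟩
  set x := (ν ^ n) d
  have h1 := mem_of_sameCycle (S := {z | ¬ Arc r x z (ν x)})
    (fun z hz => by simpa [h.arc_iff] using hz) (not_arc_left r x _) hc
  have h2 : r x ≠ r (ν x) := fun h2 => hn
    (mem_of_sameCycle (S := {z | z = x}) (by rintro z rfl; exact (hr h2).symm) rfl hc).symm
  have h3 := hr.ne hn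
  simp only [Set.mem_ofPred_eq, Arc] at h1 ⊢
  omega

/-- Since the orbit runs in cyclic order, the arc over several steps is the union of the arcs of the
single steps and the intermediate points. -/
theorem Noncrossing.arc_pow_iff {d b : Y} {n : ℕ} (hn : ∀ k, 0 < k → k ≤ n → (ν ^ k) d ≠ d) :
    Arc r d b ((ν ^ (n + 1)) d) ↔ (∃ k ≤ n, Arc r ((ν ^ k) d) b (ν ((ν ^ k) d))) ∨
      ∃ k, 0 < k ∧ k ≤ n ∧ b = (ν ^ k) d := by
  induction n with
  | zero =>
    constructor
    · exact fun h' => Or.inl ⟨0, le_rfl, by simpa using h'⟩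
    · rintro (⟨k, hk, h'⟩ | ⟨k, hk, hk', -⟩)
      · obtain rfl : k = 0 := by omega
        simpa using h'
      · omega
  | succ n ih =>
    have h1 := h.arc_pow hr (hn (n + 1) (by omega) le_rfl)
    have h2 : Arc r d b ((ν ^ (n + 1 + 1)) d) ↔ Arc r d b ((ν ^ (n + 1)) d) ∨
        Arc r ((ν ^ (n + 1)) d) b ((ν ^ (n + 1 + 1)) d) ∨ b = (ν ^ (n + 1)) d := by
      rw [← hr.eq_iff]
      unfold Arc at h1 ⊢
      omega
    rw [h2, ih fun k hk hk' => hn k hk (by omega), pow_succ' ν (n + 1), Equiv.Perm.mul_apply]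
    constructor
    · rintro ((⟨k, hk, h'⟩ | ⟨k, hk, hk', h'⟩) | h' | h')
      · exact Or.inl ⟨k, by omega, h'⟩
      · exact Or.inr ⟨k, hk, by omega, h'⟩
      · exact Or.inl ⟨_, le_rfl, h'⟩
      · exact Or.inr ⟨_, by omega, le_rfl, h'⟩
    · rintro (⟨k, hk, h'⟩ | ⟨k, hk, hk', h'⟩)
      · rcases hk.eq_or_lt with rfl | hk
        · exact Or.inr (Or.inl h')
        · exact Or.inl (Or.inl ⟨k, by omega, h'⟩)
      · rcases hk'.eq_or_lt with rfl | hk'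
        · exact Or.inr (Or.inr h')
        · exact Or.inl (Or.inr ⟨k, hk, by omega, h'⟩)

/-- An arc of the first-return map splits into arcs of `ν`, each of which is invariant under all
powers of `ν`; the intermediate points are not in the image of `φ`. -/
theorem Noncrossing.of_return {Z : Type*} {φ : Z → Y} {ν' : Equiv.Perm Z} {r' : Z → ℕ}
    (hr' : ∀ y z, r' y < r' z ↔ r (φ y) < r (φ z))
    (hν : ∀ y, ∃ n, (ν ^ (n + 1)) (φ y) = φ (ν' y) ∧
      ∀ k, 0 < k → k ≤ n → (ν ^ k) (φ y) ∉ Set.range φ) : Noncrossing r' ν' := by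
  intro d b hb
  have hA : ∀ x y z, Arc r' x y z ↔ Arc r (φ x) (φ y) (φ z) := fun x y z => by
    unfold Arc
    simp only [hr']
  obtain ⟨n, h1, h2⟩ := hν d
  obtain ⟨m, h3, -⟩ := hν b
  have h4 : ∀ k, 0 < k → k ≤ n → (ν ^ k) (φ d) ≠ φ d := fun k hk hk' h5 => h2 k hk hk' ⟨d, h5.symm⟩
  rw [hA, ← h1, h.arc_pow_iff hr h4] at hb ⊢
  rcases hb with ⟨k, hk, hb⟩ | ⟨k, hk, hk', hb⟩
  · refine Or.inl ⟨k, hk, ?_⟩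
    rw [← h3]
    exact mem_of_sameCycle (S := {z | Arc r ((ν ^ k) (φ d)) z (ν ((ν ^ k) (φ d)))})
      (fun z hz => h _ z hz) hb ⟨((m + 1 : ℕ) : ℤ), by rw [zpow_natCast]⟩
  · exact absurd ⟨b, hb⟩ (h2 k hk hk')

/-- Merged corners add their angles. For `x` on the arc from `d` to `ν x`, the truth values of `r d
< r x` and `r x < r (ν x)` add up to 1 plus that of `r d < r (ν x)`; the terms in `σ` telescope. -/
theorem Noncrossing.turn_pow (σ : Y → ℤ) {d : Y} {n : ℕ}
    (hn : ∀ k, 0 < k → k ≤ n → (ν ^ k) d ≠ d) :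
    2 - (2 * (open Classical in if r d < r ((ν ^ (n + 1)) d) then 1 else 0) + σ d -
      σ ((ν ^ (n + 1)) d)) = ∑ i ∈ Finset.range (n + 1), (2 - turn r σ ν ((ν ^ i) d)) := by
  induction n with
  | zero =>
    simp only [zero_add, Finset.range_one, Finset.sum_singleton, pow_zero, pow_one,
      Equiv.Perm.one_apply]
    unfold turn
    congr!
  | succ n ih =>
    rw [Finset.sum_range_succ, ← ih fun k hk hk' => hn k hk (by omega)]
    have h1 := h.arc_pow hr (hn (n + 1) (by omega) le_rfl)
    unfold turn
    rw [← Equiv.Perm.mul_apply, ← pow_succ' ν (n + 1)]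
    unfold Arc at h1
    split_ifs <;> omega

end Return

end CyclicOrder

/-! ### Restriction of a folding to a subgraph -/

namespace AngledMap

open CyclicOrder

section Restrict

variable {D : Type*} {M : AngledMap D} {S : Set D} {pos : D → ℝ}

theorem returnTime_min {d : S} {k : ℕ} (hk : 0 < k) (hk' : k < M.returnTime S d) :
    (M.rot ^ k) (d : D) ∉ S := fun h =>
  (Nat.sInf_le (s := {n | 0 < n ∧ (M.rot ^ n) (d : D) ∈ S}) ⟨hk, h⟩).not_gt hk'

theorem IsPlacement.pow_rot (hP : M.IsPlacement pos) (n : ℕ) (d : D) :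
    pos ((M.rot ^ n) d) = pos d := by
  induction n with
  | zero => rfl
  | succ n ih => rw [pow_succ', Equiv.Perm.mul_apply, hP.rot, ih]

theorem IsPlacement.diskPerm_pow (hP : M.IsPlacement pos) {c : ℝ} {y : M.DiskDart pos c}
    (hy : pos y = c) (n : ℕ) : ((hP.diskPerm c ^ n) y : D) = (M.rot ^ n) y := by
  induction n with
  | zero => rfl
  | succ n ih =>
    rw [pow_succ', Equiv.Perm.mul_apply, pow_succ', Equiv.Perm.mul_apply,
      hP.diskPerm_of_eq _ (by rw [ih, hP.pow_rot, hy]), ih]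

variable [Finite D] (hS : ∀ d ∈ S, M.rev d ∈ S)

theorem restrict_rev (d : S) : ((M.restrict S hS).rev d : D) = M.rev d := rfl

theorem restrict_rot (d : S) :
    ((M.restrict S hS).rot d : D) = (M.rot ^ M.returnTime S d) d := rfl

theorem returnTime_eq_one {d : S} (h : M.rot d ∈ S) : M.returnTime S d = 1 :=
  le_antisymm (Nat.sInf_le (s := {n | 0 < n ∧ (M.rot ^ n) (d : D) ∈ S})
    ⟨one_pos, by rwa [pow_one]⟩) (M.returnTime_spec S d).1

theorem IsPlacement.restrict (hP : M.IsPlacement pos) :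
    (M.restrict S hS).IsPlacement fun d => pos d where
  rot d := hP.pow_rot _ d
  abs d := hP.abs d

/-- The boundary points of a subgraph. -/
def restrictDisk (pos : D → ℝ) (c : ℝ)
    (y : (M.restrict S hS).DiskDart (fun d => pos d) c) : M.DiskDart pos c := ⟨y.1.1, y.2⟩

theorem mem_range_restrictDisk {c : ℝ} {y : M.DiskDart pos c} :
    y ∈ Set.range (restrictDisk hS pos c) ↔ (y : D) ∈ S := by
  constructor
  · rintro ⟨x, rfl⟩
    exact x.1.2
  · intro hy
    exact ⟨⟨⟨y, hy⟩, y.2⟩, rfl⟩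

/-- The disk permutation of the subgraph is the first return of that of the graph: at a vertex after
the return time of the rotation, along a passing edge at once. -/
theorem diskPerm_restrict (hP : M.IsPlacement pos) {c : ℝ}
    (y : (M.restrict S hS).DiskDart (fun d => pos d) c) :
    ∃ n, (hP.diskPerm c ^ (n + 1)) (restrictDisk hS pos c y) =
        restrictDisk hS pos c ((hP.restrict hS).diskPerm c y) ∧
      (∀ k, 0 < k → k ≤ n → (hP.diskPerm c ^ k) (restrictDisk hS pos c y) ∉
        Set.range (restrictDisk hS pos c)) ∧ (pos y = c → n + 1 = M.returnTime S y) := by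
  by_cases hy : pos y = c
  · have hy' : pos (restrictDisk hS pos c y) = c := hy
    have h1 := (M.returnTime_spec S y.1).1
    refine ⟨M.returnTime S y - 1, Subtype.ext ?_, fun k hk hk' => ?_, fun _ => by omega⟩
    · rw [hP.diskPerm_pow hy']
      have h2 := congrArg Subtype.val ((hP.restrict hS).diskPerm_of_eq y hy)
      change _ = ((((hP.restrict hS).diskPerm c y : S)) : D)
      rw [h2, restrict_rot, Nat.sub_add_cancel h1]
      rfl
    · rw [mem_range_restrictDisk, hP.diskPerm_pow hy']
      exact returnTime_min hk (by omega)
  · refine ⟨0, Subtype.ext ?_, fun k hk hk' => by omega, fun h => absurd h hy⟩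
    have hy' : pos (restrictDisk hS pos c y) ≠ c := hy
    have h2 := congrArg Subtype.val ((hP.restrict hS).diskPerm_of_ne y hy)
    rw [zero_add, pow_one, hP.diskPerm_of_ne _ hy']
    exact h2.symm

variable {B : D → D → Prop}

theorem IsStack.restrict (h : M.IsStack pos B) :
    (M.restrict S hS).IsStack (fun d => pos d) fun d e => B d e where
  irrefl d := h.irrefl d
  trans c d e g hd he hg := h.trans c d e g hd he hg
  total c d e hd he hne := h.total c d e hd he fun h' => hne (Subtype.ext h')

theorem IsStack.diskRank_restrict (h : M.IsStack pos B) {c : ℝ}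
    (y z : (M.restrict S hS).DiskDart (fun d => pos d) c) :
    (M.restrict S hS).diskRank (fun d => pos d) (fun d e => B d e) c y <
      (M.restrict S hS).diskRank (fun d => pos d) (fun d e => B d e) c z ↔
      M.diskRank pos B c (restrictDisk hS pos c y) <
        M.diskRank pos B c (restrictDisk hS pos c z) := by
  rw [(h.restrict hS).diskRank_lt_iff, h.diskRank_lt_iff]
  rfl

theorem side_restrict {c : ℝ} (y : (M.restrict S hS).DiskDart (fun d => pos d) c) :
    (M.restrict S hS).side (fun d => pos d) c y = M.side pos c (restrictDisk hS pos c y) := rfl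

variable (F : M.FlatFolding)

theorem FlatFolding.noncrossing_restrict (c : ℝ) :
    Noncrossing ((M.restrict S hS).diskRank (fun d => F.pos d) (fun d e => F.below d e) c)
      ((F.isPlacement.restrict hS).diskPerm c) :=
  (F.noncrossing c).of_return (F.isStack.diskRank_injective c) (F.isStack.diskRank_restrict hS)
    fun y => by
      obtain ⟨n, h1, h2, -⟩ := diskPerm_restrict hS F.isPlacement y
      exact ⟨n, h1, h2⟩

theorem FlatFolding.angle_restrict (d : S) : ((M.restrict S hS).angle d : ℤ) =
    180 * (2 - turn ((M.restrict S hS).diskRank (fun d => F.pos d) (fun d e => F.below d e)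
      (F.pos d)) ((M.restrict S hS).side (fun d => F.pos d) (F.pos d))
      ((F.isPlacement.restrict hS).diskPerm (F.pos d))
      ⟨d, (F.isPlacement.restrict hS).exits_self d⟩) := by
  classical
  set y : (M.restrict S hS).DiskDart (fun d => F.pos d) (F.pos d) :=
    ⟨d, (F.isPlacement.restrict hS).exits_self d⟩ with hy
  obtain ⟨n, h1, h2, h3⟩ := diskPerm_restrict hS F.isPlacement y
  have h4 := (F.noncrossing (F.pos d)).turn_pow (F.isStack.diskRank_injective _)
    (M.side F.pos (F.pos d)) (d := restrictDisk hS F.pos (F.pos d) y) (n := n)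
    fun k hk hk' h5 => h2 k hk hk' ⟨y, h5.symm⟩
  have h5 : 2 - turn ((M.restrict S hS).diskRank (fun d => F.pos d) (fun d e => F.below d e)
      (F.pos d)) ((M.restrict S hS).side (fun d => F.pos d) (F.pos d))
      ((F.isPlacement.restrict hS).diskPerm (F.pos d)) y =
      ∑ i ∈ Finset.range (n + 1), (2 - turn (M.diskRank F.pos F.below (F.pos d))
        (M.side F.pos (F.pos d)) (F.isPlacement.diskPerm (F.pos d))
        ((F.isPlacement.diskPerm (F.pos d) ^ i) (restrictDisk hS F.pos (F.pos d) y))) := by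
    refine Eq.trans ?_ h4
    unfold turn
    rw [h1]
    simp only [F.isStack.diskRank_restrict hS, side_restrict]
  have h6 : ((M.restrict S hS).angle d : ℤ) =
      ∑ i ∈ Finset.range (n + 1), (M.angle ((M.rot ^ i) d) : ℤ) := by
    rw [h3 rfl, ← Nat.cast_sum]
    rfl
  rw [h5, h6, Finset.mul_sum]
  refine Finset.sum_congr rfl fun i _ => ?_
  have h7 : (((F.isPlacement.diskPerm (F.pos d)) ^ i) (restrictDisk hS F.pos (F.pos d) y) : D) =
      (M.rot ^ i) d := F.isPlacement.diskPerm_pow rfl i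
  rw [← h7]
  exact F.angle_eq_turn_of_eq _ (by rw [h7, F.isPlacement.pow_rot])

end Restrict

end AngledMap

namespace AngledMap

open CyclicOrder

/-! ### The exterior face of a subgraph -/

section RestrictOuter

variable {D : Type*} {M : AngledMap D} {S : Set D}

/-- Two darts are linked if they border the same face of the subgraph with the darts in `S`. -/
abbrev FaceLink (M : AngledMap D) (S : Set D) : D → D → Prop :=
  Relation.EqvGen fun a b => b = M.faceNext a ∨ (a ∉ S ∧ b = M.rev a)

theorem faceLink_rev {d : D} (h : d ∉ S) : M.FaceLink S d (M.rev d) :=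
  .rel _ _ (Or.inr ⟨h, rfl⟩)

variable [Finite D] (hS : ∀ d ∈ S, M.rev d ∈ S)
  (hM : M.Connected) (F : M.FlatFolding) {c : ℝ}

theorem faceLink_of_faceOf_eq {d e : D} (h : M.faceOf d = M.faceOf e) : M.FaceLink S d e := by
  have h1 : M.faceNext.SameCycle d e :=
    Quotient.exact (s := Equiv.Perm.SameCycle.setoid M.faceNext) h
  exact mem_of_sameCycle (S := {z | M.FaceLink S d z})
    (fun z hz => Relation.EqvGen.trans _ _ _ hz (.rel _ _ (Or.inl rfl))) (.refl _) h1

include hM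

/-- Descend from `d` to the lowest edge. Consecutive edges share a face and all edges that are
crossed are deleted, so the faces on the way merge with the exterior face. -/
theorem FlatFolding.exists_faceLink_bottom {d : D} (hd : M.ExitsRight F.pos c d)
    (hn : ∀ e ∈ S, M.ExitsRight F.pos c e → ¬ F.below e d) :
    ∃ x ∈ M.outer, M.FaceLink S (M.rev d) x := by
  induction hr : M.diskRank F.pos F.below c ⟨d, Or.inl hd⟩ using Nat.strong_induction_on
    generalizing d with
  | _ n ih =>
    by_cases hex : ∃ e, M.ExitsRight F.pos c e ∧ F.below e d
    · obtain ⟨e, he, hed⟩ := hex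
      obtain ⟨g, hg, hgd, -, hng⟩ := F.isStack.exists_prev he hed
      have hgS : g ∉ S := fun h => hn g h hg hgd
      have h1 := (F.isStack.diskRank_lt_iff (c := c) ⟨g, Or.inl hg⟩ ⟨d, Or.inl hd⟩).2
        ((prec_right_iff hg hd).2 hgd)
      obtain ⟨x, hx, h2⟩ := ih _ (hr ▸ h1) hg (fun e heS he heg => hn e heS he
        (F.isStack.trans c e g d he hg hd heg hgd)) rfl
      have h3 := F.faceOf_eq_of_touching hM hg hd hgd hng
      exact ⟨x, hx, (faceLink_of_faceOf_eq h3.symm).trans _ _ _ ((faceLink_rev hgS).trans _ _ _ h2)⟩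
    · push Not at hex
      exact ⟨_, F.rev_mem_outer hd hex, .refl _⟩

theorem FlatFolding.exists_faceLink_top {d : D} (hd : M.ExitsRight F.pos c d)
    (hn : ∀ e ∈ S, M.ExitsRight F.pos c e → ¬ F.below d e) (hS : ∀ d ∈ S, M.rev d ∈ S) :
    ∃ x ∈ M.outer, M.FaceLink S d x := by
  induction hr : Fintype.card (M.DiskDart F.pos c) - M.diskRank F.pos F.below c ⟨d, Or.inl hd⟩
    using Nat.strong_induction_on generalizing d with
  | _ n ih =>
    by_cases hex : ∃ e, M.ExitsRight F.pos c e ∧ F.below d e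
    · obtain ⟨e, he, hde⟩ := hex
      obtain ⟨g, hg, hdg, -, hng⟩ := F.isStack.exists_next he hde
      have hgS : M.rev g ∉ S := fun h => hn g (by simpa [M.rev_rev] using hS _ h) hg hdg
      have h1 := (F.isStack.diskRank_lt_iff (c := c) ⟨d, Or.inl hd⟩ ⟨g, Or.inl hg⟩).2
        ((prec_right_iff hd hg).2 hdg)
      have h4 := F.isStack.diskRank_lt_card (c := c) ⟨g, Or.inl hg⟩
      obtain ⟨x, hx, h2⟩ := ih _ (by omega) hg (fun e heS he hge => hn e heS he
        (F.isStack.trans c d g e hd hg he hdg hge)) rfl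
      have h3 := F.faceOf_eq_of_touching hM hd hg hdg hng
      have h5 := faceLink_rev (M := M) hgS
      rw [M.rev_rev] at h5
      exact ⟨x, hx, (faceLink_of_faceOf_eq h3).trans _ _ _ (h5.trans _ _ _ h2)⟩
    · push Not at hex
      exact ⟨_, F.mem_outer hd hex, .refl _⟩

/-- A flat folding gives a flat folding of every subgraph. -/
noncomputable def FlatFolding.restrict : (M.restrict S hS).FlatFolding :=
  .ofStack (F.isPlacement.restrict hS) (F.isStack.restrict hS)
    (fun c _ => F.noncrossing_restrict hS c) (F.angle_restrict hS)
    (fun _ _ _ hd hn => F.exists_faceLink_bottom hM hd fun e he => hn ⟨e, he⟩)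
    (fun _ _ _ hd hn => F.exists_faceLink_top hM hd (fun e he => hn ⟨e, he⟩) hS)

end RestrictOuter

/-! ### The boundary graph of a face -/

section Boundary

variable {D : Type*} {M : AngledMap D} (f : M.Face)

/-- Only edges with neither side in `f` are deleted, so crossing them never enters or leaves `f`. -/
theorem faceOf_eq_iff_of_faceLink {x y : D}
    (h : M.FaceLink {d | M.faceOf d = f ∨ M.faceOf (M.rev d) = f} x y) :
    M.faceOf x = f ↔ M.faceOf y = f := by
  induction h with
  | rel x y h =>
    rcases h with rfl | ⟨h, rfl⟩
    · rw [M.faceOf_faceNext]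
    · simp only [Set.mem_ofPred_eq, not_or] at h
      exact iff_of_false h.1 h.2
  | refl => rfl
  | symm _ _ _ ih => exact ih.symm
  | trans _ _ _ _ _ ih1 ih2 => exact ih1.trans ih2

variable [Finite D]

/-- Both darts at a corner of `f` survive, so no rotation step is skipped there and the corner is
not merged with another one. -/
theorem faceNext_boundaryGraph {d : {d | M.faceOf d = f ∨ M.faceOf (M.rev d) = f}}
    (hd : M.faceOf d = f) : ((M.boundaryGraph f).faceNext d : D) = M.faceNext d := by
  have h1 : M.faceOf (M.faceNext d) = f := by rw [M.faceOf_faceNext, hd]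
  have h2 : M.rot (M.faceNext d) ∈ {d | M.faceOf d = f ∨ M.faceOf (M.rev d) = f} := by
    rw [rot_faceNext]
    exact Or.inr (by rwa [M.rev_rev])
  have h3 : (M.boundaryGraph f).rot ⟨M.faceNext d, Or.inl h1⟩ = (M.boundaryGraph f).rev d := by
    refine Subtype.ext ?_
    unfold boundaryGraph
    rw [restrict_rot, returnTime_eq_one h2, pow_one, restrict_rev]
    exact rot_faceNext _
  have h4 : (M.boundaryGraph f).faceNext d = ⟨M.faceNext d, Or.inl h1⟩ := by
    exact (M.boundaryGraph f).rot.injective ((rot_faceNext (M := M.boundaryGraph f) d).trans h3.symm)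
  rw [h4]

theorem angle_boundaryGraph {d : {d | M.faceOf d = f ∨ M.faceOf (M.rev d) = f}}
    (hd : M.faceOf d = f) : (M.boundaryGraph f).angle d = M.angle d := by
  have h1 : M.rot d ∈ {d | M.faceOf d = f ∨ M.faceOf (M.rev d) = f} := by
    refine Or.inr ?_
    rw [← M.faceOf_faceNext, faceNext_rev, Equiv.Perm.inv_eq_iff_eq.2 rfl, hd]
  change ∑ i ∈ Finset.range (M.returnTime _ d), M.angle ((M.rot ^ i) d) = _
  rw [returnTime_eq_one h1, Finset.sum_range_one, pow_zero, Equiv.Perm.one_apply]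

theorem mem_outer_boundaryGraph {d : {d | M.faceOf d = f ∨ M.faceOf (M.rev d) = f}}
    (hd : M.faceOf d = f) : d ∈ (M.boundaryGraph f).outer ↔ ∃ e ∈ M.outer, M.faceOf e = f := by
  constructor
  · rintro ⟨e, he, h⟩
    exact ⟨e, he, (faceOf_eq_iff_of_faceLink f h).1 hd⟩
  · rintro ⟨e, he, h⟩
    exact ⟨e, he, faceLink_of_faceOf_eq (hd.trans h.symm)⟩

/-- The sides of edges in a face as darts of the boundary of the face. -/
def boundaryDart (x : M.FaceDart f) : {d | M.faceOf d = f ∨ M.faceOf (M.rev d) = f} :=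
  ⟨x, Or.inl x.2⟩

theorem boundaryDart_tourNext (x : M.FaceDart f) :
    boundaryDart f (M.tourNext f x) = (M.boundaryGraph f).faceNext (boundaryDart f x) :=
  Subtype.ext (faceNext_boundaryGraph f (d := boundaryDart f x) x.2).symm

theorem faceOf_boundaryDart (x y : M.FaceDart f) : (M.boundaryGraph f).faceOf (boundaryDart f x) =
    (M.boundaryGraph f).faceOf (boundaryDart f y) := by
  have h1 : M.faceNext.SameCycle (x : D) y :=
    Quotient.exact (s := Equiv.Perm.SameCycle.setoid M.faceNext) (x.2.trans y.2.symm)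
  have h2 := mem_of_sameCycle (S := {z : D | ∃ hz : M.faceOf z = f,
    (M.boundaryGraph f).faceOf (boundaryDart f x) =
      (M.boundaryGraph f).faceOf (boundaryDart f ⟨z, hz⟩)}) (fun z hz => by
        obtain ⟨hz, h⟩ := hz
        refine ⟨(M.faceOf_faceNext z).trans hz, h.trans ?_⟩
        rw [← (M.boundaryGraph f).faceOf_faceNext, ← boundaryDart_tourNext]
        rfl) ⟨x.2, rfl⟩ h1
  exact h2.2

/-- The walk around `f`, its corners and its exteriority are unaffected by the deletion, so the
cycle is the same. -/
theorem IsPlane.boundaryGraph_isFaceCycle (h : M.IsPlane) (x₀ : M.FaceDart f) : (M.boundaryGraph f).IsFaceCycle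
    ((M.boundaryGraph f).faceOf (boundaryDart f x₀)) (M.eulerCycle f) (boundaryDart f)
    (M.tourNext f) where
  inj x y h := Subtype.ext (Subtype.mk.inj h)
  mem d := by
    constructor
    · rintro ⟨x, rfl⟩
      exact faceOf_boundaryDart f x x₀
    · intro hd
      have h1 : (M.boundaryGraph f).faceNext.SameCycle (boundaryDart f x₀) d :=
        Quotient.exact (s := Equiv.Perm.SameCycle.setoid _) hd.symm
      exact mem_of_sameCycle (S := Set.range (boundaryDart f)) (by
        rintro _ ⟨x, rfl⟩
        exact ⟨_, boundaryDart_tourNext f x⟩) ⟨x₀, rfl⟩ h1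
  next := boundaryDart_tourNext f
  rev _ _ := rfl
  rot_true _ := rfl
  rot_false _ := rfl
  len _ := rfl
  angle_true x := by
    rw [angle_boundaryGraph f (d := boundaryDart f (M.tourNext f x)) (M.tourNext f x).2]
    rfl
  angle_false x := by
    rw [angle_boundaryGraph f (d := boundaryDart f x) x.2]
    rfl
  outer p := by
    obtain ⟨f₀, hf₀⟩ := h.outer_face
    rw [mem_outer_boundaryGraph f (d := boundaryDart f p.1) p.1.2]
    have h1 : (∃ e ∈ M.outer, M.faceOf e = f) ↔ (p.1 : D) ∈ M.outer := by
      constructor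
      · rintro ⟨e, he, hef⟩
        rw [hf₀, p.1.2, ← hef, (hf₀ e).1 he]
      · exact fun h => ⟨_, h, p.1.2⟩
    rw [h1]
    rfl

/-- Every edge of the boundary graph has a side in `f`, and all these sides lie on one closed walk.
-/
theorem connected_boundaryGraph : (M.boundaryGraph f).Connected := by
  set R : {d | M.faceOf d = f ∨ M.faceOf (M.rev d) = f} →
      {d | M.faceOf d = f ∨ M.faceOf (M.rev d) = f} → Prop :=
    fun a b => b = (M.boundaryGraph f).rot a ∨ b = (M.boundaryGraph f).rev a with hR
  have h1 : ∀ a, Relation.EqvGen R a ((M.boundaryGraph f).rot a) := fun a => .rel _ _ (Or.inl rfl)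
  have h2 : ∀ a, Relation.EqvGen R a ((M.boundaryGraph f).rev a) := fun a => .rel _ _ (Or.inr rfl)
  have h3 : ∀ a, Relation.EqvGen R a ((M.boundaryGraph f).faceNext a) := fun a => by
    have h4 := h1 ((M.boundaryGraph f).faceNext a)
    rw [rot_faceNext] at h4
    exact (h2 a).trans _ _ _ (h4.symm _ _)
  have h4 : ∀ x y, Relation.EqvGen R (boundaryDart f x) (boundaryDart f y) := fun x y => by
    have h5 : (M.boundaryGraph f).faceNext.SameCycle (boundaryDart f x) (boundaryDart f y) :=
      Quotient.exact (s := Equiv.Perm.SameCycle.setoid _) (faceOf_boundaryDart f x y)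
    exact mem_of_sameCycle (S := {z | Relation.EqvGen R (boundaryDart f x) z})
      (fun z hz => Relation.EqvGen.trans _ _ _ hz (h3 z)) (.refl _) h5
  have h5 : ∀ d, ∃ x, Relation.EqvGen R d (boundaryDart f x) := by
    rintro ⟨d, hd | hd⟩
    · exact ⟨⟨d, hd⟩, .refl _⟩
    · exact ⟨⟨M.rev d, hd⟩, h2 ⟨d, Or.inr hd⟩⟩
  intro d e
  obtain ⟨x, hx⟩ := h5 d
  obtain ⟨y, hy⟩ := h5 e
  exact hx.trans _ _ _ ((h4 x y).trans _ _ _ (hy.symm _ _))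

theorem IsPlane.outer_boundaryGraph_cases (h : M.IsPlane) (x₀ : M.FaceDart f) :
    (∀ d, (M.boundaryGraph f).faceOf d = (M.boundaryGraph f).faceOf (boundaryDart f x₀) ↔
      d ∈ (M.boundaryGraph f).outer) ∨
    ∀ d, (M.boundaryGraph f).faceOf d = (M.boundaryGraph f).faceOf (boundaryDart f x₀) →
      d ∉ (M.boundaryGraph f).outer := by
  have hE := h.boundaryGraph_isFaceCycle f x₀
  by_cases hf : ∃ e ∈ M.outer, M.faceOf e = f
  · refine Or.inl fun d => ⟨fun hd => ?_, ?_⟩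
    · obtain ⟨x, rfl⟩ := (hE.mem d).2 hd
      exact (mem_outer_boundaryGraph f (d := boundaryDart f x) x.2).2 hf
    · rintro ⟨e, he, hde⟩
      obtain ⟨f₀, hf₀⟩ := h.outer_face
      obtain ⟨e', he', hef'⟩ := hf
      have h1 : M.faceOf e = f := by rw [(hf₀ e).1 he, ← (hf₀ e').1 he', hef']
      have h2 := (faceOf_eq_iff_of_faceLink f hde).2 h1
      exact faceOf_boundaryDart f ⟨d, h2⟩ x₀
  · refine Or.inr fun d hd hdo => hf ?_
    obtain ⟨x, rfl⟩ := (hE.mem d).2 hd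
    exact (mem_outer_boundaryGraph f (d := boundaryDart f x) x.2).1 hdo

theorem IsPlane.flatFoldable_eulerCycle (h : M.IsPlane) (hf : (M.boundaryGraph f).FlatFoldable) :
    (M.eulerCycle f).FlatFoldable := by
  obtain ⟨F⟩ := hf
  obtain ⟨d, hd⟩ : ∃ d, M.faceOf d = f := Quotient.exists_rep f
  exact ⟨(h.boundaryGraph_isFaceCycle f ⟨d, hd⟩).fold F (connected_boundaryGraph f)
    (h.outer_boundaryGraph_cases f ⟨d, hd⟩)⟩

theorem FlatFolding.flatFoldable_boundaryGraph (hM : M.Connected) (F : M.FlatFolding) :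
    (M.boundaryGraph f).FlatFoldable :=
  ⟨F.restrict _ hM⟩

end Boundary

end AngledMap

theorem mainTheorem5 {D : Type*} [Fintype D] (M : AngledMap D)
    (hplane : M.IsPlane) (hangle : M.IsConsistent) :
    ((∀ f : M.Face, (M.boundaryGraph f).FlatFoldable) ↔
      ∀ f : M.Face, (M.eulerCycle f).FlatFoldable) ∧
    Finite M.FoldingClass ∧
    M.numFlatFoldings = ∏ f : M.Face, M.numPatterns f := by
  refine ⟨⟨fun h f => hplane.flatFoldable_eulerCycle f (h f), fun h f => ?_⟩,
    hplane.finite_foldingClass hangle, hplane.numFlatFoldings_eq hangle⟩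
  -- The foldings of all cycles are used even for one face: they are glued to a folding of the whole
  -- graph, which is then restricted.
  obtain ⟨F, -⟩ := hplane.exists_visibility_eq hangle fun f => (h f).some
  exact F.flatFoldable_boundaryGraph f hplane.connected
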